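/- **Setting.** Let $(M,h)$ be a smooth oriented and time-oriented Lorentzian $4$-manifold of signature $(-+++)$ with a spin structure, $G$ a compact Lie group with an $\mathrm{Ad}$-invariant positive definite inner product on its Lie algebra $\mathfrak g$, and $P\to M$ a principal $G$-bundle. Let $\rho:G\to \mathbf U(W)$ and $\chi=\chi_+\oplus\chi_-:G\to\mathbf U(V)$, $V=V_+\oplus V_-$ (orthogonal), be finite-dimensional unitary representations, $\mathscr H=P\times_\rho W$, $\mathscr S_\pm=P\times_{\chi_\pm}V_\pm$, and $\mathscr F_+=(\Sigma_+M\otimes\mathscr S_+)\oplus(\Sigma_-M\otimes\mathscr S_-)$. Let $\mathrm Y:W\to\mathfrak u(V)$ be a Yukawa map, i.e. $\mathbb R$-linear with $\mathrm Y_w(V_\pm)\subset V_\mp$ and $\mathrm Y_{\rho(g)w}\chi(g)=\chi(g)\mathrm Y_w$, and $U:\mathscr H\to\mathbb R$ a smooth $G$-invariant function. **Conventions.** $(e_\mu)$ is a positively oriented, future directed orthonormal frame with dual frame $(e^\mu)$, $\eta_{\mu\nu}=h(e_\mu,e_\nu)$, $(\xi_a)$ is an orthonormal frame of $\mathrm{Ad}\,P$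 (with $\xi^a=\xi_a$), $(W_k)$ is a unitary frame of $\mathscr H$; repeated indices are summed. Hermitian products are conjugate linear in the first slot. Clifford multiplication satisfies $e_\mu e_\nu+e_\nu e_\mu=-2\eta_{\mu\nu}$, is symmetric for the spinor product $\langle\psi,\phi\rangle=\psi^\dagger\gamma_0\phi$ in the Weyl representation, and acts on $2$-forms by $\alpha\cdot\Psi=\tfrac12\alpha^{\mu\nu}e_\mu\cdot e_\nu\cdot\Psi$. $\nabla_\omega$ denotes the connections induced by the Levi-Civita connection and $\omega$; $\Box_\omega=\operatorname{Tr}\nabla_\omega^2=-\nabla_\omega^*\nabla_\omega$; $\mathrm d_\omega^*$ is the twisted codifferential, $(\mathrm d^*_\omega F_\omega)_\nu=-\eta^{\mu\lambda}(\nabla_\omega F_\omega)_{\mu\lambda\nu}$, with the index of the derivative first; $F_\omega=\mathrm d\omega+\tfrac12[\omega\wedge\omega]$ has components $F_{\mu\nu}$; $\slashed{\mathrm D}_\omega\Psi=\eta^{\mu\nu}e_\mu\cdot(\nabla_\omega\Psi)_\nu$; $\mathrm Y_{\nabla_\omega\Phi}\cdot\Psi=\eta^{\mu\nu}e_\mu\cdot\mathrm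 Y_{(\nabla_\omega\Phi)_\nu}\Psi$; $\mathrm{Re}\langle\alpha,\operatorname{grad}U_\Phi\rangle=\mathrm dU_\Phi(\alpha)$ along the fibres; $R_{\mu\nu\lambda\rho}=h([\nabla_{e_\mu},\nabla_{e_\nu}]e_\lambda-\nabla_{[e_\mu,e_\nu]}e_\lambda,e_\rho)$, $R_{\mu\nu}=R_{\lambda\mu\nu}{}^{\lambda}$, $\operatorname{Scal}=\eta^{\mu\nu}R_{\mu\nu}$; $e^\mu\wedge e^\nu=e^\mu\otimes e^\nu-e^\nu\otimes e^\mu$. **Theorem 3.3.** Let $\omega$ be a smooth connection on $P$, $\Phi\in\Gamma(\mathscr H)$ and $\Psi\in\Gamma(\mathscr F_+)$ smooth sections satisfying $$\begin{cases}\mathrm d_\omega^*F_\omega+\mathrm{Re}\langle(\nabla_\omega\Phi)_\mu,\rho_*(\xi^a)\Phi\rangle\,e^\mu\otimes\xi_a-\tfrac12\mathrm{Im}\langle e_\mu\cdot\Psi,\chi_*(\xi^a)\Psi\rangle\,e^\mu\otimes\xi_a=0,\\ \Box_\omega\Phi-\tfrac12\operatorname{grad}U_\Phi-\langle\Psi,i\mathrm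 Y^-\Psi\rangle=0,\\ \slashed{\mathrm D}_\omega\Psi+\mathrm Y_\Phi\Psi=0,\end{cases}$$ where $\langle\Psi,i\mathrm Y^-\Psi\rangle=\tfrac12\langle\Psi,(i\mathrm Y_{W_k}-\mathrm Y_{iW_k})\Psi\rangle W_k$. Then $$\begin{cases}\Box_\omega F_\omega=\langle[F_\omega\wedge F_\omega]\rangle+\mathcal RF_\omega+\mathrm{Im}\langle\mathrm{Id}\cdot\Psi\wedge\chi_*\nabla_\omega\Psi\rangle+\mathrm{Re}\langle\rho_*(F_\omega)\Phi\otimes\rho_*\Phi\rangle-\mathrm{Re}\langle\nabla_\omega\Phi\wedge\rho_*\nabla_\omega\Phi\rangle,\\ \Box_\omega\Phi=\tfrac12\operatorname{grad}U_\Phi+\langle\Psi,i\mathrm Y^-\Psi\rangle,\\ \Box_\omega\Psi=\tfrac14\operatorname{Scal}\Psi+\chi_*(F_\omega)\cdot\Psi+\mathrm Y_{\nabla_\omega\Phi}\cdot\Psi-\mathrm Y_\Phi^2\Psi,\end{cases}$$ where $$\begin{aligned}\langle[F_\omega\wedge F_\omega]\rangle&=e^\mu\wedge e^\nu\otimes[F^\alpha{}_\mu,F_{\alpha\nu}],\\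 \mathcal RF_\omega&=e^\mu\wedge e^\nu\otimes\tfrac12\big(R_{\mu\alpha}F^\alpha{}_\nu+R_{\nu\alpha}F_\mu{}^\alpha-2R_{\alpha\mu\nu\beta}F^{\alpha\beta}\big),\\ \mathrm{Re}\langle\rho_*(F_\omega)\Phi\otimes\rho_*\Phi\rangle&=e^\mu\wedge e^\nu\otimes\tfrac12\mathrm{Re}\langle\rho_*(F_{\mu\nu})\Phi,\rho_*(\xi^a)\Phi\rangle\,\xi_a,\\ \mathrm{Re}\langle\nabla_\omega\Phi\wedge\rho_*\nabla_\omega\Phi\rangle&=e^\mu\wedge e^\nu\otimes\mathrm{Re}\langle(\nabla_\omega\Phi)_\mu,\rho_*(\xi^a)(\nabla_\omega\Phi)_\nu\rangle\,\xi_a,\\ \mathrm{Im}\langle\mathrm{Id}\cdot\Psi\wedge\chi_*\nabla_\omega\Psi\rangle&=e^\mu\wedge e^\nu\otimes\tfrac12\mathrm{Im}\big\{\langle e_\mu\cdot\Psi,\chi_*(\xi^a)(\nabla_\omega\Psi)_\nu\rangle-\langle e_\nu\cdot\Psi,\chi_*(\xi^a)(\nabla_\omega\Psi)_\mu\rangle\big\}\,\xi_a.\end{aligned}$$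 -/

import Mathlib

open scoped Manifold ContDiff

set_option linter.unusedSectionVars false

noncomputable section

namespace YMHD

/-! ## Minkowski space, Weyl representation, the group `Spin⁺(1,3) = SL(2,ℂ)` -/

/-- The diagonal entries `η_{μμ} = η^{μμ}` of the Minkowski metric, signature `(-+++)`. -/
def eta (μ : Fin 4) : ℝ := if μ = 0 then -1 else 1

/-- The Minkowski metric `η_{μν}`. -/
def minkowski (μ ν : Fin 4) : ℝ := if μ = ν then eta μ else 0

/-- The gamma matrices `γ_μ` (lower index) of the Weyl representation:
`γ_0 = [0, I; I, 0]`, `γ_k = [0, -σ_k; σ_k, 0]`. -/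
def gamma : Fin 4 → Matrix (Fin 4) (Fin 4) ℂ :=
  ![!![0, 0, 1, 0; 0, 0, 0, 1; 1, 0, 0, 0; 0, 1, 0, 0],
    !![0, 0, 0, -1; 0, 0, -1, 0; 0, 1, 0, 0; 1, 0, 0, 0],
    !![0, 0, 0, Complex.I; 0, 0, -Complex.I, 0; 0, -Complex.I, 0, 0; Complex.I, 0, 0, 0],
    !![0, 0, -1, 0; 0, 0, 0, 1; 1, 0, 0, 0; 0, -1, 0, 0]]

/-- `γ^μ = η^{μμ} γ_μ`. -/
def gammaUp (μ : Fin 4) : Matrix (Fin 4) (Fin 4) ℂ := (eta μ : ℂ) • gamma μ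

/-- `Spin⁺(1,3)`, realised as `SL(2,ℂ)`. -/
abbrev SpinPlus : Type := Matrix.SpecialLinearGroup (Fin 2) ℂ

/-- The spinor representation `ν(A) = diag(A, (A⁻¹)ᴴ)` of `Spin⁺(1,3)` on `ℂ⁴ = Σ₊ ⊕ Σ₋`. -/
def spinRep (A : SpinPlus) : Matrix (Fin 4) (Fin 4) ℂ :=
  !![A 0 0, A 0 1, 0, 0;
     A 1 0, A 1 1, 0, 0;
     0, 0, star (A 1 1), -star (A 1 0);
     0, 0, -star (A 0 1), star (A 0 0)]

/-- The double covering `λ : Spin⁺(1,3) → SO⁺(1,3)`, given by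
`ν(A) γ_μ ν(A)⁻¹ = ∑_κ λ(A)^κ_μ γ_κ`; the coefficient is extracted with
`tr (γ_κ γ_μ) = -4 η_{κμ}`. -/
def spinCover (A : SpinPlus) (κ μ : Fin 4) : ℝ :=
  (-(eta κ / 4 : ℂ) * (gamma κ * spinRep A * gamma μ * spinRep A⁻¹).trace).re

/-! ## Spacetimes -/

section Spacetime

variable (M : Type*) [TopologicalSpace M] [ChartedSpace (EuclideanSpace ℝ (Fin 4)) M]
  [IsManifold (𝓡 4) ∞ M]

/-- A smooth Lorentzian metric of signature `(-+++)` on a 4-manifold. -/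
structure LorentzMetric where
  /-- The scalar product on each tangent space. -/
  val : ∀ x : M, TangentSpace (𝓡 4) x →L[ℝ] TangentSpace (𝓡 4) x →L[ℝ] ℝ
  symm : ∀ x (v w : TangentSpace (𝓡 4) x), val x v w = val x w v
  /-- Signature `(-+++)` (in particular nondegeneracy): each tangent space has a basis that is
  orthonormal for the Minkowski metric. -/
  signature : ∀ x : M, ∃ b : Module.Basis (Fin 4) ℝ (TangentSpace (𝓡 4) x),
    ∀ μ ν, val x (b μ) (b ν) = minkowski μ ν
  smooth : ContMDiff (𝓡 4)
    ((𝓡 4).prod 𝓘(ℝ, EuclideanSpace ℝ (Fin 4) →L[ℝ] EuclideanSpace ℝ (Fin 4) →L[ℝ] ℝ)) ∞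
    (fun x ↦ Bundle.TotalSpace.mk'
      (EuclideanSpace ℝ (Fin 4) →L[ℝ] EuclideanSpace ℝ (Fin 4) →L[ℝ] ℝ)
      (E := fun x : M ↦ TangentSpace (𝓡 4) x →L[ℝ] TangentSpace (𝓡 4) x →L[ℝ] ℝ) x (val x))

variable {M}

/-- `X` is a vector field that is smooth on `s`. -/
def SmoothVectorFieldOn (X : ∀ x : M, TangentSpace (𝓡 4) x) (s : Set M) : Prop :=
  ContMDiffOn (𝓡 4) (𝓡 4).tangent ∞ (fun x ↦ (⟨x, X x⟩ : TangentBundle (𝓡 4) M)) s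

/-- An orientation (a nowhere vanishing smooth `4`-form, only its sign on bases is used) and a
time orientation (a smooth timelike vector field) of a Lorentzian manifold. -/
structure SpacetimeOrientation (h : LorentzMetric M) where
  vol : ∀ x : M, (TangentSpace (𝓡 4) x) [⋀^Fin 4]→ₗ[ℝ] ℝ
  vol_ne_zero : ∀ x, vol x ≠ 0
  vol_smooth : ∀ (s : Set M) (X : Fin 4 → ∀ x : M, TangentSpace (𝓡 4) x), IsOpen s →
    (∀ i, SmoothVectorFieldOn (X i) s) →
    ContMDiffOn (𝓡 4) 𝓘(ℝ, ℝ) ∞ (fun x ↦ vol x (fun i ↦ X i x)) s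
  time : ∀ x : M, TangentSpace (𝓡 4) x
  time_smooth : SmoothVectorFieldOn time Set.univ
  time_timelike : ∀ x, h.val x (time x) (time x) < 0

/-- A spin structure: a principal `Spin⁺(1,3)`-bundle `Q → M` with an equivariant bundle map `Λ`
(here `frame`) to the bundle `SO⁺(TM)` of oriented and time-oriented orthonormal frames.
`Q` carries its topology only: as `Λ` is a covering, the smooth structure of `Q` is determined by
that of `SO⁺(TM)`, and a continuous local section `ε` of `Q` is smooth iff the frame
`Λ ∘ ε` is smooth. -/
structure SpinStructure {h : LorentzMetric M} (O : SpacetimeOrientation h)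
    (Q : Type*) [TopologicalSpace Q] where
  proj : Q → M
  continuous_proj : Continuous proj
  act : Q → SpinPlus → Q
  continuous_act : Continuous (fun r : Q × SpinPlus ↦ act r.1 r.2)
  act_one : ∀ q, act q 1 = q
  act_mul : ∀ q A B, act q (A * B) = act (act q A) B
  proj_act : ∀ q A, proj (act q A) = proj q
  frame : ∀ q : Q, Fin 4 → TangentSpace (𝓡 4) (proj q)
  continuous_frame : ∀ μ, Continuous (fun q ↦ (⟨proj q, frame q μ⟩ : TangentBundle (𝓡 4) M))
  frame_orthonormal : ∀ q μ ν, h.val (proj q) (frame q μ) (frame q ν) = minkowski μ ν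
  frame_oriented : ∀ q, 0 < O.vol (proj q) (frame q)
  frame_future : ∀ q, h.val (proj q) (frame q 0) (O.time (proj q)) < 0
  frame_act : ∀ q A μ, (⟨proj (act q A), frame (act q A) μ⟩ : TangentBundle (𝓡 4) M) =
    ⟨proj q, ∑ κ, spinCover A κ μ • frame q κ⟩
  /-- Local triviality: local sections `ε`, and the trivialisation
  `q ↦ (proj q, τ q)`, `q = ε (proj q) · τ q`, of `Q` over their domain. -/
  locally_trivial : ∀ x : M, ∃ U : Set M, IsOpen U ∧ x ∈ U ∧
    ∃ (ε : M → Q) (τ : Q → SpinPlus), ContinuousOn ε U ∧ ContinuousOn τ (proj ⁻¹' U) ∧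
      (∀ y ∈ U, proj (ε y) = y) ∧
      (∀ q, proj q ∈ U → act (ε (proj q)) (τ q) = q) ∧
      (∀ y ∈ U, ∀ A, τ (act (ε y) A) = A) ∧
      ∀ μ, ContMDiffOn (𝓡 4) (𝓡 4).tangent ∞
        (fun y ↦ (⟨proj (ε y), frame (ε y) μ⟩ : TangentBundle (𝓡 4) M)) U

end Spacetime

/-! ## Lie groups and representations -/

section LieGroups

/-- The Lie algebra `𝔤 = T₁G` of an `n`-dimensional Lie group, as a vector space (it is
definitionally `GroupLieAlgebra (𝓡 n) G`). -/
abbrev LieAlg (n : ℕ) : Type := EuclideanSpace ℝ (Fin n)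

variable {n : ℕ} (G : Type*) [TopologicalSpace G] [ChartedSpace (EuclideanSpace ℝ (Fin n)) G]
  [Group G] [LieGroup (𝓡 n) ∞ G]

/-- The Lie bracket of the Lie algebra of `G` (through left invariant vector fields). -/
def lieBr (X Y : LieAlg n) : LieAlg n :=
  Bracket.bracket (L := GroupLieAlgebra (𝓡 n) G) (M := GroupLieAlgebra (𝓡 n) G) X Y

variable {G}

/-- The adjoint representation: `Ad_g` is the differential at `1` of `k ↦ g k g⁻¹`. -/
def Ad (g : G) (X : LieAlg n) : LieAlg n :=
  mfderiv (𝓡 n) (𝓡 n) (fun k : G ↦ g * k * g⁻¹) 1 X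

variable (G) in
/-- An `Ad`-invariant positive definite inner product on the Lie algebra of `G`. -/
structure AdInvariantInner where
  val : LieAlg n →ₗ[ℝ] LieAlg n →ₗ[ℝ] ℝ
  symm : ∀ X Y, val X Y = val Y X
  pos : ∀ X, X ≠ 0 → 0 < val X X
  ad_invariant : ∀ (g : G) X Y, val (Ad g X) (Ad g Y) = val X Y

variable (G) in
/-- A smooth unitary representation `G → U(W)` on a finite-dimensional Hermitian space. -/
structure UnitaryRep (W : Type*) [NormedAddCommGroup W] [InnerProductSpace ℂ W] where
  toHom : G →* (W →L[ℂ] W)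
  smooth : ContMDiff (𝓡 n) 𝓘(ℝ, W →L[ℂ] W) ∞ toHom
  unitary : ∀ g v w, inner ℂ (toHom g v) (toHom g w) = inner ℂ v w

/-- The induced Lie algebra representation `ρ_* : 𝔤 → 𝔲(W)`, the differential of `ρ` at `1`. -/
def UnitaryRep.deriv {W : Type*} [NormedAddCommGroup W] [InnerProductSpace ℂ W]
    (ρ : UnitaryRep (n := n) G W) (X : LieAlg n) : W →L[ℂ] W :=
  mfderiv (𝓡 n) 𝓘(ℝ, W →L[ℂ] W) ρ.toHom 1 X

end LieGroups

/-! ## Principal bundles and connections -/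

section Principal

variable {n : ℕ}
  (M : Type*) [TopologicalSpace M] [ChartedSpace (EuclideanSpace ℝ (Fin 4)) M]
  [IsManifold (𝓡 4) ∞ M]
  (P : Type*) [TopologicalSpace P] [ChartedSpace (EuclideanSpace ℝ (Fin (4 + n))) P]
  [IsManifold (𝓡 (4 + n)) ∞ P]
  (G : Type*) [TopologicalSpace G] [ChartedSpace (EuclideanSpace ℝ (Fin n)) G]
  [Group G] [LieGroup (𝓡 n) ∞ G]

/-- A smooth principal `G`-bundle `P → M`. -/
structure PrincipalBundle where
  proj : P → M
  smooth_proj : ContMDiff (𝓡 (4 + n)) (𝓡 4) ∞ proj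
  act : P → G → P
  smooth_act : ContMDiff ((𝓡 (4 + n)).prod (𝓡 n)) (𝓡 (4 + n)) ∞
    (fun r : P × G ↦ act r.1 r.2)
  act_one : ∀ p, act p 1 = p
  act_mul : ∀ p g k, act p (g * k) = act (act p g) k
  proj_act : ∀ p g, proj (act p g) = proj p
  /-- Local triviality: smooth local sections `s`, and the trivialisation
  `p ↦ (proj p, τ p)`, `p = s (proj p) · τ p`, of `P` over their domain. -/
  locally_trivial : ∀ x : M, ∃ U : Set M, IsOpen U ∧ x ∈ U ∧
    ∃ (s : M → P) (τ : P → G), ContMDiffOn (𝓡 4) (𝓡 (4 + n)) ∞ s U ∧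
      ContMDiffOn (𝓡 (4 + n)) (𝓡 n) ∞ τ (proj ⁻¹' U) ∧
      (∀ y ∈ U, proj (s y) = y) ∧
      (∀ p, proj p ∈ U → act (s (proj p)) (τ p) = p) ∧
      (∀ y ∈ U, ∀ g, τ (act (s y) g) = g)

variable {M P G}

/-- A (smooth) connection `ω ∈ Ω¹(P, 𝔤)`: of `Ad`-type, and `ω(X*) = X` for the fundamental
vertical vector fields `X*`. -/
structure Connection (B : PrincipalBundle (n := n) M P G) where
  form : ∀ p : P, TangentSpace (𝓡 (4 + n)) p →L[ℝ] LieAlg n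
  smooth : ContMDiff (𝓡 (4 + n)).tangent 𝓘(ℝ, LieAlg n) ∞
    (fun v : TangentBundle (𝓡 (4 + n)) P ↦ form v.1 v.2)
  equivariant : ∀ (p : P) (g : G) (v : TangentSpace (𝓡 (4 + n)) p),
    form (B.act p g) (mfderiv (𝓡 (4 + n)) (𝓡 (4 + n)) (fun p' ↦ B.act p' g) p v) =
      Ad g⁻¹ (form p v)
  vertical : ∀ (p : P) (X : TangentSpace (𝓡 n) (1 : G)),
    form (B.act p 1) (mfderiv (𝓡 n) (𝓡 (4 + n)) (fun g : G ↦ B.act p g) 1 X) = X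

end Principal

/-! ## The data of the model -/

section Spinors

variable {V : Type*} [NormedAddCommGroup V] [InnerProductSpace ℂ V]

/-- Twisted spinors are elements of `ℂ⁴ ⊗ V`, written as `Fin 4 → V`. A matrix acts on the spinor
factor `ℂ⁴`. -/
def spinMul (S : Matrix (Fin 4) (Fin 4) ℂ) (ψ : Fin 4 → V) : Fin 4 → V :=
  fun a ↦ ∑ b, S a b • ψ b

/-- A linear map of `V` acts on `ℂ⁴ ⊗ V` by ignoring the spinor factor. -/
def twistMul (T : V →L[ℂ] V) (ψ : Fin 4 → V) : Fin 4 → V := fun a ↦ T (ψ a)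

/-- The inner product of `ℂ⁴ ⊗ V` induced by the spinor inner product `⟨ψ, φ⟩ = ψ† γ_0 φ` and
the Hermitian inner product of `V` (conjugate linear in the first slot). -/
def spinInner (ψ φ : Fin 4 → V) : ℂ := ∑ a, ∑ b, gamma 0 a b * inner ℂ (ψ a) (φ b)

/-- The subspace `(Σ₊ ⊗ V₊) ⊕ (Σ₋ ⊗ V₋)` of `ℂ⁴ ⊗ V`, where `V₋` is the orthogonal complement of
`V₊` and `Σ₊`, `Σ₋` are spanned by the first two and the last two basis vectors of `ℂ⁴`. -/
def IsChiral (Vplus : Submodule ℂ V) (ψ : Fin 4 → V) : Prop :=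
  ψ 0 ∈ Vplus ∧ ψ 1 ∈ Vplus ∧ ψ 2 ∈ Vplusᗮ ∧ ψ 3 ∈ Vplusᗮ

end Spinors

section Model

variable (M : Type*) [TopologicalSpace M] [ChartedSpace (EuclideanSpace ℝ (Fin 4)) M]
  [IsManifold (𝓡 4) ∞ M]
  {n : ℕ}
  (G : Type*) [TopologicalSpace G] [ChartedSpace (EuclideanSpace ℝ (Fin n)) G]
  [Group G] [LieGroup (𝓡 n) ∞ G]
  (P : Type*) [TopologicalSpace P] [ChartedSpace (EuclideanSpace ℝ (Fin (4 + n))) P]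
  [IsManifold (𝓡 (4 + n)) ∞ P]
  (Q : Type*) [TopologicalSpace Q]
  (W : Type*) [NormedAddCommGroup W] [InnerProductSpace ℂ W] [FiniteDimensional ℂ W]
  (V : Type*) [NormedAddCommGroup V] [InnerProductSpace ℂ V] [FiniteDimensional ℂ V]

/-- The fixed data: an oriented and time-oriented spin Lorentzian 4-manifold, a principal
`G`-bundle `P`, an `Ad`-invariant inner product on `𝔤`, unitary representations `ρ` on `W` and
`χ = χ₊ ⊕ χ₋` on `V = V₊ ⊕ V₋`, a Yukawa map, and a `G`-invariant Higgs potential. -/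
structure Model where
  metric : LorentzMetric M
  orient : SpacetimeOrientation metric
  spin : SpinStructure orient Q
  bundle : PrincipalBundle (n := n) M P G
  innerG : AdInvariantInner (n := n) G
  rho : UnitaryRep (n := n) G W
  chi : UnitaryRep (n := n) G V
  /-- `V₊`; the other summand `V₋` is its orthogonal complement. -/
  Vplus : Submodule ℂ V
  chi_plus : ∀ g, ∀ v ∈ Vplus, chi.toHom g v ∈ Vplus
  chi_minus : ∀ g, ∀ v ∈ Vplusᗮ, chi.toHom g v ∈ Vplusᗮ
  /-- The Yukawa map, real linear with skew-Hermitian values. -/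
  Y : W →ₗ[ℝ] (V →L[ℂ] V)
  Y_skew : ∀ w v v', inner ℂ (Y w v) v' = -inner ℂ v (Y w v')
  Y_plus : ∀ w, ∀ v ∈ Vplus, Y w v ∈ Vplusᗮ
  Y_minus : ∀ w, ∀ v ∈ Vplusᗮ, Y w v ∈ Vplus
  Y_equivariant : ∀ g w v, Y (rho.toHom g w) (chi.toHom g v) = chi.toHom g (Y w v)
  /-- The potential, a smooth `G`-invariant function on the total space of `P ×_ρ W`, i.e.
  `[p, w] ↦ U (proj p) w` with `U` smooth on `M × W` and `G`-invariant in `w`. -/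
  U : M → W → ℝ
  U_smooth : ContMDiff ((𝓡 4).prod 𝓘(ℝ, W)) 𝓘(ℝ, ℝ) ∞ (fun r : M × W ↦ U r.1 r.2)
  U_invariant : ∀ x g w, U x (rho.toHom g w) = U x w

variable {M G P Q W V}

/-- A local gauge on an open set `dom ⊆ M`: a local section `ε` of the spin bundle with associated
vielbein `e = Λ ∘ ε`, a local section `s` of `P`, an orthonormal basis `ξ` of `𝔤` and an
orthonormal basis of `W` (which through `s` are local orthonormal frames of `Ad P` and of
`P ×_ρ W`). The values of `ε`, `e`, `s` outside `dom` are irrelevant. -/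
structure LocalGauge (D : Model (n := n) M G P Q W V) where
  dom : Set M
  isOpen_dom : IsOpen dom
  eps : M → Q
  continuousOn_eps : ContinuousOn eps dom
  proj_eps : ∀ x ∈ dom, D.spin.proj (eps x) = x
  e : Fin 4 → ∀ x : M, TangentSpace (𝓡 4) x
  e_eq : ∀ μ, ∀ x ∈ dom, (⟨x, e μ x⟩ : TangentBundle (𝓡 4) M) =
    ⟨D.spin.proj (eps x), D.spin.frame (eps x) μ⟩
  smooth_e : ∀ μ, SmoothVectorFieldOn (e μ) dom
  s : M → P
  smooth_s : ContMDiffOn (𝓡 4) (𝓡 (4 + n)) ∞ s dom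
  proj_s : ∀ x ∈ dom, D.bundle.proj (s x) = x
  xi : Module.Basis (Fin n) ℝ (LieAlg n)
  xi_orthonormal : ∀ a b, D.innerG.val (xi a) (xi b) = if a = b then 1 else 0
  wFrame : OrthonormalBasis (Fin (Module.finrank ℂ W)) ℂ W

/-- A positive definite inner product on a finite-dimensional space has an orthonormal basis. -/
theorem exists_orthonormal_basis {n : ℕ} {E : Type*} [AddCommGroup E] [Module ℝ E]
    [FiniteDimensional ℝ E] (hd : Module.finrank ℝ E = n) (k : E →ₗ[ℝ] E →ₗ[ℝ] ℝ)
    (symm : ∀ X Y, k X Y = k Y X) (pos : ∀ X, X ≠ 0 → 0 < k X X) :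
    ∃ b : Module.Basis (Fin n) ℝ E, ∀ i j, k (b i) (b j) = if i = j then 1 else 0 := by
  let c : InnerProductSpace.Core ℝ E :=
    { inner := fun X Y ↦ k X Y
      conj_inner_symm := fun X Y ↦ by simp [symm X]
      re_inner_nonneg := fun X ↦ by
        by_cases h : X = 0
        · simp [h]
        · exact (pos X h).le
      add_left := fun X Y Z ↦ by simp
      smul_left := fun X Y r ↦ by simp
      definite := fun X h ↦ by
        by_contra hX
        exact (pos X hX).ne' h }
  let _ : NormedAddCommGroup E := c.toNormedAddCommGroup
  let _ : InnerProductSpace ℝ E := InnerProductSpace.ofCore c.toCore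
  let b := (stdOrthonormalBasis ℝ E).reindex (finCongr hd)
  refine ⟨b.toBasis, fun i j ↦ ?_⟩
  have := (orthonormal_iff_ite.1 b.orthonormal) i j
  simp only [OrthonormalBasis.coe_toBasis]
  exact this

/-- Every point lies in the domain of a local gauge. -/
theorem exists_localGauge (D : Model (n := n) M G P Q W V) (x : M) :
    ∃ σ : LocalGauge D, x ∈ σ.dom := by
  obtain ⟨U₁, hU₁, hx₁, ε, -, hε, -, hpε, -, -, hsm⟩ := D.spin.locally_trivial x
  obtain ⟨U₂, hU₂, hx₂, s, -, hs, -, hps, -⟩ := D.bundle.locally_trivial x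
  obtain ⟨b, hb⟩ := exists_orthonormal_basis (n := n) (by simp) D.innerG.val
    D.innerG.symm D.innerG.pos
  have key : ∀ μ, ∀ y ∈ U₁ ∩ U₂,
      (⟨y, (D.spin.frame (ε y) μ : EuclideanSpace ℝ (Fin 4))⟩ : TangentBundle (𝓡 4) M) =
      ⟨D.spin.proj (ε y), D.spin.frame (ε y) μ⟩ := by
    intro μ y hy
    have h := hpε y hy.1
    have : ∀ (z : M) (v : EuclideanSpace ℝ (Fin 4)), z = y →
        (⟨y, v⟩ : TangentBundle (𝓡 4) M) = ⟨z, v⟩ := by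
      rintro z v rfl; rfl
    exact this _ _ h
  exact ⟨{ dom := U₁ ∩ U₂
           isOpen_dom := hU₁.inter hU₂
           eps := ε
           continuousOn_eps := hε.mono Set.inter_subset_left
           proj_eps := fun y hy ↦ hpε y hy.1
           e := fun μ y ↦ (D.spin.frame (ε y) μ : EuclideanSpace ℝ (Fin 4))
           e_eq := key
           smooth_e := fun μ ↦ ((hsm μ).mono Set.inter_subset_left).congr (key μ)
           s := s
           smooth_s := hs.mono Set.inter_subset_right
           proj_s := fun y hy ↦ hps y hy.2
           xi := b
           xi_orthonormal := hb
           wFrame := stdOrthonormalBasis ℂ W }, hx₁, hx₂⟩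

/-- The unknowns: a connection `ω` on `P`, a Higgs field `Φ ∈ Γ(P ×_ρ W)` and a twisted chiral
spinor `Ψ ∈ Γ(F₊)`, all smooth. Sections of associated bundles are equivariant functions:
`Φ = [s, φ]` means `φ(x) = higgs (s x)`, and `Ψ = [ε, s, ψ]` means `ψ(x) = spinor (ε x) (s x)`;
`spinor q p` is only meaningful if `q` and `p` lie over the same point. -/
structure Fields (D : Model (n := n) M G P Q W V) where
  conn : Connection D.bundle
  higgs : P → W
  higgs_smooth : ContMDiff (𝓡 (4 + n)) 𝓘(ℝ, W) ∞ higgs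
  higgs_equivariant : ∀ p g, higgs (D.bundle.act p g) = D.rho.toHom g⁻¹ (higgs p)
  spinor : Q → P → Fin 4 → V
  spinor_equivariant : ∀ q p, D.spin.proj q = D.bundle.proj p → ∀ A g,
    spinor (D.spin.act q A) (D.bundle.act p g) =
      spinMul (spinRep A⁻¹) (twistMul (D.chi.toHom g⁻¹) (spinor q p))
  spinor_chiral : ∀ q p, D.spin.proj q = D.bundle.proj p → IsChiral D.Vplus (spinor q p)
  spinor_smooth : ∀ σ : LocalGauge D,
    ContMDiffOn (𝓡 4) 𝓘(ℝ, Fin 4 → V) ∞ (fun x ↦ spinor (σ.eps x) (σ.s x)) σ.dom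

end Model

/-! ## Levi-Civita connection and curvature in a vielbein -/

section LeviCivita

variable {M : Type*} [TopologicalSpace M] [ChartedSpace (EuclideanSpace ℝ (Fin 4)) M]
  [IsManifold (𝓡 4) ∞ M]
  (h : LorentzMetric M) (e : Fin 4 → ∀ x : M, TangentSpace (𝓡 4) x)

/-- The derivative `(df)(e_μ)` of a vector-valued function. -/
def frameDeriv {X : Type*} [NormedAddCommGroup X] [NormedSpace ℝ X]
    (μ : Fin 4) (f : M → X) (x : M) : X :=
  mfderiv (𝓡 4) 𝓘(ℝ, X) f x (e μ x)

/-- `c_{μνκ} = h([e_μ, e_ν], e_κ)`. -/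
def structureCoeff (μ ν κ : Fin 4) (x : M) : ℝ :=
  h.val x (VectorField.mlieBracket (𝓡 4) (e μ) (e ν) x) (e κ x)

/-- The connection symbols `Γ_{μνκ} = h(∇_{e_μ} e_ν, e_κ)` of the Levi-Civita connection in an
orthonormal frame, by the Koszul formula. -/
def christoffel (μ ν κ : Fin 4) (x : M) : ℝ :=
  (structureCoeff h e μ ν κ x + structureCoeff h e κ μ ν x - structureCoeff h e ν κ μ x) / 2

/-- `Γ_{μνκ}` is skew in the last two indices (`∇` is metric). -/
theorem christoffel_skew (μ ν κ : Fin 4) (x : M) :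
    christoffel h e μ ν κ x = -christoffel h e μ κ ν x := by
  have hs : ∀ a b c, structureCoeff h e a b c x = -structureCoeff h e b a c x := by
    intro a b c
    unfold structureCoeff
    rw [VectorField.mlieBracket_swap_apply]
    simp
  unfold christoffel
  linarith [hs μ ν κ, hs κ μ ν, hs ν κ μ]

/-- `Γ_{μνκ} - Γ_{νμκ} = h([e_μ, e_ν], e_κ)` (`∇` is torsion-free). -/
theorem christoffel_torsion_free (μ ν κ : Fin 4) (x : M) :
    christoffel h e μ ν κ x - christoffel h e ν μ κ x = structureCoeff h e μ ν κ x := by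
  have hs : ∀ a b c, structureCoeff h e a b c x = -structureCoeff h e b a c x := by
    intro a b c
    unfold structureCoeff
    rw [VectorField.mlieBracket_swap_apply]
    simp
  unfold christoffel
  linarith [hs μ ν κ, hs κ μ ν, hs ν κ μ]

/-- `Γ_{μν}^κ = e^κ(∇_{e_μ} e_ν)`. -/
def christoffelUp (μ ν κ : Fin 4) (x : M) : ℝ := eta κ * christoffel h e μ ν κ x

/-- The Riemann tensor `R_{μνκρ} = h(Riem(e_μ, e_ν) e_κ, e_ρ)`, where
`Riem(X,Y) = [∇_X, ∇_Y] - ∇_{[X,Y]}`, expanded in the frame with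
`[e_μ, e_ν] = (Γ_{μν}^α - Γ_{νμ}^α) e_α`. -/
def riemann (μ ν κ ρ : Fin 4) (x : M) : ℝ :=
  eta ρ * (frameDeriv e μ (christoffelUp h e ν κ ρ) x - frameDeriv e ν (christoffelUp h e μ κ ρ) x
    + ∑ α, (christoffelUp h e ν κ α x * christoffelUp h e μ α ρ x
      - christoffelUp h e μ κ α x * christoffelUp h e ν α ρ x
      - (christoffelUp h e μ ν α x - christoffelUp h e ν μ α x) * christoffelUp h e α κ ρ x))

/-- The Ricci tensor `R_{μν} = R_{λμν}^λ`. -/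
def ricci (μ ν : Fin 4) (x : M) : ℝ := ∑ κ, eta κ * riemann h e κ μ ν κ x

/-- The scalar curvature `Scal = η^{μν} R_{μν}`. -/
def scal (x : M) : ℝ := ∑ μ, eta μ * ricci h e μ μ x

variable {X : Type*} [NormedAddCommGroup X] [NormedSpace ℝ X]

/-- The induced connection on `⊗ᵏ T*M ⊗ E` for a vector bundle `E` with fibre `X` whose connection
is locally `∇_{e_μ} = e_μ + B_μ`: for an `E`-valued `k`-tensor `T` with components `T_I`,
`(∇T)_{μ I} = e_μ(T_I) + B_μ T_I - ∑_j ∑_κ Γ_{μ I_j}^κ T_{I with I_j replaced by κ}`.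
The index of the derivative is the first one. -/
def covDeriv (B : Fin 4 → M → X → X) {k : ℕ} (T : (Fin k → Fin 4) → M → X)
    (J : Fin (k + 1) → Fin 4) (x : M) : X :=
  frameDeriv e (J 0) (T (Fin.tail J)) x + B (J 0) x (T (Fin.tail J) x)
    - ∑ j : Fin k, ∑ κ : Fin 4,
        christoffelUp h e (J 0) (Fin.tail J j) κ x • T (Function.update (Fin.tail J) j κ) x

/-- The wave operator `□ = Tr ∇² = -∇*∇` on `⊗ᵏ T*M ⊗ E`. -/
def box (B : Fin 4 → M → X → X) {k : ℕ} (T : (Fin k → Fin 4) → M → X)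
    (I : Fin k → Fin 4) (x : M) : X :=
  ∑ μ, eta μ • covDeriv h e B (covDeriv h e B T) (Fin.cons μ (Fin.cons μ I)) x

end LeviCivita

/-- The components of the `2`-form `e^μ ∧ e^ν ⊗ T_{μν}`. -/
def wedgeComp {X : Type*} [AddGroup X] (T : Fin 4 → Fin 4 → X) (μ ν : Fin 4) : X :=
  T μ ν - T ν μ

/-! ## The local expressions of the fields and of their derivatives -/

section Local

variable {M : Type*} [TopologicalSpace M] [ChartedSpace (EuclideanSpace ℝ (Fin 4)) M]
  [IsManifold (𝓡 4) ∞ M]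
  {n : ℕ}
  {G : Type*} [TopologicalSpace G] [ChartedSpace (EuclideanSpace ℝ (Fin n)) G]
  [Group G] [LieGroup (𝓡 n) ∞ G]
  {P : Type*} [TopologicalSpace P] [ChartedSpace (EuclideanSpace ℝ (Fin (4 + n))) P]
  [IsManifold (𝓡 (4 + n)) ∞ P]
  {Q : Type*} [TopologicalSpace Q]
  {W : Type*} [NormedAddCommGroup W] [InnerProductSpace ℂ W] [FiniteDimensional ℂ W]
  {V : Type*} [NormedAddCommGroup V] [InnerProductSpace ℂ V] [FiniteDimensional ℂ V]
  {D : Model (n := n) M G P Q W V}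

namespace LocalGauge

variable (σ : LocalGauge D)

/-- `Γ_{μνκ}` in the vielbein of the gauge. -/
def christoffel (μ ν κ : Fin 4) (x : M) : ℝ := YMHD.christoffel D.metric σ.e μ ν κ x

/-- `R_{μνκρ}`. -/
def riemann (μ ν κ ρ : Fin 4) (x : M) : ℝ := YMHD.riemann D.metric σ.e μ ν κ ρ x

/-- `R_{μν}`. -/
def ricci (μ ν : Fin 4) (x : M) : ℝ := YMHD.ricci D.metric σ.e μ ν x

/-- `Scal`. -/
def scal (x : M) : ℝ := YMHD.scal D.metric σ.e x

end LocalGauge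

namespace Fields

variable (f : Fields D) (σ : LocalGauge D)

/-- The local connection form `A = s^*ω`, as a form on `M`. -/
def localForm (x : M) (v : TangentSpace (𝓡 4) x) : LieAlg n :=
  f.conn.form (σ.s x) (mfderiv (𝓡 4) (𝓡 (4 + n)) σ.s x v)

/-- `A_μ = (s^*ω)(e_μ)`. -/
def A (μ : Fin 4) (x : M) : LieAlg n := f.localForm σ x (σ.e μ x)

/-- `F_{μν} = F_ω(e_μ, e_ν)` in the gauge `s`: with `F = dA + ½ [A ∧ A]`,
`F(X,Y) = X(A(Y)) - Y(A(X)) - A([X,Y]) + [A(X), A(Y)]`. -/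
def F (μ ν : Fin 4) (x : M) : LieAlg n :=
  frameDeriv σ.e μ (f.A σ ν) x - frameDeriv σ.e ν (f.A σ μ) x
    - f.localForm σ x (VectorField.mlieBracket (𝓡 4) (σ.e μ) (σ.e ν) x)
    + lieBr G (f.A σ μ x) (f.A σ ν x)

/-- The local representative `φ` of `Φ = [s, φ]`. -/
def phi (x : M) : W := f.higgs (σ.s x)

/-- The local representative `ψ` of `Ψ = [ε, s, ψ]`. -/
def psi (x : M) : Fin 4 → V := f.spinor (σ.eps x) (σ.s x)

/-- The connection on `Ad P`: `∇_{e_μ} = e_μ + [A_μ, ·]`. -/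
def connAd (μ : Fin 4) (x : M) (X : LieAlg n) : LieAlg n := lieBr G (f.A σ μ x) X

/-- The connection on `P ×_ρ W`: `∇_{e_μ} = e_μ + ρ_*(A_μ)`. -/
def connHiggs (μ : Fin 4) (x : M) (w : W) : W := D.rho.deriv (f.A σ μ x) w

/-- The connection on `ΣM ⊗ (P ×_χ V)`:
`∇_{e_μ} = e_μ + ¼ Γ_{μνκ} γ^ν γ^κ + χ_*(A_μ)`. -/
def connSpinor (μ : Fin 4) (x : M) (ψ : Fin 4 → V) : Fin 4 → V :=
  (1 / 4 : ℝ) • ∑ ν, ∑ κ, σ.christoffel μ ν κ x • spinMul (gammaUp ν) (spinMul (gammaUp κ) ψ)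
    + twistMul (D.chi.deriv (f.A σ μ x)) ψ

/-- `(∇_ω F_ω)_{κμν}`. -/
def nablaF (κ μ ν : Fin 4) (x : M) : LieAlg n :=
  covDeriv D.metric σ.e (f.connAd σ) (fun I : Fin 2 → Fin 4 ↦ f.F σ (I 0) (I 1)) ![κ, μ, ν] x

/-- `(∇_ω Φ)_μ`. -/
def nablaPhi (μ : Fin 4) (x : M) : W :=
  covDeriv D.metric σ.e (f.connHiggs σ) (fun _ : Fin 0 → Fin 4 ↦ f.phi σ) ![μ] x

/-- `(∇_ω Ψ)_μ`. -/
def nablaPsi (μ : Fin 4) (x : M) : Fin 4 → V :=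
  covDeriv D.metric σ.e (f.connSpinor σ) (fun _ : Fin 0 → Fin 4 ↦ f.psi σ) ![μ] x

/-- `(□_ω F_ω)_{μν}`. -/
def boxF (μ ν : Fin 4) (x : M) : LieAlg n :=
  box D.metric σ.e (f.connAd σ) (fun I : Fin 2 → Fin 4 ↦ f.F σ (I 0) (I 1)) ![μ, ν] x

/-- `□_ω Φ`. -/
def boxPhi (x : M) : W :=
  box D.metric σ.e (f.connHiggs σ) (fun _ : Fin 0 → Fin 4 ↦ f.phi σ) ![] x

/-- `□_ω Ψ`. -/
def boxPsi (x : M) : Fin 4 → V :=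
  box D.metric σ.e (f.connSpinor σ) (fun _ : Fin 0 → Fin 4 ↦ f.psi σ) ![] x

/-- The components `(d_ω^* F_ω)_ν = -∇^μ F_{μν}` of the codifferential of the `2`-form `F_ω`. -/
def codiffF (ν : Fin 4) (x : M) : LieAlg n := -∑ μ, eta μ • f.nablaF σ μ μ ν x

/-- The twisted Dirac operator `D̸_ω Ψ = η^{μν} e_μ · (∇_ω Ψ)(e_ν)`. -/
def dirac (x : M) : Fin 4 → V := ∑ μ, eta μ • spinMul (gamma μ) (f.nablaPsi σ μ x)

/-! ### Currents and zeroth order terms of the Euler-Lagrange equations -/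

/-- `Re ⟨∇_ω Φ ⊗ ρ_* Φ⟩_μ = Re ⟨(∇_ω Φ)_μ, ρ_*(ξ^a) Φ⟩ ξ_a`. -/
def higgsCurrent (μ : Fin 4) (x : M) : LieAlg n :=
  ∑ a, (inner ℂ (f.nablaPhi σ μ x) (D.rho.deriv (σ.xi a) (f.phi σ x))).re • σ.xi a

/-- `Im ⟨Id · Ψ ⊗ χ_* Ψ⟩_μ = Im ⟨e_μ · Ψ, χ_*(ξ^a) Ψ⟩ ξ_a`. -/
def diracCurrent (μ : Fin 4) (x : M) : LieAlg n :=
  ∑ a, (spinInner (spinMul (gamma μ) (f.psi σ x))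
    (twistMul (D.chi.deriv (σ.xi a)) (f.psi σ x))).im • σ.xi a

/-- The gradient `grad U_Φ` along the fibre, with respect to `Re ⟨·, ·⟩`. -/
def gradU (x : M) : W :=
  ∑ k, ((fderiv ℝ (D.U x) (f.phi σ x) (σ.wFrame k) : ℂ)
    + Complex.I * (fderiv ℝ (D.U x) (f.phi σ x) (Complex.I • σ.wFrame k) : ℂ)) • σ.wFrame k

/-- The defining property of the gradient: `Re ⟨α, grad U_Φ⟩ = dU_Φ(α)`. -/
theorem re_inner_gradU (x : M) (α : W) :
    (inner ℂ α (f.gradU σ x)).re = fderiv ℝ (D.U x) (f.phi σ x) α := by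
  unfold gradU
  generalize fderiv ℝ (D.U x) (f.phi σ x) = L
  conv_rhs => rw [← σ.wFrame.sum_repr α]
  have h : ∀ (c : ℂ) (w : W), L (c • w) = c.re * L w + c.im * L (Complex.I • w) := by
    intro c w
    have : c • w = c.re • w + c.im • (Complex.I • w) := by
      conv_lhs => rw [← Complex.re_add_im c]
      rw [add_smul, mul_smul]; rfl
    rw [this, map_add, map_smul, map_smul]; rfl
  simp only [map_sum, inner_sum, Complex.re_sum, inner_smul_right]
  refine Finset.sum_congr rfl fun k _ ↦ ?_
  rw [h (σ.wFrame.repr α k)]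
  rw [σ.wFrame.repr_apply_apply, ← inner_conj_symm α (σ.wFrame k)]
  generalize inner ℂ (σ.wFrame k) α = z
  generalize L (σ.wFrame k) = p
  generalize L (Complex.I • σ.wFrame k) = q
  simp only [Complex.mul_re, Complex.add_re, Complex.add_im, Complex.mul_im, Complex.I_re,
    Complex.I_im, Complex.ofReal_re, Complex.ofReal_im, Complex.conj_re, Complex.conj_im]
  ring

/-- `⟨Ψ, i Y⁻ Ψ⟩ = ½ ⟨Ψ, (i Y_{W_k} - Y_{i W_k}) Ψ⟩ W_k`, with `Y⁻` the antilinear part of `Y`. -/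
def yukawaCurrent (x : M) : W :=
  ∑ k, ((1 / 2 : ℂ) * spinInner (f.psi σ x)
    (twistMul (Complex.I • D.Y (σ.wFrame k) - D.Y (Complex.I • σ.wFrame k)) (f.psi σ x)))
      • σ.wFrame k

/-- `Y_Φ Ψ`. -/
def yukawaPsi (x : M) : Fin 4 → V := twistMul (D.Y (f.phi σ x)) (f.psi σ x)

/-- `Y_{∇_ω Φ} · Ψ = η^{μν} e_μ · Y_{(∇_ω Φ)_ν} Ψ`. -/
def yukawaNablaPsi (x : M) : Fin 4 → V :=
  ∑ μ, eta μ • spinMul (gamma μ) (twistMul (D.Y (f.nablaPhi σ μ x)) (f.psi σ x))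

/-! ### Right-hand sides of the wave equations, as components of `2`-forms -/

/-- `⟨[F_ω ∧ F_ω]⟩ = e^μ ∧ e^ν ⊗ [F^α_μ, F_{αν}]`. -/
def bracketFF (μ ν : Fin 4) (x : M) : LieAlg n :=
  wedgeComp (fun μ ν ↦ ∑ α, eta α • lieBr G (f.F σ α μ x) (f.F σ α ν x)) μ ν

/-- `𝓡 F_ω = e^μ ∧ e^ν ⊗ ½ (R_{μα} F^α_ν + R_{να} F_μ^α - 2 R_{αμνβ} F^{αβ})`. -/
def curvF (μ ν : Fin 4) (x : M) : LieAlg n :=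
  wedgeComp (fun μ ν ↦ (1 / 2 : ℝ) •
    (∑ α, (σ.ricci μ α x * eta α) • f.F σ α ν x
      + ∑ α, (σ.ricci ν α x * eta α) • f.F σ μ α x
      - (2 : ℝ) • ∑ α, ∑ β, (σ.riemann α μ ν β x * eta α * eta β) • f.F σ α β x)) μ ν

/-- `Re ⟨ρ_*(F_ω) Φ ⊗ ρ_* Φ⟩ = e^μ ∧ e^ν ⊗ ½ Re ⟨ρ_*(F_{μν}) Φ, ρ_*(ξ^a) Φ⟩ ξ_a`. -/
def higgsCurvCurrent (μ ν : Fin 4) (x : M) : LieAlg n :=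
  wedgeComp (fun μ ν ↦ ∑ a, ((1 / 2 : ℝ) *
    (inner ℂ (D.rho.deriv (f.F σ μ ν x) (f.phi σ x))
      (D.rho.deriv (σ.xi a) (f.phi σ x))).re) • σ.xi a) μ ν

/-- `Re ⟨∇_ω Φ ∧ ρ_* ∇_ω Φ⟩ = e^μ ∧ e^ν ⊗ Re ⟨(∇_ω Φ)_μ, ρ_*(ξ^a) (∇_ω Φ)_ν⟩ ξ_a`. -/
def higgsWedgeCurrent (μ ν : Fin 4) (x : M) : LieAlg n :=
  wedgeComp (fun μ ν ↦ ∑ a,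
    (inner ℂ (f.nablaPhi σ μ x) (D.rho.deriv (σ.xi a) (f.nablaPhi σ ν x))).re • σ.xi a) μ ν

/-- `Im ⟨Id · Ψ ∧ χ_* ∇_ω Ψ⟩ = e^μ ∧ e^ν ⊗
½ Im {⟨e_μ · Ψ, χ_*(ξ^a) (∇_ω Ψ)_ν⟩ - ⟨e_ν · Ψ, χ_*(ξ^a) (∇_ω Ψ)_μ⟩} ξ_a`. -/
def diracWedgeCurrent (μ ν : Fin 4) (x : M) : LieAlg n :=
  wedgeComp (fun μ ν ↦ ∑ a, ((1 / 2 : ℝ) *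
    (spinInner (spinMul (gamma μ) (f.psi σ x))
        (twistMul (D.chi.deriv (σ.xi a)) (f.nablaPsi σ ν x))
      - spinInner (spinMul (gamma ν) (f.psi σ x))
        (twistMul (D.chi.deriv (σ.xi a)) (f.nablaPsi σ μ x))).im) • σ.xi a) μ ν

/-- `χ_*(F_ω) · Ψ = ½ e^μ · e^ν · χ_*(F_{μν}) Ψ`. -/
def curvPsi (x : M) : Fin 4 → V :=
  (1 / 2 : ℝ) • ∑ μ, ∑ ν, spinMul (gammaUp μ) (spinMul (gammaUp ν)
    (twistMul (D.chi.deriv (f.F σ μ ν x)) (f.psi σ x)))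

/-! ### The Euler-Lagrange system and the wave system -/

/-- `(ω, Φ, Ψ)` solves the Yang-Mills-Higgs-Dirac system. Equality of sections is equality of
their representatives in every local gauge. -/
structure SolvesEulerLagrange : Prop where
  yangMills : ∀ σ : LocalGauge D, ∀ x ∈ σ.dom, ∀ ν,
    f.codiffF σ ν x + f.higgsCurrent σ ν x - (1 / 2 : ℝ) • f.diracCurrent σ ν x = 0
  higgsEq : ∀ σ : LocalGauge D, ∀ x ∈ σ.dom,
    f.boxPhi σ x - (1 / 2 : ℝ) • f.gradU σ x - f.yukawaCurrent σ x = 0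
  diracEq : ∀ σ : LocalGauge D, ∀ x ∈ σ.dom,
    f.dirac σ x + f.yukawaPsi σ x = 0

end Fields

end Local

end YMHD

end

open YMHD

/-! Each wave equation arises by differentiating one equation of the first-order system once more
and commuting covariant derivatives. The Higgs equation already is a wave equation and is only
rearranged.

Spinor: apply the Dirac operator to D̸Ψ = -Y_Φ Ψ. On the left, the Weitzenböck formula
(`dirac_dirac`) gives D̸²Ψ = -□Ψ + ¼ Scal Ψ + χ_*(F)·Ψ. The scalar curvature is what survives of the
Riemann tensor contracted with four gamma matrices (`lichnerowicz`). On the right, the Yukawa map is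
parallel by equivariance (`derivSpinor_yukawa`), so the product rule gives -Y_{∇Φ}·Ψ - Y_Φ D̸Ψ, and
the Dirac equation is used a second time.

Field strength: F satisfies the Bianchi identity, whose derivative gives ∇^κ∇_κ F_{μν} = ∇^κ∇_μ
F_{κν} - ∇^κ∇_ν F_{κμ}. Commuting the derivatives produces [F, F] and the Ricci and Riemann terms;
what remains is the exterior covariant derivative of the divergence ∇^κ F_{κν} (`twoForm_box`). The
Yang-Mills equation identifies this divergence with the current. The two parts of the current are
momentum maps, which are parallel because the inner product on 𝔤 is Ad-invariant and the
representations are unitary (`lieBr_momentum`). Hence their exterior derivatives follow from the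
product rule: the antisymmetrised Hessian of Φ yields ρ_*(F)Φ, and symmetry of Clifford
multiplication makes the two halves of the Dirac term agree.

All of this is computed in an orthonormal frame. The geometric input is that the Lie bracket is the
commutator of derivations. It makes frame derivatives commute up to structure functions
(`frameDeriv_comm`), which satisfy the Jacobi identity (`bracketCoeff_jacobi`); from this follow the
first Bianchi identity and the symmetries of the Riemann tensor. On the group side, differentiating
Ad and the representations at 1 gives the infinitesimal invariance statements. -/

noncomputable section

namespace YMHD

/-! ## The Lie bracket as a commutator of derivations -/

section Bracket

open VectorField Filter Topology

variable {E : Type*} [NormedAddCommGroup E] [NormedSpace ℝ E] [CompleteSpace E]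
  {H : Type*} [TopologicalSpace H] {I : ModelWithCorners ℝ E H} [I.Boundaryless]
  {N : Type*} [TopologicalSpace N] [ChartedSpace H N] [IsManifold I 2 N]
  {X : Type*} [NormedAddCommGroup X] [NormedSpace ℝ X]

theorem mvfderiv_congr {f g : N → X} {x : N} (h : f =ᶠ[𝓝 x] g) :
    mvfderiv I f x = mvfderiv I g x :=
  EventuallyEq.mfderiv_eq h

/-- The derivatives of the chart and of its inverse are mutually inverse, so pulling a field back
along the inverse chart amounts to pushing it forward by the chart. -/
theorem mpullbackWithin_extChartAt_symm_apply (V : ∀ y : N, TangentSpace I y) {x y : N}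
    (hy : y ∈ (extChartAt I x).source) :
    mpullbackWithin 𝓘(ℝ, E) I (extChartAt I x).symm V (Set.range I) (extChartAt I x y) =
      mvfderiv I (extChartAt I x) y (V y) := by
  have : IsManifold I 1 N := IsManifold.of_le (n := 2) (by norm_num)
  have h2 := (extChartAt I x).left_inv hy
  have h1 : (mfderivWithin 𝓘(ℝ, E) I (extChartAt I x).symm (Set.range I)
      (extChartAt I x y)).inverse =
      mfderiv I 𝓘(ℝ, E) (extChartAt I x) ((extChartAt I x).symm (extChartAt I x y)) :=
    ContinuousLinearMap.inverse_eq
      (mfderivWithin_extChartAt_symm_comp_mfderiv_extChartAt ((extChartAt I x).map_source hy))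
      (mfderiv_extChartAt_comp_mfderivWithin_extChartAt_symm ((extChartAt I x).map_source hy))
  calc _ = mvfderiv I (extChartAt I x) ((extChartAt I x).symm (extChartAt I x y))
        (V ((extChartAt I x).symm (extChartAt I x y))) :=
        congrArg (fun L : E →L[ℝ] E ↦ L (V ((extChartAt I x).symm (extChartAt I x y)))) h1
    _ = _ := by rw [h2]

theorem mvfderiv_comp_extChartAt {h : E → X} {x y : N} (hy : y ∈ (extChartAt I x).source)
    (hh : DifferentiableAt ℝ h (extChartAt I x y)) (v : TangentSpace I y) :
    mvfderiv I (fun z ↦ h (extChartAt I x z)) y v =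
      fderiv ℝ h (extChartAt I x y) (mvfderiv I (extChartAt I x) y v) := by
  have : IsManifold I 1 N := IsManifold.of_le (n := 2) (by norm_num)
  have h1 : MDifferentiableAt I 𝓘(ℝ, E) (extChartAt I x) y :=
    mdifferentiableAt_extChartAt (by rwa [extChartAt_source] at hy)
  have := mfderiv_comp (I' := 𝓘(ℝ, E)) (g := h) (f := extChartAt I x) y
    hh.mdifferentiableAt h1
  rw [mfderiv_eq_fderiv] at this
  exact congrArg (fun L : E →L[ℝ] X ↦ L v) this

/-- The Lie bracket of vector fields acts on functions as the commutator. -/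
theorem mvfderiv_mlieBracket {f : N → X} {V W : ∀ y : N, TangentSpace I y} {x : N}
    (hf : ContMDiffAt I 𝓘(ℝ, X) 2 f x)
    (hV : MDifferentiableAt I I.tangent (fun y ↦ (⟨y, V y⟩ : TangentBundle I N)) x)
    (hW : MDifferentiableAt I I.tangent (fun y ↦ (⟨y, W y⟩ : TangentBundle I N)) x) :
    mvfderiv I f x (mlieBracket I V W x) =
      mvfderiv I (fun y ↦ mvfderiv I f y (W y)) x (V x)
        - mvfderiv I (fun y ↦ mvfderiv I f y (V y)) x (W x) := by
  have : IsManifold I 1 N := IsManifold.of_le (n := 2) (by norm_num)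
  have hx : x ∈ (extChartAt I x).source := mem_extChartAt_source x
  obtain ⟨g, hg⟩ : ∃ g : E → X, g = f ∘ (extChartAt I x).symm := ⟨_, rfl⟩
  have hgs : ContDiffAt ℝ 2 g (extChartAt I x x) := by
    rw [contMDiffAt_iff] at hf
    have h := hf.2
    simp only [I.range_eq_univ, contDiffWithinAt_univ, extChartAt_model_space_eq_id,
      PartialEquiv.refl_coe, Function.id_comp] at h
    rwa [hg]
  have hgd : ∀ᶠ y in 𝓝 x, DifferentiableAt ℝ g (extChartAt I x y) := by
    have h1 : ∀ᶠ u in 𝓝 (extChartAt I x x), DifferentiableAt ℝ g u := by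
      filter_upwards [hgs.eventually (by simp)] with u hu
      exact hu.differentiableAt (by norm_num)
    exact (continuousAt_extChartAt x).eventually h1
  have hsrc : ∀ᶠ y in 𝓝 x, y ∈ (extChartAt I x).source := extChartAt_source_mem_nhds x
  have hfg : ∀ᶠ y in 𝓝 x, f y = g (extChartAt I x y) := by
    filter_upwards [hsrc] with y hy
    rw [hg, Function.comp_apply, (extChartAt I x).left_inv hy]
  -- `T Z` is the field Z read in the chart at x, as `g` is the function f. The claim thereby
  -- becomes the bracket formula in the vector space E.
  let T (Z : ∀ y : N, TangentSpace I y) : E → E :=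
    mpullbackWithin 𝓘(ℝ, E) I (extChartAt I x).symm Z (Set.range I)
  have hT : ∀ Z, ∀ y ∈ (extChartAt I x).source, mvfderiv I (extChartAt I x) y (Z y) =
      T Z (extChartAt I x y) := fun Z y hy ↦ (mpullbackWithin_extChartAt_symm_apply Z hy).symm
  have key : ∀ (Z : ∀ y : N, TangentSpace I y), ∀ᶠ y in 𝓝 x,
      mvfderiv I f y (Z y) = fderiv ℝ g (extChartAt I x y) (T Z (extChartAt I x y)) := by
    intro Z
    filter_upwards [hsrc, hgd, hfg.eventually_nhds] with y hy hd he
    rw [mvfderiv_congr he, mvfderiv_comp_extChartAt hy hd, hT Z y hy]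
  have hd : ∀ (Z : ∀ y : N, TangentSpace I y),
      MDifferentiableAt I I.tangent (fun y ↦ (⟨y, Z y⟩ : TangentBundle I N)) x →
      DifferentiableAt ℝ (T Z) (extChartAt I x x) := by
    intro Z hZ
    have h := MDifferentiableWithinAt.differentiableWithinAt_mpullbackWithin_vectorField
      (hZ.mdifferentiableWithinAt (s := Set.univ))
    rw [Set.preimage_univ, Set.univ_inter] at h
    exact h.differentiableAt (by rw [I.range_eq_univ]; exact Filter.univ_mem)
  have hfd : DifferentiableAt ℝ (fderiv ℝ g) (extChartAt I x x) :=
    (hgs.fderiv_right (m := 1) (by norm_num)).differentiableAt (by norm_num)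
  have key2 : ∀ (Z Z' : ∀ y : N, TangentSpace I y),
      MDifferentiableAt I I.tangent (fun y ↦ (⟨y, Z y⟩ : TangentBundle I N)) x →
      mvfderiv I (fun y ↦ mvfderiv I f y (Z y)) x (Z' x) =
      fderiv ℝ (fun u ↦ fderiv ℝ g u (T Z u)) (extChartAt I x x) (T Z' (extChartAt I x x)) := by
    intro Z Z' hZ
    rw [mvfderiv_congr (key Z), ← hT Z' x hx]
    exact mvfderiv_comp_extChartAt (h := fun u ↦ fderiv ℝ g u (T Z u)) hx
      (hfd.clm_apply (hd Z hZ)) _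
  rw [key2 W V hW, key2 V W hV, mvfderiv_congr hfg,
    mvfderiv_comp_extChartAt hx hgd.self_of_nhds]
  have h3 : mvfderiv I (extChartAt I x) x (mlieBracket I V W x) =
      lieBracket ℝ (T V) (T W) (extChartAt I x x) := by
    have hi := isInvertible_mfderiv_extChartAt (I := I) hx
    have h4 := hi.self_apply_inverse
      (lieBracket ℝ (T V) (T W) (extChartAt I x x) : E)
    refine Eq.trans ?_ h4
    -- The manifold bracket is by definition the chart pullback of a bracket within the range of I,
    -- which is all of E in the boundaryless case.
    have h5 : lieBracketWithin ℝ (T V) (T W) ((extChartAt I x).symm ⁻¹' Set.univ ∩ Set.range I)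
        (extChartAt I x x) = lieBracket ℝ (T V) (T W) (extChartAt I x x) := by
      rw [Set.preimage_univ, Set.univ_inter, I.range_eq_univ, lieBracketWithin_univ]
    rw [← h5]
    rfl
  rw [h3]
  exact fderiv_apply_lieBracket hgs (by simp) (hd W hW) (hd V hV)

end Bracket

/-! ### Derivatives of linear and bilinear expressions. -/

section Rules

variable {E : Type*} [NormedAddCommGroup E] [NormedSpace ℝ E]
  {H : Type*} [TopologicalSpace H] {I : ModelWithCorners ℝ E H}
  {N : Type*} [TopologicalSpace N] [ChartedSpace H N]
  {X Y Z : Type*} [NormedAddCommGroup X] [NormedSpace ℝ X] [NormedAddCommGroup Y]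
  [NormedSpace ℝ Y] [NormedAddCommGroup Z] [NormedSpace ℝ Z]

theorem mvfderiv_clm (L : X →L[ℝ] Y) {u : N → X} {x : N} (hu : MDifferentiableAt I 𝓘(ℝ, X) u x)
    (v : TangentSpace I x) : mvfderiv I (fun y ↦ L (u y)) x v = L (mvfderiv I u x v) := by
  have h1 : HasMFDerivAt 𝓘(ℝ, X) 𝓘(ℝ, Y) L (u x) L := L.hasMFDerivAt
  have h := (h1.comp x hu.hasMFDerivAt).mfderiv
  exact congrArg (fun T : TangentSpace I x →L[ℝ] Y ↦ T v) h

theorem mvfderiv_bilin (L : X →L[ℝ] Y →L[ℝ] Z) {u : N → X} {w : N → Y} {x : N}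
    (hu : MDifferentiableAt I 𝓘(ℝ, X) u x) (hw : MDifferentiableAt I 𝓘(ℝ, Y) w x)
    (v : TangentSpace I x) :
    mvfderiv I (fun y ↦ L (u y) (w y)) x v =
      L (mvfderiv I u x v) (w x) + L (u x) (mvfderiv I w x v) := by
  have h1 : HasMFDerivAt 𝓘(ℝ, X × Y) 𝓘(ℝ, Z) (fun p : X × Y ↦ L p.1 p.2) (u x, w x)
      (L.deriv₂ (u x, w x)) := (L.hasFDerivAt_of_bilinear hasFDerivAt_fst hasFDerivAt_snd).hasMFDerivAt
  have h2 : HasMFDerivAt I 𝓘(ℝ, X × Y) (fun y ↦ (u y, w y)) x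
      ((mvfderiv I u x).prod (mvfderiv I w x)) :=
    ⟨hu.continuousAt.prodMk hw.continuousAt, hu.hasMFDerivAt.2.prodMk hw.hasMFDerivAt.2⟩
  have h := (HasMFDerivAt.comp x h1 h2).mfderiv
  refine (congrArg (fun T : TangentSpace I x →L[ℝ] Z ↦ T v) h).trans ?_
  exact add_comm _ _

end Rules

/-! ## Calculus in a smooth frame on an open set -/

section FrameCalculus

open VectorField Filter Topology

variable {M : Type*} [TopologicalSpace M] [ChartedSpace (EuclideanSpace ℝ (Fin 4)) M]
  [IsManifold (𝓡 4) ∞ M]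
  {X Y Z : Type*} [NormedAddCommGroup X] [NormedSpace ℝ X] [NormedAddCommGroup Y]
  [NormedSpace ℝ Y] [NormedAddCommGroup Z] [NormedSpace ℝ Z]
  {s : Set M} {u u' : M → X} {w : M → Y} {x : M}

/-- Smoothness on a set of a vector-valued function. -/
abbrev SmoothOn (u : M → X) (s : Set M) : Prop := ContMDiffOn (𝓡 4) 𝓘(ℝ, X) ∞ u s

theorem SmoothOn.mdifferentiableAt (hs : IsOpen s) (hu : SmoothOn u s) (hx : x ∈ s) :
    MDifferentiableAt (𝓡 4) 𝓘(ℝ, X) u x :=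
  (hu.contMDiffAt (hs.mem_nhds hx)).mdifferentiableAt (by simp)

theorem SmoothOn.add (hu : SmoothOn u s) (hu' : SmoothOn u' s) :
    SmoothOn (fun x ↦ u x + u' x) s := ContMDiffOn.add hu hu'

theorem SmoothOn.sub (hu : SmoothOn u s) (hu' : SmoothOn u' s) :
    SmoothOn (fun x ↦ u x - u' x) s := ContMDiffOn.sub hu hu'

theorem SmoothOn.const (c : X) : SmoothOn (fun _ : M ↦ c) s := contMDiffOn_const

theorem SmoothOn.sum {ι : Type*} [Fintype ι] {u : ι → M → X} (hu : ∀ i, SmoothOn (u i) s) :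
    SmoothOn (fun x ↦ ∑ i, u i x) s := contMDiffOn_finsetSum fun i _ ↦ hu i

theorem SmoothOn.clm (L : X →L[ℝ] Y) (hu : SmoothOn u s) : SmoothOn (fun x ↦ L (u x)) s :=
  L.contMDiff.comp_contMDiffOn hu

theorem SmoothOn.bilin (L : X →L[ℝ] Y →L[ℝ] Z) (hu : SmoothOn u s) (hw : SmoothOn w s) :
    SmoothOn (fun x ↦ L (u x) (w x)) s :=
  (hu.clm L).clm_apply hw

theorem SmoothOn.smul {f : M → ℝ} (hf : SmoothOn f s) (hu : SmoothOn u s) :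
    SmoothOn (fun x ↦ f x • u x) s := ContMDiffOn.smul hf hu

theorem SmoothOn.mul {f g : M → ℝ} (hf : SmoothOn f s) (hg : SmoothOn g s) :
    SmoothOn (fun x ↦ f x * g x) s := SmoothOn.smul hf hg

theorem SmoothOn.pi {ι : Type*} [Fintype ι] {u : M → ι → X} (hu : ∀ i, SmoothOn (fun x ↦ u x i) s) :
    SmoothOn u s := contMDiffOn_pi_space.2 hu

theorem SmoothOn.apply {ι : Type*} [Fintype ι] {u : M → ι → X} (hu : SmoothOn u s) (i : ι) :
    SmoothOn (fun x ↦ u x i) s := contMDiffOn_pi_space.1 hu i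

variable {e : Fin 4 → ∀ x : M, TangentSpace (𝓡 4) x} {μ : Fin 4}

theorem frameDeriv_eq (μ : Fin 4) (u : M → X) (x : M) :
    frameDeriv e μ u x = mvfderiv (𝓡 4) u x (e μ x) := rfl

theorem frameDeriv_congr (hs : IsOpen s) (hx : x ∈ s) (h : Set.EqOn u u' s) :
    frameDeriv e μ u x = frameDeriv e μ u' x := by
  rw [frameDeriv_eq, frameDeriv_eq, mvfderiv_congr (h.eventuallyEq_of_mem (hs.mem_nhds hx))]

theorem frameDeriv_clm (hs : IsOpen s) (L : X →L[ℝ] Y) (hu : SmoothOn u s) (hx : x ∈ s) :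
    frameDeriv e μ (fun x ↦ L (u x)) x = L (frameDeriv e μ u x) :=
  mvfderiv_clm L (hu.mdifferentiableAt hs hx) _

theorem frameDeriv_bilin (hs : IsOpen s) (L : X →L[ℝ] Y →L[ℝ] Z) (hu : SmoothOn u s)
    (hw : SmoothOn w s) (hx : x ∈ s) :
    frameDeriv e μ (fun x ↦ L (u x) (w x)) x =
      L (frameDeriv e μ u x) (w x) + L (u x) (frameDeriv e μ w x) :=
  mvfderiv_bilin L (hu.mdifferentiableAt hs hx) (hw.mdifferentiableAt hs hx) _

theorem frameDeriv_smul (hs : IsOpen s) {f : M → ℝ} (hf : SmoothOn f s) (hu : SmoothOn u s)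
    (hx : x ∈ s) : frameDeriv e μ (fun x ↦ f x • u x) x =
      frameDeriv e μ f x • u x + f x • frameDeriv e μ u x :=
  frameDeriv_bilin hs (ContinuousLinearMap.lsmul ℝ ℝ) hf hu hx

theorem frameDeriv_const_smul (hs : IsOpen s) (c : ℝ) (hu : SmoothOn u s)
    (hx : x ∈ s) : frameDeriv e μ (fun x ↦ c • u x) x = c • frameDeriv e μ u x :=
  frameDeriv_clm hs (c • ContinuousLinearMap.id ℝ X) hu hx

theorem frameDeriv_add (hs : IsOpen s) (hu : SmoothOn u s) (hu' : SmoothOn u' s) (hx : x ∈ s) :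
    frameDeriv e μ (fun x ↦ u x + u' x) x = frameDeriv e μ u x + frameDeriv e μ u' x := by
  have h := mvfderiv_add (hu.mdifferentiableAt hs hx) (hu'.mdifferentiableAt hs hx)
  exact congrArg (fun T : TangentSpace (𝓡 4) x →L[ℝ] X ↦ T (e μ x)) h

theorem frameDeriv_sub (hs : IsOpen s) (hu : SmoothOn u s) (hu' : SmoothOn u' s) (hx : x ∈ s) :
    frameDeriv e μ (fun x ↦ u x - u' x) x = frameDeriv e μ u x - frameDeriv e μ u' x := by
  have h := mvfderiv_sub (hu.mdifferentiableAt hs hx) (hu'.mdifferentiableAt hs hx)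
  exact congrArg (fun T : TangentSpace (𝓡 4) x →L[ℝ] X ↦ T (e μ x)) h

theorem frameDeriv_const (c : X) : frameDeriv e μ (fun _ : M ↦ c) x = 0 := by
  rw [frameDeriv_eq, mvfderiv_const]; rfl

theorem frameDeriv_sum_finset {ι : Type*} (t : Finset ι) (hs : IsOpen s) {u : ι → M → X}
    (hu : ∀ i, SmoothOn (u i) s) (hx : x ∈ s) :
    frameDeriv e μ (fun x ↦ ∑ i ∈ t, u i x) x = ∑ i ∈ t, frameDeriv e μ (u i) x := by
  classical
  induction t using Finset.induction_on with
  | empty => simpa using frameDeriv_const (e := e) (0 : X)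
  | insert i t hi ih =>
    simp only [Finset.sum_insert hi]
    rw [frameDeriv_add hs (hu i) (contMDiffOn_finsetSum fun i _ ↦ hu i) hx, ih]

theorem frameDeriv_sum {ι : Type*} [Fintype ι] (hs : IsOpen s) {u : ι → M → X}
    (hu : ∀ i, SmoothOn (u i) s) (hx : x ∈ s) :
    frameDeriv e μ (fun x ↦ ∑ i, u i x) x = ∑ i, frameDeriv e μ (u i) x :=
  frameDeriv_sum_finset _ hs hu hx

/-- The derivative along e_μ is the fibre component of the tangent map of u composed with the
section e_μ. -/
theorem SmoothOn.frameDeriv (hs : IsOpen s) (he : ∀ μ, SmoothVectorFieldOn (e μ) s)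
    (hu : SmoothOn u s) : SmoothOn (frameDeriv e μ u) s := by
  have : IsManifold (𝓡 4) 1 M := IsManifold.of_le (n := ∞) (by simp)
  have h1 := ContMDiffOn.contMDiffOn_tangentMapWithin (m := ∞) hu (by simp) hs.uniqueMDiffOn
  have h2 := h1.comp (he μ) fun x hx ↦ hx
  have h3 := (contMDiff_snd_tangentBundle_modelSpace (n := ∞) X 𝓘(ℝ, X)).comp_contMDiffOn h2
  refine h3.congr fun x hx ↦ ?_
  exact (congrArg (fun T : TangentSpace (𝓡 4) x →L[ℝ] X ↦ T (e μ x))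
    (mfderivWithin_of_isOpen hs hx)).symm

theorem SmoothVectorFieldOn.mlieBracket (hs : IsOpen s) {V W : ∀ x : M, TangentSpace (𝓡 4) x}
    (hV : SmoothVectorFieldOn V s) (hW : SmoothVectorFieldOn W s) :
    SmoothVectorFieldOn (mlieBracket (𝓡 4) V W) s := by
  have : IsManifold (𝓡 4) (minSmoothness ℝ 2) M := by
    rw [minSmoothness_of_isRCLikeNormedField]
    exact IsManifold.of_le (n := ∞) (by norm_cast)
  have : IsManifold (𝓡 4) (((⊤ : ℕ∞) : ℕ∞ω) + 1) M := by simpa using ‹IsManifold (𝓡 4) ∞ M›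
  intro x hx
  refine ContMDiffAt.contMDiffWithinAt ?_
  exact ContMDiffAt.mlieBracket_vectorField (m := ⊤) (n := ⊤) (hV.contMDiffAt (hs.mem_nhds hx))
    (hW.contMDiffAt (hs.mem_nhds hx)) (by simp)

theorem LorentzMetric.smoothOn_val (h : LorentzMetric M) {V W : ∀ x : M, TangentSpace (𝓡 4) x}
    (hV : SmoothVectorFieldOn V s) (hW : SmoothVectorFieldOn W s) :
    SmoothOn (fun x ↦ h.val x (V x) (W x)) s := by
  have : IsManifold (𝓡 4) 1 M := IsManifold.of_le (n := ∞) (by simp)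
  have h1 : ContMDiffOn (𝓡 4) ((𝓡 4).prod 𝓘(ℝ, ℝ)) ∞
      (fun x ↦ Bundle.TotalSpace.mk' ℝ (E := Bundle.Trivial M ℝ) x (h.val x (V x) (W x))) s := by
    apply ContMDiffOn.clm_bundle_apply₂ (F₁ := EuclideanSpace ℝ (Fin 4))
      (F₂ := EuclideanSpace ℝ (Fin 4))
    · exact h.smooth.contMDiffOn
    · exact hV
    · exact hW
  intro x hx
  have := h1 x hx
  rw [Bundle.contMDiffWithinAt_section] at this
  exact this

/-- A smooth orthonormal frame of a Lorentz metric on an open set. -/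
structure IsOrthonormalFrame (h : LorentzMetric M) (e : Fin 4 → ∀ x : M, TangentSpace (𝓡 4) x)
    (s : Set M) : Prop where
  isOpen : IsOpen s
  smooth : ∀ μ, SmoothVectorFieldOn (e μ) s
  orthonormal : ∀ x ∈ s, ∀ μ ν, h.val x (e μ x) (e ν x) = minkowski μ ν

theorem eta_mul_self (μ : Fin 4) : eta μ * eta μ = 1 := by
  unfold eta; split_ifs <;> norm_num

theorem eta_ne_zero (μ : Fin 4) : eta μ ≠ 0 := left_ne_zero_of_mul_eq_one (eta_mul_self μ)

/-- The coefficients of the Lie bracket `[e_μ, e_ν]` in the frame. -/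
def bracketCoeff (h : LorentzMetric M) (e : Fin 4 → ∀ x : M, TangentSpace (𝓡 4) x)
    (μ ν κ : Fin 4) (x : M) : ℝ := christoffelUp h e μ ν κ x - christoffelUp h e ν μ κ x

theorem bracketCoeff_swap (h : LorentzMetric M) (μ ν κ : Fin 4) (x : M) :
    bracketCoeff h e μ ν κ x = -bracketCoeff h e ν μ κ x := by
  unfold bracketCoeff; ring

namespace IsOrthonormalFrame

variable {h : LorentzMetric M} (hf : IsOrthonormalFrame h e s)
include hf

theorem linearIndependent (hx : x ∈ s) : LinearIndependent ℝ fun μ ↦ e μ x := by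
  rw [Fintype.linearIndependent_iff]
  intro c hc κ
  have h1 : h.val x (∑ μ, c μ • e μ x) (e κ x) = 0 := by rw [hc]; simp
  simp only [map_sum, map_smul, sum_apply, smul_apply,
    hf.orthonormal x hx, smul_eq_mul, minkowski, mul_ite, mul_zero, Finset.sum_ite_eq',
    Finset.mem_univ, if_true] at h1
  exact (mul_eq_zero.1 h1).resolve_right (eta_ne_zero κ)

/-- Pairing with e_κ isolates the κ-th coefficient up to the sign `eta κ`, which is its own inverse.
-/
theorem sum_smul (hx : x ∈ s) (v : TangentSpace (𝓡 4) x) :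
    v = ∑ κ, (eta κ * h.val x v (e κ x)) • e κ x := by
  have hd : Module.finrank ℝ (TangentSpace (𝓡 4) x) = 4 := by
    change Module.finrank ℝ (EuclideanSpace ℝ (Fin 4)) = 4
    simp
  have : FiniteDimensional ℝ (TangentSpace (𝓡 4) x) :=
    inferInstanceAs (FiniteDimensional ℝ (EuclideanSpace ℝ (Fin 4)))
  let b := basisOfLinearIndependentOfCardEqFinrank (hf.linearIndependent hx) (by simp [hd])
  have hb : ∀ μ, b μ = e μ x := fun μ ↦ by simp [b]
  have hv : v = ∑ μ, b.repr v μ • e μ x := by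
    conv_lhs => rw [← b.sum_repr v]
    simp only [hb]
  have hr : ∀ κ, eta κ * h.val x v (e κ x) = b.repr v κ := by
    intro κ
    conv_lhs => rw [hv]
    simp only [map_sum, map_smul, sum_apply, smul_apply,
      hf.orthonormal x hx, smul_eq_mul, minkowski, mul_ite, mul_zero, Finset.sum_ite_eq',
      Finset.mem_univ, if_true]
    rw [mul_left_comm, eta_mul_self, mul_one]
  simp only [hr]
  exact hv

theorem mlieBracket_eq (hx : x ∈ s) (μ ν : Fin 4) :
    mlieBracket (𝓡 4) (e μ) (e ν) x = ∑ κ, bracketCoeff h e μ ν κ x • e κ x := by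
  rw [hf.sum_smul hx (mlieBracket (𝓡 4) (e μ) (e ν) x)]
  refine Finset.sum_congr rfl fun κ _ ↦ ?_
  unfold bracketCoeff christoffelUp
  rw [← mul_sub, christoffel_torsion_free]
  rfl

theorem smoothOn_christoffelUp (μ ν κ : Fin 4) : SmoothOn (christoffelUp h e μ ν κ) s := by
  have h1 : ∀ a b c, SmoothOn (structureCoeff h e a b c) s := fun a b c ↦
    h.smoothOn_val ((hf.smooth a).mlieBracket hf.isOpen (hf.smooth b)) (hf.smooth c)
  have h2 := (SmoothOn.const (s := s) (eta κ)).mul ((SmoothOn.const (s := s) (2⁻¹ : ℝ)).mul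
    (((h1 μ ν κ).add (h1 κ μ ν)).sub (h1 ν κ μ)))
  refine h2.congr fun x _ ↦ ?_
  unfold christoffelUp christoffel
  ring

theorem smoothOn_bracketCoeff (μ ν κ : Fin 4) : SmoothOn (bracketCoeff h e μ ν κ) s :=
  (hf.smoothOn_christoffelUp μ ν κ).sub (hf.smoothOn_christoffelUp ν μ κ)

theorem smoothOn_frameDeriv (hu : SmoothOn u s) : SmoothOn (frameDeriv e μ u) s :=
  hu.frameDeriv hf.isOpen hf.smooth

/-- The bracket acts as a commutator of derivations, and its expansion in the frame has the
coefficients Γ_{μν}^κ - Γ_{νμ}^κ because the connection is torsion-free. -/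
theorem frameDeriv_comm (hu : SmoothOn u s) (hx : x ∈ s) (μ ν : Fin 4) :
    frameDeriv e μ (frameDeriv e ν u) x - frameDeriv e ν (frameDeriv e μ u) x =
      ∑ κ, bracketCoeff h e μ ν κ x • frameDeriv e κ u x := by
  have : IsManifold (𝓡 4) 2 M := IsManifold.of_le (n := ∞) (by norm_cast)
  have hd : ∀ μ, MDifferentiableAt (𝓡 4) (𝓡 4).tangent
      (fun y ↦ (⟨y, e μ y⟩ : TangentBundle (𝓡 4) M)) x := fun μ ↦
    ((hf.smooth μ).contMDiffAt (hf.isOpen.mem_nhds hx)).mdifferentiableAt (by simp)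
  have h1 := mvfderiv_mlieBracket ((hu.contMDiffAt (hf.isOpen.mem_nhds hx)).of_le
    (by norm_cast)) (hd μ) (hd ν)
  rw [hf.mlieBracket_eq hx] at h1
  rw [frameDeriv_eq, frameDeriv_eq]
  refine h1.symm.trans ?_
  simp only [map_sum, map_smul]
  rfl

theorem mono {t : Set M} (ht : IsOpen t) (hts : t ⊆ s) : IsOrthonormalFrame h e t :=
  ⟨ht, fun μ ↦ (hf.smooth μ).mono hts, fun x hx ↦ hf.orthonormal x (hts hx)⟩

/-- A weak form of the Jacobi identity, tested on a function u; a suitable vector-valued u later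
separates the coefficients. -/
theorem sum_bracketCoeff_jacobi_smul (hu : SmoothOn u s) (hx : x ∈ s) (μ ν κ : Fin 4) :
    ∑ ρ, ((frameDeriv e μ (bracketCoeff h e ν κ ρ) x
        + ∑ α, bracketCoeff h e ν κ α x * bracketCoeff h e μ α ρ x)
      + (frameDeriv e ν (bracketCoeff h e κ μ ρ) x
        + ∑ α, bracketCoeff h e κ μ α x * bracketCoeff h e ν α ρ x)
      + (frameDeriv e κ (bracketCoeff h e μ ν ρ) x
        + ∑ α, bracketCoeff h e μ ν α x * bracketCoeff h e κ α ρ x)) • frameDeriv e ρ u x = 0 := by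
  have hd : ∀ ρ, SmoothOn (frameDeriv e ρ u) s := fun ρ ↦ hf.smoothOn_frameDeriv hu
  -- Each summand is the double commutator [e_a, [e_b, e_c]] u, and the cyclic sum of double
  -- commutators of operators vanishes.
  have key : ∀ a b c, ∑ ρ, (frameDeriv e a (bracketCoeff h e b c ρ) x
        + ∑ α, bracketCoeff h e b c α x * bracketCoeff h e a α ρ x) • frameDeriv e ρ u x =
      (frameDeriv e a (frameDeriv e b (frameDeriv e c u)) x
        - frameDeriv e a (frameDeriv e c (frameDeriv e b u)) x)
      - (frameDeriv e b (frameDeriv e c (frameDeriv e a u)) x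
        - frameDeriv e c (frameDeriv e b (frameDeriv e a u)) x) := by
    intro a b c
    rw [hf.frameDeriv_comm (hd a) hx b c,
      ← frameDeriv_sub hf.isOpen (hf.smoothOn_frameDeriv (hd c)) (hf.smoothOn_frameDeriv (hd b)) hx,
      frameDeriv_congr hf.isOpen hx fun y hy ↦ hf.frameDeriv_comm hu hy b c,
      frameDeriv_sum hf.isOpen (fun ρ ↦ (hf.smoothOn_bracketCoeff b c ρ).smul (hd ρ)) hx,
      ← Finset.sum_sub_distrib]
    have h1 : ∀ ρ, frameDeriv e a (fun x ↦ bracketCoeff h e b c ρ x • frameDeriv e ρ u x) x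
        - bracketCoeff h e b c ρ x • frameDeriv e ρ (frameDeriv e a u) x =
        frameDeriv e a (bracketCoeff h e b c ρ) x • frameDeriv e ρ u x
          + ∑ α, (bracketCoeff h e b c ρ x * bracketCoeff h e a ρ α x) • frameDeriv e α u x := by
      intro ρ
      rw [frameDeriv_smul hf.isOpen (hf.smoothOn_bracketCoeff b c ρ) (hd ρ) hx, add_sub_assoc,
        ← smul_sub, hf.frameDeriv_comm hu hx, Finset.smul_sum]
      simp only [smul_smul]
    simp only [h1, Finset.sum_add_distrib, add_smul, Finset.sum_smul]
    rw [Finset.sum_comm]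
  simp only [add_smul _ (_ : ℝ) (frameDeriv e _ u x), Finset.sum_add_distrib] at key ⊢
  simp only [key]
  abel

/-- The Jacobi identity for the structure functions of the frame. -/
theorem bracketCoeff_jacobi (hx : x ∈ s) (μ ν κ ρ : Fin 4) :
    (frameDeriv e μ (bracketCoeff h e ν κ ρ) x
        + ∑ α, bracketCoeff h e ν κ α x * bracketCoeff h e μ α ρ x)
      + (frameDeriv e ν (bracketCoeff h e κ μ ρ) x
        + ∑ α, bracketCoeff h e κ μ α x * bracketCoeff h e ν α ρ x)
      + (frameDeriv e κ (bracketCoeff h e μ ν ρ) x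
        + ∑ α, bracketCoeff h e μ ν α x * bracketCoeff h e κ α ρ x) = 0 := by
  have : IsManifold (𝓡 4) 1 M := IsManifold.of_le (n := ∞) (by simp)
  -- The test function is the chart at x itself, on the smaller open set where it is smooth. Its
  -- differential is invertible, so the frame derivatives at x are linearly independent and every
  -- coefficient vanishes.
  have hm : IsOrthonormalFrame h e (s ∩ (chartAt (EuclideanSpace ℝ (Fin 4)) x).source) :=
    hf.mono (hf.isOpen.inter (chartAt _ x).open_source) Set.inter_subset_left
  have hu : SmoothOn (extChartAt (𝓡 4) x)
      (s ∩ (chartAt (EuclideanSpace ℝ (Fin 4)) x).source) :=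
    contMDiffOn_extChartAt.mono Set.inter_subset_right
  have h1 := hm.sum_bracketCoeff_jacobi_smul hu ⟨hx, mem_chart_source _ x⟩ μ ν κ
  have h2 : LinearIndependent ℝ fun ρ ↦ frameDeriv e ρ (extChartAt (𝓡 4) x) x := by
    obtain ⟨L, hL⟩ := isInvertible_mfderiv_extChartAt (I := 𝓡 4) (mem_extChartAt_source (I := 𝓡 4) x)
    have h3 := (hf.linearIndependent hx).map' L.toLinearEquiv.toLinearMap
      L.toLinearEquiv.ker
    have h4 : (fun ρ ↦ frameDeriv e ρ (extChartAt (𝓡 4) x) x) = fun ρ ↦ L (e ρ x) :=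
      funext fun ρ ↦ congrArg
        (fun T : TangentSpace (𝓡 4) x →L[ℝ] EuclideanSpace ℝ (Fin 4) ↦ T (e ρ x)) hL.symm
    rw [h4]
    exact h3
  exact Fintype.linearIndependent_iff.1 h2 _ h1 ρ

end IsOrthonormalFrame

end FrameCalculus

/-! ## Covariant derivatives along a frame -/

section CovariantDerivative

variable {M : Type*} [TopologicalSpace M] [ChartedSpace (EuclideanSpace ℝ (Fin 4)) M]
  [IsManifold (𝓡 4) ∞ M]
  {X : Type*} [NormedAddCommGroup X] [NormedSpace ℝ X]
  {h : LorentzMetric M} {e : Fin 4 → ∀ x : M, TangentSpace (𝓡 4) x} {s : Set M} {x : M}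

/-- The operators `D_μ` are the components, along the frame, of a covariant derivative on smooth
`X`-valued functions over `s`. -/
structure IsCovDeriv (e : Fin 4 → ∀ x : M, TangentSpace (𝓡 4) x) (s : Set M)
    (D : Fin 4 → (M → X) → M → X) : Prop where
  smooth : ∀ {u : M → X} μ, SmoothOn u s → SmoothOn (D μ u) s
  congr : ∀ {u u' : M → X} μ, Set.EqOn u u' s → Set.EqOn (D μ u) (D μ u') s
  add : ∀ {u u' : M → X} μ, SmoothOn u s → SmoothOn u' s → ∀ x ∈ s,
    D μ (fun x ↦ u x + u' x) x = D μ u x + D μ u' x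
  smul : ∀ {f : M → ℝ} {u : M → X} μ, SmoothOn f s → SmoothOn u s → ∀ x ∈ s,
    D μ (fun x ↦ f x • u x) x = frameDeriv e μ f x • u x + f x • D μ u x

/-- The curvature of the covariant derivative `D` is `K`. -/
def HasCurvature (h : LorentzMetric M) (e : Fin 4 → ∀ x : M, TangentSpace (𝓡 4) x) (s : Set M)
    (D : Fin 4 → (M → X) → M → X) (K : Fin 4 → Fin 4 → M → X → X) : Prop :=
  ∀ u : M → X, SmoothOn u s → ∀ x ∈ s, ∀ μ ν, D μ (D ν u) x - D ν (D μ u) x =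
    ∑ κ, bracketCoeff h e μ ν κ x • D κ u x + K μ ν x (u x)

namespace IsCovDeriv

variable {D : Fin 4 → (M → X) → M → X} (hD : IsCovDeriv e s D) {u u' : M → X}
include hD

theorem const_smul (μ : Fin 4) (c : ℝ) (hu : SmoothOn u s) (hx : x ∈ s) :
    D μ (fun x ↦ c • u x) x = c • D μ u x := by
  rw [hD.smul μ (SmoothOn.const c) hu x hx, frameDeriv_const, zero_smul, zero_add]

theorem sub (μ : Fin 4) (hu : SmoothOn u s) (hu' : SmoothOn u' s) (hx : x ∈ s) :
    D μ (fun x ↦ u x - u' x) x = D μ u x - D μ u' x := by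
  have h1 : (fun x ↦ u x - u' x) = fun x ↦ u x + (-1 : ℝ) • u' x := by
    funext x; rw [neg_one_smul, sub_eq_add_neg]
  rw [h1, hD.add μ hu ((SmoothOn.const (-1 : ℝ)).smul hu') x hx, hD.const_smul μ _ hu' hx,
    neg_one_smul, sub_eq_add_neg]

theorem zero (μ : Fin 4) (hx : x ∈ s) : D μ (fun _ ↦ 0) x = 0 := by
  have := hD.const_smul μ 0 (SmoothOn.const (0 : X)) hx
  simpa using this

theorem sum {ι : Type*} [Fintype ι] (μ : Fin 4) {u : ι → M → X}
    (hu : ∀ i, SmoothOn (u i) s) (hx : x ∈ s) :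
    D μ (fun x ↦ ∑ i, u i x) x = ∑ i, D μ (u i) x := by
  classical
  have : ∀ t : Finset ι, D μ (fun x ↦ ∑ i ∈ t, u i x) x = ∑ i ∈ t, D μ (u i) x := by
    intro t
    induction t using Finset.induction_on with
    | empty => simpa using hD.zero μ hx
    | insert i t hi ih =>
      simp only [Finset.sum_insert hi]
      rw [hD.add μ (hu i) (contMDiffOn_finsetSum fun i _ ↦ hu i) x hx, ih]
  exact this _

end IsCovDeriv

/-- The covariant derivative `e_μ + B_μ`. -/
def connDeriv (e : Fin 4 → ∀ x : M, TangentSpace (𝓡 4) x) (B : Fin 4 → M → X → X) (μ : Fin 4)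
    (u : M → X) (x : M) : X := frameDeriv e μ u x + B μ x (u x)

theorem isCovDeriv_connDeriv (hf : IsOrthonormalFrame h e s) {B : Fin 4 → M → X → X}
    (hB : ∀ μ (u : M → X), SmoothOn u s → SmoothOn (fun x ↦ B μ x (u x)) s)
    (hadd : ∀ μ x v w, B μ x (v + w) = B μ x v + B μ x w)
    (hsmul : ∀ μ x (c : ℝ) v, B μ x (c • v) = c • B μ x v) :
    IsCovDeriv e s (connDeriv e B) where
  smooth μ hu := (hf.smoothOn_frameDeriv hu).add (hB μ _ hu)
  congr μ huu' x hx := by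
    unfold connDeriv
    rw [frameDeriv_congr hf.isOpen hx huu', huu' hx]
  add μ hu hu' x hx := by
    unfold connDeriv
    rw [frameDeriv_add hf.isOpen hu hu' hx, hadd]
    abel
  smul μ hφ hu x hx := by
    unfold connDeriv
    rw [frameDeriv_smul hf.isOpen hφ hu hx, hsmul, smul_add]
    abel

/-- The covariant derivative on `T^*M ⊗ E`, where `E` has the covariant derivative `D`. -/
def oneFormDeriv (h : LorentzMetric M) (e : Fin 4 → ∀ x : M, TangentSpace (𝓡 4) x)
    (D : Fin 4 → (M → X) → M → X) (μ : Fin 4) (u : M → Fin 4 → X) (x : M) (α : Fin 4) : X :=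
  D μ (fun y ↦ u y α) x - ∑ κ, christoffelUp h e μ α κ x • u x κ

/-- As the value space is arbitrary, the construction can be iterated: a two-form is a one-form with
values in `Fin 4 → X`, and no separate theory of tensors is needed. -/
theorem IsCovDeriv.oneFormDeriv (hf : IsOrthonormalFrame h e s) {D : Fin 4 → (M → X) → M → X}
    (hD : IsCovDeriv e s D) : IsCovDeriv e s (oneFormDeriv h e D) where
  smooth μ hu := SmoothOn.pi fun α ↦ (hD.smooth μ (hu.apply α)).sub
    (SmoothOn.sum fun κ ↦ (hf.smoothOn_christoffelUp μ α κ).smul (hu.apply κ))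
  congr μ huu' x hx := by
    funext α
    unfold YMHD.oneFormDeriv
    rw [hD.congr μ (fun y hy ↦ congrFun (huu' hy) α) hx, huu' hx]
  add μ hu hu' x hx := by
    funext α
    simp only [YMHD.oneFormDeriv, Pi.add_apply, smul_add, Finset.sum_add_distrib]
    rw [hD.add μ (hu.apply α) (hu'.apply α) x hx]
    abel
  smul {φ u} μ hφ hu x hx := by
    funext α
    simp only [YMHD.oneFormDeriv, Pi.smul_apply, Pi.add_apply]
    rw [hD.smul μ hφ (hu.apply α) x hx, smul_sub, Finset.smul_sum, add_sub_assoc]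
    simp only [smul_comm (φ x)]

/-- The Riemann tensor with the last index raised. -/
def riemannUp (h : LorentzMetric M) (e : Fin 4 → ∀ x : M, TangentSpace (𝓡 4) x)
    (μ ν κ ρ : Fin 4) (x : M) : ℝ :=
  frameDeriv e μ (christoffelUp h e ν κ ρ) x - frameDeriv e ν (christoffelUp h e μ κ ρ) x
    + ∑ α, (christoffelUp h e ν κ α x * christoffelUp h e μ α ρ x
      - christoffelUp h e μ κ α x * christoffelUp h e ν α ρ x
      - bracketCoeff h e μ ν α x * christoffelUp h e α κ ρ x)

theorem riemann_eq (μ ν κ ρ : Fin 4) (x : M) :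
    riemann h e μ ν κ ρ x = eta ρ * riemannUp h e μ ν κ ρ x := rfl

theorem riemannUp_eq (μ ν κ ρ : Fin 4) (x : M) :
    riemannUp h e μ ν κ ρ x = eta ρ * riemann h e μ ν κ ρ x := by
  rw [riemann_eq, ← mul_assoc, eta_mul_self, one_mul]

/-- The terms Γ · Du are symmetric in μ, ν and drop out of the commutator. The derivatives of Γ, the
products ΓΓ and the bracket term assemble into the Riemann tensor, with a minus sign since the form
index is covariant. -/
theorem HasCurvature.oneFormDeriv (hf : IsOrthonormalFrame h e s) {D : Fin 4 → (M → X) → M → X}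
    (hD : IsCovDeriv e s D) {K : Fin 4 → Fin 4 → M → X → X} (hK : HasCurvature h e s D K) :
    HasCurvature h e s (oneFormDeriv h e D)
      (fun μ ν x u α ↦ K μ ν x (u α) - ∑ ρ, riemannUp h e μ ν α ρ x • u ρ) := by
  intro u hu x hx μ ν
  funext α
  have h1 : ∀ μ ν, YMHD.oneFormDeriv h e D μ (YMHD.oneFormDeriv h e D ν u) x α =
      D μ (D ν (fun y ↦ u y α)) x
      - ∑ κ, (frameDeriv e μ (christoffelUp h e ν α κ) x • u x κ
        + christoffelUp h e ν α κ x • D μ (fun y ↦ u y κ) x)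
      - ∑ κ, christoffelUp h e μ α κ x • D ν (fun y ↦ u y κ) x
      + ∑ κ, ∑ ρ, (christoffelUp h e μ α κ x * christoffelUp h e ν κ ρ x) • u x ρ := by
    intro μ ν
    simp only [YMHD.oneFormDeriv]
    rw [hD.sub μ (hD.smooth ν (hu.apply α)) (SmoothOn.sum fun κ ↦
      (hf.smoothOn_christoffelUp ν α κ).smul (hu.apply κ)) hx,
      hD.sum μ (fun κ ↦ (hf.smoothOn_christoffelUp ν α κ).smul (hu.apply κ)) hx]
    simp only [hD.smul μ (hf.smoothOn_christoffelUp ν α _) (hu.apply _) x hx, smul_sub,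
      Finset.sum_sub_distrib, Finset.smul_sum, smul_smul]
    abel
  rw [Pi.sub_apply, h1, h1, Pi.add_apply, Finset.sum_apply]
  simp only [Pi.smul_apply, YMHD.oneFormDeriv, riemannUp, add_smul, sub_smul, smul_sub,
    Finset.sum_add_distrib, Finset.sum_sub_distrib, Finset.smul_sum, smul_smul, Finset.sum_smul]
  have h2 := hK (fun y ↦ u y α) (hu.apply α) x hx μ ν
  rw [sub_eq_iff_eq_add] at h2
  rw [h2, Finset.sum_comm (f := fun κ ρ ↦ (christoffelUp h e μ α κ x * christoffelUp h e ν κ ρ x) •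
    u x ρ), Finset.sum_comm (f := fun κ ρ ↦ (christoffelUp h e ν α κ x * christoffelUp h e μ κ ρ x) •
    u x ρ), Finset.sum_comm (f := fun κ ρ ↦ (bracketCoeff h e μ ν κ x * christoffelUp h e κ α ρ x) •
    u x ρ)]
  abel

/-- The second covariant derivative `∇²_{μν}`. -/
def hess (h : LorentzMetric M) (e : Fin 4 → ∀ x : M, TangentSpace (𝓡 4) x)
    (D : Fin 4 → (M → X) → M → X) (u : M → X) (μ ν : Fin 4) (x : M) : X :=
  D μ (D ν u) x - ∑ α, christoffelUp h e μ ν α x • D α u x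

/-- The Ricci identity: by torsion-freeness the Γ terms of the two Hessians differ by exactly the
bracket term of the commutator, leaving only the zeroth-order curvature. -/
theorem hess_sub_hess {D : Fin 4 → (M → X) → M → X} {K : Fin 4 → Fin 4 → M → X → X}
    (hK : HasCurvature h e s D K) {u : M → X} (hu : SmoothOn u s) (hx : x ∈ s) (μ ν : Fin 4) :
    hess h e D u μ ν x - hess h e D u ν μ x = K μ ν x (u x) := by
  have h1 := hK u hu x hx μ ν
  simp only [bracketCoeff, sub_smul, Finset.sum_sub_distrib] at h1
  unfold hess
  rw [sub_sub_sub_comm, h1]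
  abel

theorem covDeriv_zero (B : Fin 4 → M → X → X) (T : (Fin 0 → Fin 4) → M → X) (μ : Fin 4) (x : M) :
    covDeriv h e B T ![μ] x = connDeriv e B μ (T ![]) x := by
  simp [covDeriv, connDeriv, Matrix.empty_eq]

theorem covDeriv_one (B : Fin 4 → M → X → X) (T : (Fin 1 → Fin 4) → M → X) (μ α : Fin 4) (x : M) :
    covDeriv h e B T ![μ, α] x =
      oneFormDeriv h e (connDeriv e B) μ (fun y α ↦ T ![α] y) x α := by
  have h1 : Fin.tail ![μ, α] = ![α] := rfl
  have h2 : ∀ κ, Function.update ![α] 0 κ = ![κ] := fun κ ↦ by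
    funext i; fin_cases i; rfl
  simp [covDeriv, connDeriv, oneFormDeriv, h1, h2]

/-- The outer `oneFormDeriv` carries the correction for α, the inner one that for β. -/
theorem covDeriv_two (B : Fin 4 → M → X → X) (T : (Fin 2 → Fin 4) → M → X) (μ α β : Fin 4)
    (x : M) : covDeriv h e B T ![μ, α, β] x =
      oneFormDeriv h e (oneFormDeriv h e (connDeriv e B)) μ (fun y α β ↦ T ![α, β] y) x α β := by
  have h1 : Fin.tail ![μ, α, β] = ![α, β] := rfl
  have h2 : ∀ κ, Function.update ![α, β] 0 κ = ![κ, β] := fun κ ↦ by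
    funext i; fin_cases i <;> rfl
  have h3 : ∀ κ, Function.update ![α, β] 1 κ = ![α, κ] := fun κ ↦ by
    funext i; fin_cases i <;> rfl
  simp only [covDeriv, connDeriv, oneFormDeriv, h1, h2, h3, Fin.sum_univ_two, Matrix.cons_val_zero,
    Matrix.cons_val_one, Pi.sub_apply, Finset.sum_apply, Pi.smul_apply]
  abel

/-- The index ν is the slot of an earlier derivative. Its Γ term is kept apart, which is the shape
of `hess`, so that the wave operator on two-forms becomes a trace of Hessians. -/
theorem covDeriv_three (B : Fin 4 → M → X → X) (T : (Fin 3 → Fin 4) → M → X) (μ ν α β : Fin 4)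
    (x : M) : covDeriv h e B T ![μ, ν, α, β] x =
      oneFormDeriv h e (oneFormDeriv h e (connDeriv e B)) μ (fun y α β ↦ T ![ν, α, β] y) x α β
        - ∑ κ, christoffelUp h e μ ν κ x • T ![κ, α, β] x := by
  have h1 : Fin.tail ![μ, ν, α, β] = ![ν, α, β] := rfl
  have h0 : ∀ κ, Function.update ![ν, α, β] 0 κ = ![κ, α, β] := fun κ ↦ by
    funext i; fin_cases i <;> rfl
  have h2 : ∀ κ, Function.update ![ν, α, β] 1 κ = ![ν, κ, β] := fun κ ↦ by
    funext i; fin_cases i <;> rfl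
  have h3 : ∀ κ, Function.update ![ν, α, β] 2 κ = ![ν, α, κ] := fun κ ↦ by
    funext i; fin_cases i <;> rfl
  simp only [covDeriv, connDeriv, oneFormDeriv, h1, h0, h2, h3, Fin.sum_univ_three,
    Matrix.cons_val, Pi.sub_apply, Finset.sum_apply, Pi.smul_apply]
  abel

theorem box_zero (B : Fin 4 → M → X → X) (T : (Fin 0 → Fin 4) → M → X) (x : M) :
    box h e B T ![] x = ∑ κ, eta κ • hess h e (connDeriv e B) (T ![]) κ κ x := by
  refine Finset.sum_congr rfl fun κ _ ↦ congrArg _ ?_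
  have h1 : (fun y (α : Fin 4) ↦ covDeriv h e B T ![α] y) =
      fun y α ↦ connDeriv e B α (T ![]) y := by
    funext y α; rw [covDeriv_zero]
  refine (covDeriv_one B (covDeriv h e B T) κ κ x).trans ?_
  rw [h1]
  rfl

theorem box_two (B : Fin 4 → M → X → X) (T : (Fin 2 → Fin 4) → M → X) (μ ν : Fin 4) (x : M) :
    box h e B T ![μ, ν] x = ∑ κ, eta κ •
      hess h e (oneFormDeriv h e (oneFormDeriv h e (connDeriv e B)))
        (fun y α β ↦ T ![α, β] y) κ κ x μ ν := by
  refine Finset.sum_congr rfl fun κ _ ↦ congrArg _ ?_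
  refine (covDeriv_three B (covDeriv h e B T) κ κ μ ν x).trans ?_
  simp only [covDeriv_two, hess, Pi.sub_apply, Finset.sum_apply, Pi.smul_apply]

end CovariantDerivative

/-! ## Symmetries of the Riemann tensor -/

section RiemannSymmetries

variable {M : Type*} [TopologicalSpace M] [ChartedSpace (EuclideanSpace ℝ (Fin 4)) M]
  [IsManifold (𝓡 4) ∞ M]
  {h : LorentzMetric M} {e : Fin 4 → ∀ x : M, TangentSpace (𝓡 4) x} {s : Set M} {x : M}

/-- Substituting Γ_{μν}^κ - Γ_{νμ}^κ for the structure functions turns their Jacobi identity into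
this one. -/
theorem riemannUp_bianchi (hf : IsOrthonormalFrame h e s) (hx : x ∈ s) (μ ν κ ρ : Fin 4) :
    riemannUp h e μ ν κ ρ x + riemannUp h e ν κ μ ρ x + riemannUp h e κ μ ν ρ x = 0 := by
  have h1 := hf.bracketCoeff_jacobi hx μ ν κ ρ
  have h2 : ∀ a b c, frameDeriv e a (bracketCoeff h e b c ρ) x =
      frameDeriv e a (christoffelUp h e b c ρ) x - frameDeriv e a (christoffelUp h e c b ρ) x :=
    fun a b c ↦ frameDeriv_sub hf.isOpen (hf.smoothOn_christoffelUp b c ρ)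
      (hf.smoothOn_christoffelUp c b ρ) hx
  simp only [h2] at h1
  simp only [riemannUp, bracketCoeff, Fin.sum_univ_four] at h1 ⊢
  linear_combination h1

theorem riemann_bianchi (hf : IsOrthonormalFrame h e s) (hx : x ∈ s) (μ ν κ ρ : Fin 4) :
    riemann h e μ ν κ ρ x + riemann h e ν κ μ ρ x + riemann h e κ μ ν ρ x = 0 := by
  rw [riemann_eq, riemann_eq, riemann_eq, ← mul_add, ← mul_add, riemannUp_bianchi hf hx, mul_zero]

theorem riemann_swap (μ ν κ ρ : Fin 4) (x : M) :
    riemann h e μ ν κ ρ x = -riemann h e ν μ κ ρ x := by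
  simp only [riemann_eq, riemannUp, bracketCoeff, Fin.sum_univ_four]
  ring

theorem christoffelUp_skew (μ ν κ : Fin 4) (x : M) :
    christoffelUp h e μ ν κ x = -(eta κ * eta ν) * christoffelUp h e μ κ ν x := by
  unfold christoffelUp
  rw [christoffel_skew]
  linear_combination (eta κ * christoffel h e μ κ ν x) * eta_mul_self ν

/-- Metric compatibility: lowering an index makes Γ skew. The derivative and bracket terms change
sign directly, while the two products ΓΓ are interchanged. -/
theorem riemann_skew (hf : IsOrthonormalFrame h e s) (hx : x ∈ s) (μ ν κ ρ : Fin 4) :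
    riemann h e μ ν κ ρ x = -riemann h e μ ν ρ κ x := by
  have h1 : ∀ a b c d, frameDeriv e a (christoffelUp h e b c d) x =
      -(eta d * eta c) * frameDeriv e a (christoffelUp h e b d c) x := by
    intro a b c d
    rw [frameDeriv_congr hf.isOpen hx fun y _ ↦ christoffelUp_skew b c d y]
    exact frameDeriv_const_smul hf.isOpen _ (hf.smoothOn_christoffelUp b d c) hx
  have h2 : ∀ a b α, christoffelUp h e a κ α x * christoffelUp h e b α ρ x =
      eta κ * eta ρ * (christoffelUp h e b ρ α x * christoffelUp h e a α κ x) := by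
    intro a b α
    rw [christoffelUp_skew a κ α, christoffelUp_skew b α ρ]
    linear_combination (eta κ * eta ρ * (christoffelUp h e b ρ α x * christoffelUp h e a α κ x))
      * eta_mul_self α
  have h3 : ∀ α, bracketCoeff h e μ ν α x * christoffelUp h e α κ ρ x =
      -(eta κ * eta ρ) * (bracketCoeff h e μ ν α x * christoffelUp h e α ρ κ x) := by
    intro α
    rw [christoffelUp_skew α κ ρ]
    ring
  simp only [riemann_eq, riemannUp, Finset.sum_sub_distrib]
  rw [h1 μ ν κ ρ, h1 ν μ κ ρ]
  simp only [h2, h3, ← Finset.mul_sum]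
  linear_combination (-eta κ * (frameDeriv e μ (christoffelUp h e ν ρ κ) x -
    frameDeriv e ν (christoffelUp h e μ ρ κ) x
    + (∑ i, christoffelUp h e ν ρ i x * christoffelUp h e μ i κ x)
    - (∑ i, christoffelUp h e μ ρ i x * christoffelUp h e ν i κ x)
    - ∑ i, bracketCoeff h e μ ν i x * christoffelUp h e i ρ κ x)) * eta_mul_self ρ

/-- The classical octahedron argument: the four Bianchi identities for the cyclic rotations of (μ,
ν, κ, ρ), combined through the two skew symmetries. -/
theorem riemann_pair (hf : IsOrthonormalFrame h e s) (hx : x ∈ s) (μ ν κ ρ : Fin 4) :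
    riemann h e μ ν κ ρ x = riemann h e κ ρ μ ν x := by
  have b1 := riemann_bianchi hf hx μ ν κ ρ
  have b2 := riemann_bianchi hf hx ν κ ρ μ
  have b3 := riemann_bianchi hf hx κ ρ μ ν
  have b4 := riemann_bianchi hf hx ρ μ ν κ
  have sw := fun a b c d ↦ riemann_swap (h := h) (e := e) a b c d x
  have sk := riemann_skew hf hx
  linarith [sk μ ν κ ρ, sk ν κ μ ρ, sk κ μ ν ρ, sk ν κ ρ μ, sk κ ρ ν μ, sk ρ ν κ μ, sk κ ρ μ ν,
    sk ρ μ κ ν, sk μ κ ρ ν, sk ρ μ ν κ, sk μ ν ρ κ, sk ν ρ μ κ,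
    sw μ κ ν ρ, sw κ μ ν ρ, sw ρ ν κ μ, sw ν ρ μ κ, sw μ κ ρ ν, sw κ μ ρ ν, sw ν ρ κ μ, sw ρ ν μ κ]

theorem ricci_symm (hf : IsOrthonormalFrame h e s) (hx : x ∈ s) (μ ν : Fin 4) :
    ricci h e μ ν x = ricci h e ν μ x := by
  refine Finset.sum_congr rfl fun κ _ ↦ ?_
  rw [riemann_pair hf hx κ μ ν κ, riemann_swap ν κ κ μ, riemann_skew hf hx κ ν κ μ, neg_neg]

end RiemannSymmetries

/-! ## The wave operator on closed two-forms -/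

section TwoForms

variable {M : Type*} [TopologicalSpace M] [ChartedSpace (EuclideanSpace ℝ (Fin 4)) M]
  [IsManifold (𝓡 4) ∞ M]
  {X : Type*} [NormedAddCommGroup X] [NormedSpace ℝ X]
  {h : LorentzMetric M} {e : Fin 4 → ∀ x : M, TangentSpace (𝓡 4) x} {s : Set M} {x : M}
  {D : Fin 4 → (M → X) → M → X}

/-- The coefficients are skew in κ, α while the tensor is symmetrised. This is the frame form of
∇η⁻¹ = 0 and allows traces to pass through ∇. -/
theorem sum_christoffelUp_smul_symm (μ : Fin 4) (T : Fin 4 → Fin 4 → X) (x : M) :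
    ∑ κ, ∑ α, (eta κ * christoffelUp h e μ κ α x) • (T α κ + T κ α) = 0 := by
  have h1 : ∀ κ α, eta κ * christoffelUp h e μ κ α x = -(eta α * christoffelUp h e μ α κ x) := by
    intro κ α
    rw [christoffelUp_skew μ κ α]
    linear_combination -(eta α * christoffelUp h e μ α κ x) * eta_mul_self κ
  simp only [smul_add, Finset.sum_add_distrib]
  rw [Finset.sum_comm (f := fun κ α ↦ (eta κ * christoffelUp h e μ κ α x) • T κ α),
    ← Finset.sum_add_distrib]
  refine Finset.sum_eq_zero fun κ _ ↦ ?_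
  rw [← Finset.sum_add_distrib]
  refine Finset.sum_eq_zero fun α _ ↦ ?_
  rw [h1 κ α, neg_smul, neg_add_cancel]

variable (hf : IsOrthonormalFrame h e s) (hD : IsCovDeriv e s D) {F : M → Fin 4 → Fin 4 → X}
  (hF : SmoothOn F s)
include hf hD hF

theorem twoFormDeriv_apply (κ μ ν : Fin 4) (x : M) :
    oneFormDeriv h e (oneFormDeriv h e D) κ F x μ ν = D κ (fun y ↦ F y μ ν) x
      - ∑ α, christoffelUp h e κ ν α x • F x μ α - ∑ α, christoffelUp h e κ μ α x • F x α ν := by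
  simp [oneFormDeriv]

/-- The trace `∇^κ F_{κν}`. -/
theorem twoForm_hess_trace (hx : x ∈ s) (μ ν : Fin 4) :
    ∑ κ, eta κ • hess h e (oneFormDeriv h e (oneFormDeriv h e D)) F μ κ x κ ν =
      oneFormDeriv h e D μ
        (fun y ν ↦ ∑ κ, eta κ • oneFormDeriv h e (oneFormDeriv h e D) κ F y κ ν) x ν := by
  have hD2 := (hD.oneFormDeriv hf).oneFormDeriv hf
  have hG : ∀ κ, SmoothOn (oneFormDeriv h e (oneFormDeriv h e D) κ F) s :=
    fun κ ↦ hD2.smooth κ hF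
  set G := fun κ ↦ oneFormDeriv h e (oneFormDeriv h e D) κ F with hGdef
  have h1 : ∀ κ, hess h e (oneFormDeriv h e (oneFormDeriv h e D)) F μ κ x κ ν =
      D μ (fun y ↦ G κ y κ ν) x - ∑ α, christoffelUp h e μ ν α x • G κ x κ α
        - ∑ α, christoffelUp h e μ κ α x • (G κ x α ν + G α x κ ν) := by
    intro κ
    unfold hess
    simp only [Pi.sub_apply, Finset.sum_apply, Pi.smul_apply]
    rw [twoFormDeriv_apply hf hD (hG κ)]
    simp only [smul_add, Finset.sum_add_distrib]
    abel
  simp only [h1, smul_sub, Finset.sum_sub_distrib, Finset.smul_sum, smul_smul]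
  -- The corrections on the two contracted slots, one a form index and one a derivative index, form
  -- together a symmetrised tensor, so they cancel under the trace.
  have h2 := sum_christoffelUp_smul_symm (h := h) (e := e) μ (fun α κ ↦ G κ x α ν) x
  rw [h2, sub_zero]
  change _ = D μ (fun y ↦ ∑ κ, eta κ • G κ y κ ν) x
    - ∑ α, christoffelUp h e μ ν α x • ∑ κ, eta κ • G κ x κ α
  rw [hD.sum μ (fun κ ↦ (SmoothOn.const (eta κ)).smul (((hG κ).apply κ).apply ν)) hx]
  simp only [hD.const_smul μ _ (((hG _).apply _).apply ν) hx, Finset.smul_sum, smul_smul]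
  congr 1
  rw [Finset.sum_comm]
  refine Finset.sum_congr rfl fun κ _ ↦ Finset.sum_congr rfl fun α _ ↦ ?_
  rw [mul_comm]

/-- Differentiating the cyclic identity for ∇F once more keeps it cyclic: the Γ corrections regroup
into three sums, each a combination of cyclic identities with common coefficients. -/
theorem twoForm_hess_bianchi
    (hB : ∀ x ∈ s, ∀ κ μ ν, oneFormDeriv h e (oneFormDeriv h e D) κ F x μ ν
      + oneFormDeriv h e (oneFormDeriv h e D) μ F x ν κ
      + oneFormDeriv h e (oneFormDeriv h e D) ν F x κ μ = 0) (hx : x ∈ s) (ρ κ μ ν : Fin 4) :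
    hess h e (oneFormDeriv h e (oneFormDeriv h e D)) F ρ κ x μ ν
      + hess h e (oneFormDeriv h e (oneFormDeriv h e D)) F ρ μ x ν κ
      + hess h e (oneFormDeriv h e (oneFormDeriv h e D)) F ρ ν x κ μ = 0 := by
  have hD2 := (hD.oneFormDeriv hf).oneFormDeriv hf
  have hG : ∀ κ, SmoothOn (oneFormDeriv h e (oneFormDeriv h e D) κ F) s :=
    fun κ ↦ hD2.smooth κ hF
  set G := fun κ ↦ oneFormDeriv h e (oneFormDeriv h e D) κ F with hGdef
  change ∀ x ∈ s, ∀ κ μ ν, G κ x μ ν + G μ x ν κ + G ν x κ μ = 0 at hB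
  have h1 : ∀ κ μ ν, hess h e (oneFormDeriv h e (oneFormDeriv h e D)) F ρ κ x μ ν =
      D ρ (fun y ↦ G κ y μ ν) x - ∑ α, christoffelUp h e ρ ν α x • G κ x μ α
        - ∑ α, christoffelUp h e ρ μ α x • G κ x α ν
        - ∑ α, christoffelUp h e ρ κ α x • G α x μ ν := by
    intro κ μ ν
    unfold hess
    simp only [Pi.sub_apply, Finset.sum_apply, Pi.smul_apply]
    rw [twoFormDeriv_apply hf hD (hG κ)]
  have h2 : D ρ (fun y ↦ G κ y μ ν) x + D ρ (fun y ↦ G μ y ν κ) x + D ρ (fun y ↦ G ν y κ μ) x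
      = 0 := by
    have s1 := ((hG κ).apply μ).apply ν
    have s2 := ((hG μ).apply ν).apply κ
    have s3 := ((hG ν).apply κ).apply μ
    rw [← hD.add ρ s1 s2 x hx, ← hD.add ρ (s1.add s2) s3 x hx,
      hD.congr ρ (fun y hy ↦ hB y hy κ μ ν) hx, hD.zero ρ hx]
  have h3 : ∀ a b c, ∑ α, christoffelUp h e ρ a α x • G α x b c
      + ∑ α, christoffelUp h e ρ a α x • G b x c α
      + ∑ α, christoffelUp h e ρ a α x • G c x α b = 0 := by
    intro a b c
    simp only [← Finset.sum_add_distrib, ← smul_add, hB x hx, smul_zero, Finset.sum_const_zero]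
  rw [h1, h1, h1]
  calc _ = (D ρ (fun y ↦ G κ y μ ν) x + D ρ (fun y ↦ G μ y ν κ) x + D ρ (fun y ↦ G ν y κ μ) x)
      - (∑ α, christoffelUp h e ρ κ α x • G α x μ ν
        + ∑ α, christoffelUp h e ρ κ α x • G μ x ν α + ∑ α, christoffelUp h e ρ κ α x • G ν x α μ)
      - (∑ α, christoffelUp h e ρ μ α x • G α x ν κ
        + ∑ α, christoffelUp h e ρ μ α x • G ν x κ α + ∑ α, christoffelUp h e ρ μ α x • G κ x α ν)
      - (∑ α, christoffelUp h e ρ ν α x • G α x κ μ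
        + ∑ α, christoffelUp h e ρ ν α x • G κ x μ α + ∑ α, christoffelUp h e ρ ν α x • G μ x α κ)
        := by abel
    _ = 0 := by rw [h2, h3, h3, h3]; simp

theorem twoForm_hess_skew (hsk : ∀ x ∈ s, ∀ μ ν, F x μ ν = -F x ν μ) (hx : x ∈ s)
    (ρ κ μ ν : Fin 4) :
    hess h e (oneFormDeriv h e (oneFormDeriv h e D)) F ρ κ x μ ν =
      -hess h e (oneFormDeriv h e (oneFormDeriv h e D)) F ρ κ x ν μ := by
  have hD2 := (hD.oneFormDeriv hf).oneFormDeriv hf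
  -- Stated for a general T because it is used twice, for F and for its first covariant derivative.
  have key : ∀ (T : M → Fin 4 → Fin 4 → X), SmoothOn T s →
      (∀ x ∈ s, ∀ μ ν, T x μ ν = -T x ν μ) → ∀ x ∈ s, ∀ κ μ ν,
      oneFormDeriv h e (oneFormDeriv h e D) κ T x μ ν =
        -oneFormDeriv h e (oneFormDeriv h e D) κ T x ν μ := by
    intro T hT hsT x hx κ μ ν
    rw [twoFormDeriv_apply hf hD hT, twoFormDeriv_apply hf hD hT]
    have h1 : D κ (fun y ↦ T y μ ν) x = -D κ (fun y ↦ T y ν μ) x := by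
      rw [← neg_one_smul ℝ, ← hD.const_smul κ (-1) ((hT.apply ν).apply μ) hx]
      refine hD.congr κ (fun y hy ↦ ?_) hx
      simp only [neg_one_smul]
      exact hsT y hy μ ν
    rw [h1]
    simp only [hsT x hx μ, hsT x hx _ ν, smul_neg, Finset.sum_neg_distrib]
    abel
  unfold hess
  simp only [Pi.sub_apply, Finset.sum_apply, Pi.smul_apply]
  rw [key _ (hD2.smooth κ hF) (fun x hx ↦ key F hF hsk x hx κ) x hx]
  simp only [key F hF hsk x hx _ μ ν, smul_neg, Finset.sum_neg_distrib]
  abel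

/-- The wave operator on a closed two-form, in terms of its divergence and the curvature. -/
theorem twoForm_box {K : Fin 4 → Fin 4 → M → X → X} (hK : HasCurvature h e s D K)
    (hsk : ∀ x ∈ s, ∀ μ ν, F x μ ν = -F x ν μ)
    (hB : ∀ x ∈ s, ∀ κ μ ν, oneFormDeriv h e (oneFormDeriv h e D) κ F x μ ν
      + oneFormDeriv h e (oneFormDeriv h e D) μ F x ν κ
      + oneFormDeriv h e (oneFormDeriv h e D) ν F x κ μ = 0)
    {J : M → Fin 4 → X}
    (hJ : ∀ x ∈ s, ∀ ν,
      ∑ κ, eta κ • oneFormDeriv h e (oneFormDeriv h e D) κ F x κ ν = J x ν)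
    (hx : x ∈ s) (μ ν : Fin 4) :
    ∑ κ, eta κ • hess h e (oneFormDeriv h e (oneFormDeriv h e D)) F κ κ x μ ν =
      oneFormDeriv h e D μ J x ν - oneFormDeriv h e D ν J x μ
      + ∑ κ, eta κ • (K κ μ x (F x κ ν) - ∑ ρ, riemannUp h e κ μ ν ρ x • F x κ ρ
          - ∑ ρ, riemannUp h e κ μ κ ρ x • F x ρ ν)
      - ∑ κ, eta κ • (K κ ν x (F x κ μ) - ∑ ρ, riemannUp h e κ ν μ ρ x • F x κ ρ
          - ∑ ρ, riemannUp h e κ ν κ ρ x • F x ρ μ) := by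
  have hD1 := hD.oneFormDeriv hf
  have hK2 := (hK.oneFormDeriv hf hD).oneFormDeriv hf hD1
  have hcomm : ∀ κ μ a b, hess h e (oneFormDeriv h e (oneFormDeriv h e D)) F κ μ x a b =
      hess h e (oneFormDeriv h e (oneFormDeriv h e D)) F μ κ x a b
      + (K κ μ x (F x a b) - ∑ ρ, riemannUp h e κ μ b ρ x • F x a ρ
          - ∑ ρ, riemannUp h e κ μ a ρ x • F x ρ b) := by
    -- The Ricci identity on two-forms: one curvature term from the coefficient bundle and one
    -- Riemann term for each form index.
    intro κ μ a b
    have h1 := congrFun (congrFun (hess_sub_hess hK2 hF hx κ μ) a) b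
    simp only [Pi.sub_apply, Finset.sum_apply, Pi.smul_apply] at h1
    rw [← h1]
    abel
  -- The differentiated Bianchi identity moves one of the two derivatives off the repeated index κ.
  -- After commuting, the inner derivative is contracted with F, and its divergence appears.
  have hb : ∀ κ, hess h e (oneFormDeriv h e (oneFormDeriv h e D)) F κ κ x μ ν =
      hess h e (oneFormDeriv h e (oneFormDeriv h e D)) F κ μ x κ ν
      - hess h e (oneFormDeriv h e (oneFormDeriv h e D)) F κ ν x κ μ := by
    intro κ
    have h1 := twoForm_hess_bianchi hf hD hF hB hx κ κ μ ν
    rw [twoForm_hess_skew hf hD hF hsk hx κ μ ν κ] at h1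
    rw [← sub_eq_zero, ← h1]
    abel
  have htr : ∀ μ ν, ∑ κ, eta κ • hess h e (oneFormDeriv h e (oneFormDeriv h e D)) F μ κ x κ ν =
      oneFormDeriv h e D μ J x ν := by
    intro μ ν
    rw [twoForm_hess_trace hf hD hF hx μ ν]
    exact congrFun (hD1.congr μ (fun y hy ↦ funext fun ν ↦ hJ y hy ν) hx) ν
  simp only [hb]
  simp only [hcomm _ μ _ ν, hcomm _ ν _ μ, smul_sub, smul_add, Finset.sum_sub_distrib,
    Finset.sum_add_distrib, htr]
  abel

end TwoForms

/-! ### The chain rule with a prescribed base point. -/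

section ChainRule

variable {E : Type*} [NormedAddCommGroup E] [NormedSpace ℝ E]
  {H : Type*} [TopologicalSpace H] {I : ModelWithCorners ℝ E H}
  {N : Type*} [TopologicalSpace N] [ChartedSpace H N]
  {E' : Type*} [NormedAddCommGroup E'] [NormedSpace ℝ E']
  {H' : Type*} [TopologicalSpace H'] {I' : ModelWithCorners ℝ E' H'}
  {N' : Type*} [TopologicalSpace N'] [ChartedSpace H' N']
  {X : Type*} [NormedAddCommGroup X] [NormedSpace ℝ X]

/-- The base point enters through an equation, so that points such as g · 1 and g can be exchanged
although their tangent spaces are different types. -/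
theorem mvfderiv_comp_apply_of_eq {u : N' → X} {f : N → N'} {x : N} {y : N'}
    (hu : MDifferentiableAt I' 𝓘(ℝ, X) u y) (hf : MDifferentiableAt I I' f x) (hy : f x = y)
    (v : TangentSpace I x) : mvfderiv I (fun z ↦ u (f z)) x v =
      mvfderiv I' u y (mfderiv I I' f x v : E') := by
  subst hy
  exact congrArg (fun T : TangentSpace I x →L[ℝ] X ↦ T v)
    (mfderiv_comp (I'' := 𝓘(ℝ, X)) (g := u) x hu hf)

end ChainRule

/-! ## Mixed second derivatives in a chart -/

section Mixed

open Filter Topology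

variable {E : Type*} [NormedAddCommGroup E] [NormedSpace ℝ E] [CompleteSpace E]
  {H : Type*} [TopologicalSpace H] {I : ModelWithCorners ℝ E H} [I.Boundaryless]
  {N : Type*} [TopologicalSpace N] [ChartedSpace H N] [IsManifold I ∞ N]
  {X : Type*} [NormedAddCommGroup X] [NormedSpace ℝ X]

/-- A function of two variables in the chart at `o`. -/
def chartRep (I : ModelWithCorners ℝ E H) (q : N → N → X) (o : N) (p : E × E) : X :=
  q ((extChartAt I o).symm p.1) ((extChartAt I o).symm p.2)

variable {q : N → N → X} {o : N}

theorem contDiffAt_chartRep (hq : ContMDiffAt (I.prod I) 𝓘(ℝ, X) ∞ (Function.uncurry q) (o, o)) :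
    ContDiffAt ℝ ∞ (chartRep I q o) (extChartAt I o o, extChartAt I o o) := by
  rw [← contMDiffAt_iff_contDiffAt]
  have h0 : ContMDiffAt 𝓘(ℝ, E) I ∞ (extChartAt I o).symm (extChartAt I o o) :=
    (contMDiffOn_extChartAt_symm o).contMDiffAt (extChartAt_target_mem_nhds o)
  have h1 : ContMDiffAt 𝓘(ℝ, E × E) I ∞ (fun p : E × E ↦ (extChartAt I o).symm p.1)
      (extChartAt I o o, extChartAt I o o) :=
    ContMDiffAt.comp (x := (extChartAt I o o, extChartAt I o o)) (g := (extChartAt I o).symm)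
      h0 (contDiff_fst (𝕜 := ℝ) (E := E) (F := E)).contMDiff.contMDiffAt
  have h2 : ContMDiffAt 𝓘(ℝ, E × E) I ∞ (fun p : E × E ↦ (extChartAt I o).symm p.2)
      (extChartAt I o o, extChartAt I o o) :=
    ContMDiffAt.comp (x := (extChartAt I o o, extChartAt I o o)) (g := (extChartAt I o).symm)
      h0 (contDiff_snd (𝕜 := ℝ) (E := E) (F := E)).contMDiff.contMDiffAt
  refine ContMDiffAt.comp_of_eq (y := (o, o)) (I' := I.prod I) (g := Function.uncurry q)
    (f := fun p : E × E ↦ ((extChartAt I o).symm p.1, (extChartAt I o).symm p.2)) hq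
    (h1.prodMk h2) ?_
  simp

/-- For g near o the partial derivative becomes a Fréchet derivative in a direction independent of
g, so that its dependence on g can be differentiated by ordinary calculus. -/
theorem eventually_mvfderiv_right
    (hq : ContMDiffAt (I.prod I) 𝓘(ℝ, X) ∞ (Function.uncurry q) (o, o)) :
    ∀ᶠ g in 𝓝 o, ∀ v : TangentSpace I o, mvfderiv I (fun k ↦ q g k) o v =
      fderiv ℝ (chartRep I q o) (extChartAt I o g, extChartAt I o o)
        (0, mvfderiv I (extChartAt I o) o v) := by
  have : IsManifold I 2 N := IsManifold.of_le (n := ∞) (by norm_cast)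
  have h1 : ∀ᶠ p in 𝓝 (extChartAt I o o, extChartAt I o o),
      DifferentiableAt ℝ (chartRep I q o) p := by
    filter_upwards [((contDiffAt_chartRep hq).of_le (m := 1) (by norm_cast)).eventually (by simp)]
      with p hp
    exact hp.differentiableAt (by norm_num)
  have h2 : ContinuousAt (fun g ↦ (extChartAt I o g, extChartAt I o o)) o :=
    (continuousAt_extChartAt o).prodMk continuousAt_const
  filter_upwards [h2.eventually h1, extChartAt_source_mem_nhds (I := I) o] with g hg hgs v
  have h3 : (fun k ↦ q g k) =ᶠ[𝓝 o]
      fun k ↦ (fun b ↦ chartRep I q o (extChartAt I o g, b)) (extChartAt I o k) := by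
    filter_upwards [extChartAt_source_mem_nhds (I := I) o] with k hk
    simp only [chartRep]
    rw [(extChartAt I o).left_inv hgs, (extChartAt I o).left_inv hk]
  have h4 : HasFDerivAt (fun b ↦ chartRep I q o (extChartAt I o g, b))
      ((fderiv ℝ (chartRep I q o) (extChartAt I o g, extChartAt I o o)).comp
        (ContinuousLinearMap.inr ℝ E E)) (extChartAt I o o) :=
    hg.hasFDerivAt.comp _ (hasFDerivAt_prodMk_right _ _)
  rw [mvfderiv_congr h3]
  refine (mvfderiv_comp_extChartAt (mem_extChartAt_source o) h4.differentiableAt v).trans ?_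
  rw [h4.fderiv]
  rfl

theorem eventually_mvfderiv_left
    (hq : ContMDiffAt (I.prod I) 𝓘(ℝ, X) ∞ (Function.uncurry q) (o, o)) :
    ∀ᶠ g in 𝓝 o, ∀ v : TangentSpace I o, mvfderiv I (fun k ↦ q k g) o v =
      fderiv ℝ (chartRep I q o) (extChartAt I o o, extChartAt I o g)
        (mvfderiv I (extChartAt I o) o v, 0) := by
  have : IsManifold I 2 N := IsManifold.of_le (n := ∞) (by norm_cast)
  have h1 : ∀ᶠ p in 𝓝 (extChartAt I o o, extChartAt I o o),
      DifferentiableAt ℝ (chartRep I q o) p := by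
    filter_upwards [((contDiffAt_chartRep hq).of_le (m := 1) (by norm_cast)).eventually (by simp)]
      with p hp
    exact hp.differentiableAt (by norm_num)
  have h2 : ContinuousAt (fun g ↦ (extChartAt I o o, extChartAt I o g)) o :=
    continuousAt_const.prodMk (continuousAt_extChartAt o)
  filter_upwards [h2.eventually h1, extChartAt_source_mem_nhds (I := I) o] with g hg hgs v
  have h3 : (fun k ↦ q k g) =ᶠ[𝓝 o]
      fun k ↦ (fun b ↦ chartRep I q o (b, extChartAt I o g)) (extChartAt I o k) := by
    filter_upwards [extChartAt_source_mem_nhds (I := I) o] with k hk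
    simp only [chartRep]
    rw [(extChartAt I o).left_inv hgs, (extChartAt I o).left_inv hk]
  have h4 : HasFDerivAt (fun b ↦ chartRep I q o (b, extChartAt I o g))
      ((fderiv ℝ (chartRep I q o) (extChartAt I o o, extChartAt I o g)).comp
        (ContinuousLinearMap.inl ℝ E E)) (extChartAt I o o) :=
    HasFDerivAt.comp (f := fun b ↦ (b, extChartAt I o g)) _ hg.hasFDerivAt
      (hasFDerivAt_prodMk_left _ _)
  rw [mvfderiv_congr h3]
  refine (mvfderiv_comp_extChartAt (mem_extChartAt_source o) h4.differentiableAt v).trans ?_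
  rw [h4.fderiv]
  rfl

theorem differentiableAt_fderiv_chartRep
    (hq : ContMDiffAt (I.prod I) 𝓘(ℝ, X) ∞ (Function.uncurry q) (o, o)) :
    DifferentiableAt ℝ (fderiv ℝ (chartRep I q o)) (extChartAt I o o, extChartAt I o o) :=
  ((contDiffAt_chartRep hq).fderiv_right (m := 1) (by norm_cast)).differentiableAt (by norm_num)

/-- The partial derivative in the second variable is differentiable in the first. -/
theorem mdifferentiableAt_mvfderiv_right
    (hq : ContMDiffAt (I.prod I) 𝓘(ℝ, X) ∞ (Function.uncurry q) (o, o)) (v : TangentSpace I o) :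
    MDifferentiableAt I 𝓘(ℝ, X) (fun g ↦ mvfderiv I (fun k ↦ q g k) o v) o := by
  have hc : MDifferentiableAt I 𝓘(ℝ, E) (extChartAt I o) o :=
    (contMDiffAt_extChartAt (n := ∞)).mdifferentiableAt (by simp)
  have h1 : DifferentiableAt ℝ (fun a ↦ fderiv ℝ (chartRep I q o) (a, extChartAt I o o)
      (0, mvfderiv I (extChartAt I o) o v)) (extChartAt I o o) :=
    (DifferentiableAt.comp (f := fun a ↦ (a, extChartAt I o o)) _
      (differentiableAt_fderiv_chartRep hq)
      (differentiableAt_id.prodMk (differentiableAt_const _))).clm_apply (differentiableAt_const _)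
  refine MDifferentiableAt.congr_of_eventuallyEq
    (MDifferentiableAt.comp (I' := 𝓘(ℝ, E)) o h1.mdifferentiableAt hc) ?_
  filter_upwards [eventually_mvfderiv_right hq] with g hg
  exact hg v

/-- Mixed second derivatives commute. -/
theorem mvfderiv_mvfderiv_comm
    (hq : ContMDiffAt (I.prod I) 𝓘(ℝ, X) ∞ (Function.uncurry q) (o, o)) (v w : TangentSpace I o) :
    mvfderiv I (fun g ↦ mvfderiv I (fun k ↦ q g k) o w) o v =
      mvfderiv I (fun g ↦ mvfderiv I (fun k ↦ q k g) o v) o w := by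
  have : IsManifold I 2 N := IsManifold.of_le (n := ∞) (by norm_cast)
  have hd := (differentiableAt_fderiv_chartRep hq).hasFDerivAt
  set c := extChartAt I o o
  have h1 : HasFDerivAt (fun a ↦ fderiv ℝ (chartRep I q o) (a, c)
      (0, mvfderiv I (extChartAt I o) o w))
      ((ContinuousLinearMap.apply ℝ X ((0 : E), mvfderiv I (extChartAt I o) o w)).comp
        ((fderiv ℝ (fderiv ℝ (chartRep I q o)) (c, c)).comp (ContinuousLinearMap.inl ℝ E E))) c :=
    (ContinuousLinearMap.apply ℝ X ((0 : E), mvfderiv I (extChartAt I o) o w)).hasFDerivAt.comp c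
      (HasFDerivAt.comp (f := fun a ↦ (a, c)) c hd (hasFDerivAt_prodMk_left c c))
  have h2 : HasFDerivAt (fun a ↦ fderiv ℝ (chartRep I q o) (c, a)
      (mvfderiv I (extChartAt I o) o v, 0))
      ((ContinuousLinearMap.apply ℝ X (mvfderiv I (extChartAt I o) o v, (0 : E))).comp
        ((fderiv ℝ (fderiv ℝ (chartRep I q o)) (c, c)).comp (ContinuousLinearMap.inr ℝ E E))) c :=
    (ContinuousLinearMap.apply ℝ X (mvfderiv I (extChartAt I o) o v, (0 : E))).hasFDerivAt.comp c
      (hd.comp c (hasFDerivAt_prodMk_right c c))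
  have e1 : (fun g ↦ mvfderiv I (fun k ↦ q g k) o w) =ᶠ[𝓝 o] fun g ↦
      (fun a ↦ fderiv ℝ (chartRep I q o) (a, c) (0, mvfderiv I (extChartAt I o) o w))
        (extChartAt I o g) := by
    filter_upwards [eventually_mvfderiv_right hq] with g hg using hg w
  have e2 : (fun g ↦ mvfderiv I (fun k ↦ q k g) o v) =ᶠ[𝓝 o] fun g ↦
      (fun a ↦ fderiv ℝ (chartRep I q o) (c, a) (mvfderiv I (extChartAt I o) o v, 0))
        (extChartAt I o g) := by
    filter_upwards [eventually_mvfderiv_left hq] with g hg using hg v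
  rw [mvfderiv_congr e1, mvfderiv_congr e2]
  refine (mvfderiv_comp_extChartAt (mem_extChartAt_source o) h1.differentiableAt v).trans
    (Eq.trans ?_
      (mvfderiv_comp_extChartAt (mem_extChartAt_source o) h2.differentiableAt w).symm)
  rw [h1.fderiv, h2.fderiv]
  -- Both sides are the second derivative of the chart representative on a horizontal and a vertical
  -- vector, in opposite orders.
  exact ((contDiffAt_chartRep hq).isSymmSndFDerivAt (by simp; norm_cast)) _ _

end Mixed

/-! ## The Lie algebra of a Lie group and its representations -/

section LieGroupCalculus

open VectorField Filter Topology

variable {n : ℕ} {G : Type*} [TopologicalSpace G] [ChartedSpace (EuclideanSpace ℝ (Fin n)) G]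
  [Group G] [LieGroup (𝓡 n) ∞ G]

variable (G) in
theorem lieGroup_minSmoothness : LieGroup (𝓡 n) (minSmoothness ℝ 3) G := by
  rw [minSmoothness_of_isRCLikeNormedField]
  exact LieGroup.of_le (n := ∞) (by norm_cast)

variable (G) in
theorem isManifold_of_lieGroup : IsManifold (𝓡 n) ∞ G := inferInstance

variable (G) in
/-- The Lie bracket as a continuous bilinear map. -/
def lieBrL : LieAlg n →L[ℝ] LieAlg n →L[ℝ] LieAlg n :=
  have := lieGroup_minSmoothness (n := n) G
  LinearMap.toContinuousBilinearMap (LinearMap.mk₂ ℝ (lieBr G)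
    (fun X Y Z ↦ add_lie (L := GroupLieAlgebra (𝓡 n) G) (M := GroupLieAlgebra (𝓡 n) G) X Y Z)
    (fun c X Y ↦ smul_lie (R := ℝ) (L := GroupLieAlgebra (𝓡 n) G)
      (M := GroupLieAlgebra (𝓡 n) G) c X Y)
    (fun X Y Z ↦ lie_add (L := GroupLieAlgebra (𝓡 n) G) (M := GroupLieAlgebra (𝓡 n) G) X Y Z)
    (fun c X Y ↦ lie_smul (R := ℝ) (L := GroupLieAlgebra (𝓡 n) G)
      (M := GroupLieAlgebra (𝓡 n) G) c X Y))

theorem lieBrL_apply (X Y : LieAlg n) : lieBrL G X Y = lieBr G X Y := rfl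

theorem lieBr_skew (X Y : LieAlg n) : lieBr G X Y = -lieBr G Y X :=
  have := lieGroup_minSmoothness (n := n) G
  (lie_skew (L := GroupLieAlgebra (𝓡 n) G) X Y).symm

theorem lieBr_lieBr (X Y Z : LieAlg n) :
    lieBr G X (lieBr G Y Z) = lieBr G (lieBr G X Y) Z + lieBr G Y (lieBr G X Z) :=
  have := lieGroup_minSmoothness (n := n) G
  leibniz_lie (L₁ := GroupLieAlgebra (𝓡 n) G) (L₂ := GroupLieAlgebra (𝓡 n) G)
    (M := GroupLieAlgebra (𝓡 n) G) X Y Z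

theorem contMDiff_mul_uncurry :
    ContMDiff ((𝓡 n).prod (𝓡 n)) (𝓡 n) ∞ (fun p : G × G ↦ p.1 * p.2) := contMDiff_mul (𝓡 n) ∞

/-- Derivative of a function along a left invariant vector field. -/
theorem mvfderiv_mulInvariantVectorField {X : Type*} [NormedAddCommGroup X] [NormedSpace ℝ X]
    {f : G → X} {g : G} (hf : MDifferentiableAt (𝓡 n) 𝓘(ℝ, X) f g)
    (v : GroupLieAlgebra (𝓡 n) G) :
    mvfderiv (𝓡 n) f g (mulInvariantVectorField v g) =
      mvfderiv (𝓡 n) (fun k ↦ f (g * k)) 1 v := by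
  have h1 : MDifferentiableAt (𝓡 n) (𝓡 n) (fun k : G ↦ g * k) 1 :=
    (contMDiff_mul_left (I := 𝓡 n) (n := ∞) (a := g)).mdifferentiableAt (by simp)
  exact (mvfderiv_comp_apply_of_eq hf h1 (mul_one g) v).symm

/-- The bracket of 𝔤 is that of left invariant fields, and such a field differentiates f at g by
differentiating k ↦ f (g k) at 1. This expresses the bracket through iterated derivatives of the
multiplication alone. -/
theorem mvfderiv_lieBr {X : Type*} [NormedAddCommGroup X] [NormedSpace ℝ X] {f : G → X}
    (hf : ContMDiffAt (𝓡 n) 𝓘(ℝ, X) ∞ f 1) (v w : GroupLieAlgebra (𝓡 n) G) :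
    mvfderiv (𝓡 n) f 1 (lieBr G v w) =
      mvfderiv (𝓡 n) (fun g ↦ mvfderiv (𝓡 n) (fun k ↦ f (g * k)) 1 w) 1 v
        - mvfderiv (𝓡 n) (fun g ↦ mvfderiv (𝓡 n) (fun k ↦ f (g * k)) 1 v) 1 w := by
  have := lieGroup_minSmoothness (n := n) G
  have : IsManifold (𝓡 n) ∞ G := isManifold_of_lieGroup G
  have : IsManifold (𝓡 n) 2 G := IsManifold.of_le (n := ∞) (by norm_cast)
  have h1 := mvfderiv_mlieBracket (I := 𝓡 n) (hf.of_le (m := 2) (by norm_cast))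
    (mdifferentiableAt_mulInvariantVectorField (I := 𝓡 n) v)
    (mdifferentiableAt_mulInvariantVectorField (I := 𝓡 n) w)
  have h2 : ∀ v : GroupLieAlgebra (𝓡 n) G,
      (fun y ↦ mvfderiv (𝓡 n) f y (mulInvariantVectorField v y)) =ᶠ[𝓝 1]
        fun g ↦ mvfderiv (𝓡 n) (fun k ↦ f (g * k)) 1 v := by
    intro v
    have h3 := (contMDiffAt_iff_contMDiffAt_nhds (by simp)).1
      (hf.of_le (m := 1) (by norm_cast))
    filter_upwards [h3] with g hg
    exact mvfderiv_mulInvariantVectorField (hg.mdifferentiableAt (by norm_num)) v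
  have h3 : ∀ v : GroupLieAlgebra (𝓡 n) G, mulInvariantVectorField v (1 : G) = v := by
    intro v
    have : (fun k : G ↦ 1 * k) = id := by funext k; simp
    unfold mulInvariantVectorField
    rw [this, mfderiv_id]
    rfl
  rw [mvfderiv_congr (h2 v), mvfderiv_congr (h2 w), h3, h3] at h1
  exact h1

/-- The differential at `1` of a smooth homomorphism into a normed algebra preserves brackets. -/
theorem mvfderiv_monoidHom_lieBr {A : Type*} [NormedAddCommGroup A] [NormedSpace ℝ A]
    (m : A →L[ℝ] A →L[ℝ] A) {r : G → A} (hr : ContMDiff (𝓡 n) 𝓘(ℝ, A) ∞ r)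
    (hmul : ∀ g k, r (g * k) = m (r g) (r k)) (v w : GroupLieAlgebra (𝓡 n) G) :
    mvfderiv (𝓡 n) r 1 (lieBr G v w) =
      m (mvfderiv (𝓡 n) r 1 v) (mvfderiv (𝓡 n) r 1 w)
        - m (mvfderiv (𝓡 n) r 1 w) (mvfderiv (𝓡 n) r 1 v) := by
  have hd : MDifferentiableAt (𝓡 n) 𝓘(ℝ, A) r 1 := hr.mdifferentiableAt (by simp)
  have h1 : ∀ w : GroupLieAlgebra (𝓡 n) G,
      (fun g ↦ mvfderiv (𝓡 n) (fun k ↦ r (g * k)) 1 w) =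
        fun g ↦ m.flip (mvfderiv (𝓡 n) r 1 w) (r g) := by
    intro w
    funext g
    simp only [hmul]
    exact mvfderiv_clm (m (r g)) hd w
  rw [mvfderiv_lieBr hr.contMDiffAt, h1, h1, mvfderiv_clm _ hd, mvfderiv_clm _ hd]
  rfl

/-- The derivative of `g ↦ Ad_g Y` at `1` is `X ↦ [X, Y]`. -/
theorem hasDeriv_Ad (Y : LieAlg n) :
    MDifferentiableAt (𝓡 n) 𝓘(ℝ, LieAlg n) (fun g : G ↦ Ad g Y) 1 ∧
      ∀ X : GroupLieAlgebra (𝓡 n) G, mvfderiv (𝓡 n) (fun g : G ↦ Ad g Y) 1 X = lieBr G X Y := by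
  have : IsManifold (𝓡 n) ∞ G := isManifold_of_lieGroup G
  have : IsManifold (𝓡 n) 2 G := IsManifold.of_le (n := ∞) (by norm_cast)
  have : IsManifold (𝓡 n) 1 G := IsManifold.of_le (n := ∞) (by simp)
  set f : G → LieAlg n := ⇑(extChartAt (𝓡 n) (1 : G)) with hfdef
  have hf : ContMDiffAt (𝓡 n) 𝓘(ℝ, LieAlg n) ∞ f 1 := contMDiffAt_extChartAt
  obtain ⟨L, hL⟩ := isInvertible_mfderiv_extChartAt (I := 𝓡 n)
    (mem_extChartAt_source (I := 𝓡 n) (1 : G))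
  let L' : LieAlg n ≃L[ℝ] LieAlg n := L
  have hL' : ∀ v : GroupLieAlgebra (𝓡 n) G, mvfderiv (𝓡 n) f 1 v = L' v := fun v ↦
    congrArg (fun T : TangentSpace (𝓡 n) (1 : G) →L[ℝ] LieAlg n ↦ T v) hL.symm
  -- conjugation and multiplication read in the chart
  have hc : ContMDiffAt ((𝓡 n).prod (𝓡 n)) 𝓘(ℝ, LieAlg n) ∞
      (Function.uncurry fun g k : G ↦ f (g * k * g⁻¹)) (1, 1) := by
    refine ContMDiffAt.comp_of_eq (y := 1) hf (f := fun p : G × G ↦ p.1 * p.2 * p.1⁻¹) ?_ (by simp)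
    exact ((contMDiff_fst.mul contMDiff_snd).mul contMDiff_fst.inv).contMDiffAt
  have hq : ContMDiffAt ((𝓡 n).prod (𝓡 n)) 𝓘(ℝ, LieAlg n) ∞
      (Function.uncurry fun g k : G ↦ f (g * k)) (1, 1) :=
    ContMDiffAt.comp_of_eq (y := 1) hf (f := fun p : G × G ↦ p.1 * p.2)
      (contMDiff_mul_uncurry.contMDiffAt) (by simp)
  have hconj : ∀ g : G, ContMDiff (𝓡 n) (𝓡 n) ∞ (fun k : G ↦ g * k * g⁻¹) := fun g ↦
    (contMDiff_const.mul contMDiff_id).mul contMDiff_const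
  -- the chain rule for a function composed with conjugation
  have hchain : ∀ (g : G) {u : G → LieAlg n}, MDifferentiableAt (𝓡 n) 𝓘(ℝ, LieAlg n) u 1 →
      mvfderiv (𝓡 n) (fun k ↦ u (g * k * g⁻¹)) 1 Y =
        mvfderiv (𝓡 n) u 1 (Ad g Y : LieAlg n) := by
    intro g u hu
    have h1 : MDifferentiableAt (𝓡 n) (𝓡 n) (fun k : G ↦ g * k * g⁻¹) 1 :=
      (hconj g).mdifferentiableAt (by simp)
    exact mvfderiv_comp_apply_of_eq hu h1 (by simp) Y
  have hAd : ∀ g : G, Ad g Y = L'.symm (mvfderiv (𝓡 n) (fun k ↦ f (g * k * g⁻¹)) 1 Y) := by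
    intro g
    have h1 := (hchain g (hf.mdifferentiableAt (by simp))).trans (hL' (Ad g Y : LieAlg n))
    exact ((congrArg L'.symm h1).trans (L'.symm_apply_apply _)).symm
  have hdiff : MDifferentiableAt (𝓡 n) 𝓘(ℝ, LieAlg n) (fun g : G ↦ Ad g Y) 1 := by
    have h1 := mdifferentiableAt_mvfderiv_right hc Y
    have h2 := (L'.symm : LieAlg n →L[ℝ] LieAlg n).hasMFDerivAt
      (x := mvfderiv (𝓡 n) (fun k : G ↦ f (1 * k * 1⁻¹)) 1 Y)
    refine MDifferentiableAt.congr_of_eventuallyEq (h2.mdifferentiableAt.comp (1 : G) h1) ?_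
    exact Eventually.of_forall hAd
  refine ⟨hdiff, fun X ↦ ?_⟩
  -- `f (g k) = f ((g k g⁻¹) g)`, differentiated in `k` and then in `g`
  set c := extChartAt (𝓡 n) (1 : G) 1 with hcdef
  -- In the chart, `B a` is the differential at 1 of right translation by the element with
  -- coordinate a. As an operator-valued function it admits the product rule.
  let B : LieAlg n → LieAlg n →L[ℝ] LieAlg n := fun a ↦
    (fderiv ℝ (chartRep (𝓡 n) (fun g k : G ↦ f (g * k)) 1) (c, a)).comp
      ((ContinuousLinearMap.inl ℝ (LieAlg n) (LieAlg n)).comp (L' : LieAlg n →L[ℝ] LieAlg n))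
  have hBd : DifferentiableAt ℝ B c :=
    (DifferentiableAt.comp (f := fun a ↦ (c, a)) _ (differentiableAt_fderiv_chartRep hq)
      ((differentiableAt_const _).prodMk differentiableAt_id)).clm_comp (differentiableAt_const _)
  have hBm : MDifferentiableAt (𝓡 n) 𝓘(ℝ, LieAlg n →L[ℝ] LieAlg n) (fun g : G ↦ B (f g)) 1 :=
    MDifferentiableAt.comp (I' := 𝓘(ℝ, LieAlg n)) (1 : G) hBd.mdifferentiableAt
      (hf.mdifferentiableAt (by simp))
  have hB : ∀ᶠ g in 𝓝 (1 : G), ∀ Z : LieAlg n,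
      mvfderiv (𝓡 n) (fun k : G ↦ f (k * g)) 1 Z = B (f g) Z := by
    filter_upwards [eventually_mvfderiv_left hq] with g hg Z
    rw [hg Z]
    simp only [B, ContinuousLinearMap.comp_apply, ContinuousLinearMap.inl_apply]
    rw [← hfdef, hL' Z]
    rfl
  have hR : ∀ᶠ g in 𝓝 (1 : G), MDifferentiableAt (𝓡 n) 𝓘(ℝ, LieAlg n) (fun k : G ↦ f (k * g)) 1 := by
    have h1 := (contMDiffAt_iff_contMDiffAt_nhds (by simp)).1
      (hf.of_le (m := 1) (by norm_cast))
    filter_upwards [h1] with g hg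
    refine ContMDiffAt.mdifferentiableAt (n := 1) ?_ (by norm_num)
    refine ContMDiffAt.comp_of_eq (y := g) hg (f := fun k : G ↦ k * g) ?_ (by simp)
    exact (contMDiff_mul_right (I := 𝓡 n) (n := ∞)).contMDiffAt.of_le (by norm_cast)
  -- Left translation by g is conjugation by g followed by right translation by g.
  have hLR : (fun g : G ↦ mvfderiv (𝓡 n) (fun k ↦ f (g * k)) 1 Y) =ᶠ[𝓝 1]
      fun g ↦ ContinuousLinearMap.id ℝ (LieAlg n →L[ℝ] LieAlg n) (B (f g)) (Ad g Y) := by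
    filter_upwards [hB, hR] with g hg hRg
    have h1 := hchain g hRg
    rw [hg] at h1
    simpa using h1
  have hRY : (fun g : G ↦ mvfderiv (𝓡 n) (fun k ↦ f (k * g)) 1 Y) =ᶠ[𝓝 1]
      fun g ↦ ContinuousLinearMap.apply ℝ (LieAlg n) Y (B (f g)) := by
    filter_upwards [hB] with g hg using hg Y
  have hAd1 : Ad (1 : G) Y = Y := by
    have : (fun k : G ↦ 1 * k * 1⁻¹) = id := by funext k; simp
    rw [hAd, inv_one]
    simp only [one_mul, mul_one]
    exact (congrArg L'.symm (hL' Y)).trans (L'.symm_apply_apply Y)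
  have hB1 : ∀ Z : LieAlg n, B (f 1) Z = L' Z := by
    intro Z
    rw [← hB.self_of_nhds Z]
    simp only [mul_one]
    exact hL' Z
  have h1 := mvfderiv_bilin (ContinuousLinearMap.id ℝ (LieAlg n →L[ℝ] LieAlg n)) hBm hdiff X
  rw [← mvfderiv_congr hLR, hAd1] at h1
  have h2 := mvfderiv_clm (ContinuousLinearMap.apply ℝ (LieAlg n) Y) hBm X
  rw [← mvfderiv_congr hRY] at h2
  -- In the bracket formula the second term equals, by symmetry of mixed derivatives, the
  -- X-derivative of B(f g) Y. The product rule produces the same term from the first one, so only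
  -- the derivative of Ad survives.
  have h3 := mvfderiv_mvfderiv_comm hq Y X
  have h4 := mvfderiv_lieBr hf X Y
  simp only [ContinuousLinearMap.id_apply, ContinuousLinearMap.apply_apply] at h1 h2
  rw [h3, h1, h2] at h4
  rw [hB1, add_sub_cancel_left] at h4
  exact L'.injective (h4.symm.trans (hL' _))

/-- Differentiate the Ad-invariance at g = 1 in the direction X. -/
theorem AdInvariantInner.lieBr_left (k : AdInvariantInner (n := n) G) (X Y Z : LieAlg n) :
    k.val (lieBr G X Y) Z = -k.val Y (lieBr G X Z) := by
  obtain ⟨dY, hY⟩ := hasDeriv_Ad (G := G) Y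
  obtain ⟨dZ, hZ⟩ := hasDeriv_Ad (G := G) Z
  have h1 := mvfderiv_bilin (I := 𝓡 n) k.val.toContinuousBilinearMap dY dZ X
  have h2 : (fun g : G ↦ k.val.toContinuousBilinearMap (Ad (n := n) g Y) (Ad (n := n) g Z)) = fun _ ↦ k.val Y Z := by
    funext g; exact k.ad_invariant g Y Z
  have hAd1 : ∀ Y : LieAlg n, Ad (1 : G) Y = Y := by
    intro Y
    have : (fun k : G ↦ 1 * k * 1⁻¹) = id := by funext k; simp
    unfold Ad
    rw [this, mfderiv_id]
    rfl
  rw [h2, mvfderiv_const, hAd1, hAd1] at h1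
  have h3 : (0 : ℝ) = k.val (lieBr G X Y) Z + k.val Y (lieBr G X Z) :=
    h1.trans (congrArg₂ (fun u v ↦ k.val u Z + k.val Y v) (hY X) (hZ X))
  linarith

end LieGroupCalculus

/-! ## Infinitesimal representations -/

section Representations

variable {n : ℕ} {G : Type*} [TopologicalSpace G] [ChartedSpace (EuclideanSpace ℝ (Fin n)) G]
  [Group G] [LieGroup (𝓡 n) ∞ G]
  {W : Type*} [NormedAddCommGroup W] [InnerProductSpace ℂ W] [FiniteDimensional ℂ W]
  {V : Type*} [NormedAddCommGroup V] [InnerProductSpace ℂ V] [FiniteDimensional ℂ V]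

/-- The Hermitian inner product as a real bilinear map. -/
def innerL (W : Type*) [NormedAddCommGroup W] [InnerProductSpace ℂ W] : W →L[ℝ] W →L[ℝ] ℂ :=
  (isBoundedBilinearMap_inner (𝕜 := ℂ) (E := W)).toContinuousLinearMap

namespace UnitaryRep

variable (ρ : UnitaryRep (n := n) G W)

/-- The differential of a representation as a continuous linear map. -/
def derivL : LieAlg n →L[ℝ] (W →L[ℂ] W) := mfderiv (𝓡 n) 𝓘(ℝ, W →L[ℂ] W) ρ.toHom 1

theorem mdifferentiableAt_toHom :
    MDifferentiableAt (𝓡 n) 𝓘(ℝ, W →L[ℂ] W) ρ.toHom 1 :=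
  ρ.smooth.mdifferentiableAt (by simp)

theorem deriv_lieBr (X Y : LieAlg n) :
    ρ.deriv (lieBr G X Y) = (ρ.deriv X).comp (ρ.deriv Y) - (ρ.deriv Y).comp (ρ.deriv X) :=
  mvfderiv_monoidHom_lieBr (ContinuousLinearMap.mul ℝ (W →L[ℂ] W)) ρ.smooth
    (fun g k ↦ map_mul ρ.toHom g k) X Y

/-- Evaluation of operators at a vector, as a real bilinear map. -/
def evalL (W : Type*) [NormedAddCommGroup W] [InnerProductSpace ℂ W] :
    (W →L[ℂ] W) →L[ℝ] W →L[ℝ] W :=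
  ContinuousLinearMap.restrictScalarsL ℂ W W ℝ ℝ

theorem mdifferentiableAt_toHom_apply (v : W) :
    MDifferentiableAt (𝓡 n) 𝓘(ℝ, W) (fun g ↦ ρ.toHom g v) 1 :=
  (((evalL W).flip v).hasMFDerivAt.comp (1 : G)
    ρ.mdifferentiableAt_toHom.hasMFDerivAt).mdifferentiableAt

theorem mvfderiv_toHom_apply (v : W) (X : LieAlg n) :
    mvfderiv (𝓡 n) (fun g ↦ ρ.toHom g v) 1 X = ρ.deriv X v :=
  mvfderiv_clm ((evalL W).flip v) ρ.mdifferentiableAt_toHom X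

theorem toHom_one_apply (v : W) : ρ.toHom 1 v = v := by rw [map_one]; rfl

/-- Differentiate the unitarity of ρ(g) at g = 1. -/
theorem inner_deriv_left (X : LieAlg n) (v w : W) :
    inner ℂ (ρ.deriv X v) w = -inner ℂ v (ρ.deriv X w) := by
  have h1 := mvfderiv_bilin (I := 𝓡 n) (innerL W) (ρ.mdifferentiableAt_toHom_apply v)
    (ρ.mdifferentiableAt_toHom_apply w) X
  have h2 : (fun g : G ↦ innerL W (ρ.toHom g v) (ρ.toHom g w)) = fun _ ↦ inner ℂ v w := by
    funext g; exact ρ.unitary g v w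
  rw [h2, mvfderiv_const, toHom_one_apply, toHom_one_apply] at h1
  have h3 : (0 : ℂ) = inner ℂ (ρ.deriv X v) w + inner ℂ v (ρ.deriv X w) :=
    h1.trans (congrArg₂ (fun a b ↦ innerL W a w + innerL W v b) (ρ.mvfderiv_toHom_apply v X)
      (ρ.mvfderiv_toHom_apply w X))
  exact eq_neg_of_add_eq_zero_left h3.symm

end UnitaryRep

/-- An equivariant bilinear map is infinitesimally equivariant. -/
theorem deriv_equivariant (ρ : UnitaryRep (n := n) G W) (χ : UnitaryRep (n := n) G V)
    (Y : W →L[ℝ] V →L[ℝ] V)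
    (hY : ∀ g w v, Y (ρ.toHom g w) (χ.toHom g v) = χ.toHom g (Y w v)) (X : LieAlg n)
    (w : W) (v : V) : Y (ρ.deriv X w) v + Y w (χ.deriv X v) = χ.deriv X (Y w v) := by
  have h1 := mvfderiv_bilin (I := 𝓡 n) Y (ρ.mdifferentiableAt_toHom_apply w)
    (χ.mdifferentiableAt_toHom_apply v) X
  have h2 : (fun g : G ↦ Y (ρ.toHom g w) (χ.toHom g v)) = fun g ↦ χ.toHom g (Y w v) := by
    funext g; exact hY g w v
  rw [h2, ρ.toHom_one_apply, χ.toHom_one_apply] at h1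
  have h3 := congrArg₂ (fun a b ↦ Y a v + Y w b) (ρ.mvfderiv_toHom_apply w X)
    (χ.mvfderiv_toHom_apply v X)
  exact h3.symm.trans (h1.symm.trans (χ.mvfderiv_toHom_apply (Y w v) X))

end Representations

/-! ## Clifford algebra -/

section Clifford

variable {A : Type*} [Ring A] [Algebra ℝ A]

/-- The Clifford relations of signature `(-+++)`, with the sign convention `v² = -|v|²`. -/
def IsClifford (g : Fin 4 → A) : Prop :=
  ∀ μ ν, g μ * g ν + g ν * g μ = (-2 * minkowski μ ν) • (1 : A)

/-- The element `¼ ∑ a_{νκ} γ^ν γ^κ` of the spin Lie algebra. -/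
def spinGen (g : Fin 4 → A) (a : Fin 4 → Fin 4 → ℝ) : A :=
  (1 / 4 : ℝ) • ∑ ν, ∑ κ, a ν κ • (g ν * g κ)

theorem sum_rotate {ι B : Type*} [Fintype ι] [AddCommMonoid B] (f : ι → ι → ι → B) :
    ∑ a, ∑ b, ∑ c, f a b c = ∑ b, ∑ c, ∑ a, f a b c := by
  rw [Finset.sum_comm]
  exact Finset.sum_congr rfl fun b _ ↦ Finset.sum_comm

namespace IsClifford

variable {g : Fin 4 → A} (hg : IsClifford g)
include hg

theorem mul_mul_sub_mul_mul (μ ν κ : Fin 4) :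
    g μ * g ν * g κ - g κ * (g μ * g ν) =
      (-2 * minkowski ν κ) • g μ - (-2 * minkowski μ κ) • g ν := by
  have h : g μ * g ν * g κ - g κ * (g μ * g ν) =
      g μ * (g ν * g κ + g κ * g ν) - (g μ * g κ + g κ * g μ) * g ν := by noncomm_ring
  rw [h, hg, hg, mul_smul_comm, smul_mul_assoc, mul_one, one_mul]

/-- The spin Lie algebra acts on vectors as the Lorentz Lie algebra. Each product of gammas
contributes two contractions of weight -2, equal up to sign by skewness of a, and the factor ¼
normalises the result. This is why the spin connection is compatible with Clifford multiplication.
-/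
theorem spinGen_mul_sub {a : Fin 4 → Fin 4 → ℝ} (ha : ∀ ν κ, a ν κ = -a κ ν) (α : Fin 4) :
    spinGen g a * g α - g α * spinGen g a = ∑ κ, (eta α * a α κ) • g κ := by
  have h1 : spinGen g a * g α - g α * spinGen g a =
      (1 / 4 : ℝ) • ∑ ν, ∑ κ, a ν κ • ((-2 * minkowski κ α) • g ν - (-2 * minkowski ν α) • g κ) := by
    simp only [spinGen, smul_mul_assoc, mul_smul_comm, Finset.sum_mul, Finset.mul_sum, ← smul_sub,
      ← Finset.sum_sub_distrib, hg.mul_mul_sub_mul_mul]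
  have h2 : ∀ ν κ, a ν κ • ((-2 * minkowski κ α) • g ν - (-2 * minkowski ν α) • g κ) =
      (if κ = α then (-2 * eta α * a ν κ) • g ν else 0)
        - (if ν = α then (-2 * eta α * a ν κ) • g κ else 0) := by
    intro ν κ
    rw [smul_sub, smul_smul, smul_smul]
    congr 1
    · by_cases h : κ = α
      · subst h; simp [minkowski]; congr 1; ring
      · simp [minkowski, h]
    · by_cases h : ν = α
      · subst h; simp [minkowski]; congr 1; ring
      · simp [minkowski, h]
  rw [h1]
  simp only [h2, Finset.sum_sub_distrib, Finset.sum_ite_eq', Finset.mem_univ, if_true]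
  rw [Finset.sum_comm (f := fun ν κ ↦ if ν = α then (-2 * eta α * a ν κ) • g κ else 0)]
  simp only [Finset.sum_ite_eq', Finset.mem_univ, if_true]
  rw [← Finset.sum_sub_distrib, Finset.smul_sum]
  refine Finset.sum_congr rfl fun κ _ ↦ ?_
  rw [← sub_smul, smul_smul, ha κ α]
  congr 1
  ring

/-- Taking the commutator with an element is a derivation, so the action on single gammas determines
that on their products. The outcome is a matrix commutator of the coefficients, contracted with η.
-/
theorem spinGen_commutator {a b : Fin 4 → Fin 4 → ℝ} (ha : ∀ ν κ, a ν κ = -a κ ν) :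
    spinGen g a * spinGen g b - spinGen g b * spinGen g a =
      spinGen g (fun κ ρ ↦ ∑ α, eta α * (b κ α * a α ρ - a κ α * b α ρ)) := by
  have h1 : spinGen g a * spinGen g b - spinGen g b * spinGen g a = (1 / 4 : ℝ) • ∑ ν, ∑ κ, b ν κ •
      ((spinGen g a * g ν - g ν * spinGen g a) * g κ
        + g ν * (spinGen g a * g κ - g κ * spinGen g a)) := by
    have h2 : spinGen g b = (1 / 4 : ℝ) • ∑ ν, ∑ κ, b ν κ • (g ν * g κ) := rfl
    rw [h2]
    simp only [mul_smul_comm, smul_mul_assoc, Finset.sum_mul, Finset.mul_sum, ← smul_sub,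
      ← Finset.sum_sub_distrib]
    refine congrArg _ (Finset.sum_congr rfl fun ν _ ↦ Finset.sum_congr rfl fun κ _ ↦ congrArg _ ?_)
    noncomm_ring
  rw [h1]
  simp only [hg.spinGen_mul_sub ha]
  unfold spinGen
  congr 1
  simp only [smul_add, Finset.sum_mul, Finset.mul_sum, Finset.smul_sum, smul_mul_assoc,
    mul_smul_comm, smul_smul, Finset.sum_smul, Finset.sum_add_distrib, mul_sub, sub_smul,
    Finset.sum_sub_distrib]
  rw [add_comm, sub_eq_add_neg]
  congr 1
  · refine Finset.sum_congr rfl fun ν _ ↦ ?_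
    rw [Finset.sum_comm]
    refine Finset.sum_congr rfl fun κ _ ↦ Finset.sum_congr rfl fun α _ ↦ ?_
    congr 1; ring
  · simp only [← Finset.sum_neg_distrib]
    refine (sum_rotate _).trans ((sum_rotate _).trans (Finset.sum_congr rfl fun ν _ ↦ ?_))
    rw [Finset.sum_comm]
    refine Finset.sum_congr rfl fun κ _ ↦ Finset.sum_congr rfl fun α _ ↦ ?_
    rw [← neg_smul, ha α ν]
    congr 1; ring

/-- Moving the first gamma past the other two rotates the product cyclically at the price of two
contractions. -/
theorem sum_smul_mul_mul (U : Fin 4 → Fin 4 → Fin 4 → ℝ) :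
    ∑ ν, ∑ κ, ∑ ρ, U ν κ ρ • (g ν * g κ * g ρ) = ∑ ν, ∑ κ, ∑ ρ, U ρ ν κ • (g ν * g κ * g ρ)
      + (∑ ν, ∑ κ, (2 * eta ν * U ν κ ν) • g κ - ∑ ν, ∑ ρ, (2 * eta ν * U ν ν ρ) • g ρ) := by
  have h1 : ∀ ν κ ρ, g ν * g κ * g ρ = g κ * g ρ * g ν
      + ((2 * minkowski ν ρ) • g κ - (2 * minkowski ν κ) • g ρ) := by
    intro ν κ ρ
    have h2 : g ν * g κ * g ρ = g κ * g ρ * g ν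
      + ((g ν * g κ + g κ * g ν) * g ρ - g κ * (g ν * g ρ + g ρ * g ν)) := by noncomm_ring
    rw [h2, hg, hg, mul_smul_comm, smul_mul_assoc, mul_one, one_mul]
    congr 1
    rw [neg_mul, neg_mul, neg_smul, neg_smul]
    abel
  have h3 : ∀ ν κ ρ, U ν κ ρ • (g ν * g κ * g ρ) = U ν κ ρ • (g κ * g ρ * g ν)
      + ((if ν = ρ then (2 * eta ν * U ν κ ρ) • g κ else 0)
        - if ν = κ then (2 * eta ν * U ν κ ρ) • g ρ else 0) := by
    intro ν κ ρ
    rw [h1, smul_add, smul_sub, smul_smul, smul_smul]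
    congr 2
    · by_cases h : ν = ρ
      · subst h; simp [minkowski]; congr 1; ring
      · simp [minkowski, h]
    · by_cases h : ν = κ
      · subst h; simp [minkowski]; congr 1; ring
      · simp [minkowski, h]
  simp only [h3, Finset.sum_add_distrib, Finset.sum_sub_distrib]
  congr 1
  · exact sum_rotate _
  · congr 1
    · simp
    · refine Finset.sum_congr rfl fun ν _ ↦ ?_
      rw [Finset.sum_comm]
      simp

/-- The contraction at the heart of the Lichnerowicz formula. -/
theorem sum_smul_mul_mul_of_cyclic {U : Fin 4 → Fin 4 → Fin 4 → ℝ}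
    (hc : ∀ ν κ ρ, U ν κ ρ + U ρ ν κ + U κ ρ ν = 0) (hs : ∀ ν κ ρ, U ν κ ρ = -U ν ρ κ) :
    ∑ ν, ∑ κ, ∑ ρ, U ν κ ρ • (g ν * g κ * g ρ) = -∑ ρ, (2 * ∑ ν, eta ν * U ν ν ρ) • g ρ := by
  have h1 := hg.sum_smul_mul_mul U
  have h2 := hg.sum_smul_mul_mul (fun ν κ ρ ↦ U κ ρ ν)
  have h3 : ∑ ν, ∑ κ, ∑ ρ, U ν κ ρ • (g ν * g κ * g ρ)
      + ∑ ν, ∑ κ, ∑ ρ, U ρ ν κ • (g ν * g κ * g ρ)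
      + ∑ ν, ∑ κ, ∑ ρ, U κ ρ ν • (g ν * g κ * g ρ) = 0 := by
    simp only [← Finset.sum_add_distrib, ← add_smul, hc, zero_smul, Finset.sum_const_zero]
  have h4 : ∑ ρ, (2 * ∑ ν, eta ν * U ν ν ρ) • g ρ = ∑ ν, ∑ ρ, (2 * eta ν * U ν ν ρ) • g ρ := by
    rw [Finset.sum_comm]
    simp only [Finset.mul_sum, Finset.sum_smul, mul_assoc]
  have h5 : ∑ ν, ∑ κ, (2 * eta ν * U ν κ ν) • g κ = -∑ ν, ∑ ρ, (2 * eta ν * U ν ν ρ) • g ρ := by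
    simp only [← Finset.sum_neg_distrib, ← neg_smul]
    refine Finset.sum_congr rfl fun ν _ ↦ Finset.sum_congr rfl fun κ _ ↦ ?_
    rw [hs ν κ ν]; congr 1; ring
  have h6 : ∀ ν κ, U κ ν ν = 0 := fun ν κ ↦ by linarith [hs κ ν ν]
  simp only [h6, mul_zero, zero_smul, Finset.sum_const_zero, zero_sub] at h2
  rw [h5] at h1 h2
  rw [h4]
  rw [h2] at h3
  generalize ∑ ν, ∑ ρ, (2 * eta ν * U ν ν ρ) • g ρ = E at *
  generalize ∑ ν, ∑ κ, ∑ ρ, U ρ ν κ • (g ν * g κ * g ρ) = T2 at *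
  generalize ∑ ν, ∑ κ, ∑ ρ, U ν κ ρ • (g ν * g κ * g ρ) = T1 at *
  -- The two rotations say that the rotated sums are T1 + 2E and T1 + E. Their cyclic total, zero by
  -- `h3`, is therefore 3 (T1 + E).
  have h7 : (3 : ℝ) • (T1 + E) = 0 := by
    have h8 : T2 = T1 + E + E := by rw [h1]; abel
    rw [h8] at h3
    rw [← h3]
    module
  exact eq_neg_of_add_eq_zero_left ((smul_eq_zero.1 h7).resolve_left (by norm_num))

/-- Symmetric coefficients see only the anticommutator, which is scalar. -/
theorem sum_mul_symm {r : Fin 4 → Fin 4 → ℝ} (hr : ∀ μ ν, r μ ν = r ν μ) :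
    ∑ μ, ∑ ν, r μ ν • (g μ * g ν) = -(∑ μ, eta μ * r μ μ) • (1 : A) := by
  have h1 : (2 : ℝ) • ∑ μ, ∑ ν, r μ ν • (g μ * g ν) =
      ∑ μ, ∑ ν, r μ ν • (g μ * g ν + g ν * g μ) := by
    simp only [smul_add, Finset.sum_add_distrib]
    rw [two_smul, Finset.sum_comm (f := fun μ ν ↦ r μ ν • (g ν * g μ))]
    simp only [hr]
  have h2 : ∑ μ, ∑ ν, r μ ν • (g μ * g ν + g ν * g μ) =
      (2 : ℝ) • -(∑ μ, eta μ * r μ μ) • (1 : A) := by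
    have h3 : ∀ μ ν, r μ ν • (g μ * g ν + g ν * g μ) =
        if μ = ν then (-2 * (eta μ * r μ μ)) • (1 : A) else 0 := by
      intro μ ν
      rw [hg, smul_smul]
      by_cases h : μ = ν
      · subst h; simp [minkowski]; congr 1; ring
      · simp [minkowski, h]
    simp only [h3, Finset.sum_ite_eq, Finset.mem_univ, if_true]
    rw [← Finset.sum_smul, ← Finset.mul_sum, smul_smul]
    congr 1; ring
  exact (smul_right_injective A (two_ne_zero (α := ℝ))) (h1.trans h2)

end IsClifford

end Clifford

/-- The curvature term in the Lichnerowicz formula. -/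
theorem lichnerowicz {M : Type*} [TopologicalSpace M]
    [ChartedSpace (EuclideanSpace ℝ (Fin 4)) M] [IsManifold (𝓡 4) ∞ M] {h : LorentzMetric M}
    {e : Fin 4 → ∀ x : M, TangentSpace (𝓡 4) x} {s : Set M} (hf : IsOrthonormalFrame h e s)
    {A : Type*} [Ring A] [Algebra ℝ A] {g : Fin 4 → A} (hg : IsClifford g)
    {x : M} (hx : x ∈ s) :
    ∑ μ, ∑ ν, g μ * g ν * spinGen g (fun κ ρ ↦ riemann h e μ ν κ ρ x) =
      (1 / 2 * scal h e x) • (1 : A) := by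
  have sw := fun a b c d ↦ riemann_swap (h := h) (e := e) a b c d x
  have sk := riemann_skew hf hx
  have pr := riemann_pair hf hx
  have bi := riemann_bianchi hf hx
  -- The Bianchi identity is cyclic in the first three indices; reversing all four carries it over
  -- to the last three.
  have hcyc : ∀ μ ν κ ρ, riemann h e μ ν κ ρ x + riemann h e μ ρ ν κ x
      + riemann h e μ κ ρ ν x = 0 := by
    have h1 : ∀ a b c d, riemann h e a b c d x = riemann h e d c b a x := by
      intro a b c d
      rw [pr, sw, sk, neg_neg]
    intro μ ν κ ρ
    rw [h1 μ ν κ ρ, h1 μ ρ ν κ, h1 μ κ ρ ν]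
    exact bi ρ κ ν μ
  -- The three inner gammas collapse to -2 Ric. Since Ric is symmetric, the remaining pair of gammas
  -- gives its trace with another minus sign, and ¼ · 2 leaves ½ Scal.
  have h1 : ∀ μ, ∑ ν, ∑ κ, ∑ ρ, riemann h e μ ν κ ρ x • (g ν * g κ * g ρ) =
      -∑ ρ, (2 * ricci h e ρ μ x) • g ρ := by
    intro μ
    rw [hg.sum_smul_mul_mul_of_cyclic (U := fun ν κ ρ ↦ riemann h e μ ν κ ρ x)
(hcyc μ) (fun ν κ ρ ↦ sk μ ν κ ρ)]
    congr 1
    refine Finset.sum_congr rfl fun ρ _ ↦ ?_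
    congr 2
    refine Finset.sum_congr rfl fun ν _ ↦ ?_
    rw [pr μ ν ν ρ]
  have h2 : ∑ μ, ∑ ν, g μ * g ν * spinGen g (fun κ ρ ↦ riemann h e μ ν κ ρ x) =
      (1 / 4 : ℝ) • ∑ μ, g μ * ∑ ν, ∑ κ, ∑ ρ, riemann h e μ ν κ ρ x • (g ν * g κ * g ρ) := by
    simp only [spinGen, mul_smul_comm, Finset.mul_sum, Finset.smul_sum, mul_assoc]
  rw [h2]
  simp only [h1, mul_neg, Finset.mul_sum, mul_smul_comm, Finset.sum_neg_distrib]
  rw [hg.sum_mul_symm (r := fun μ ρ ↦ 2 * ricci h e ρ μ x)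
    (fun μ ν ↦ by rw [ricci_symm hf hx])]
  unfold scal
  rw [neg_smul, neg_neg, smul_smul]
  congr 1
  rw [Finset.mul_sum, Finset.mul_sum]
  exact Finset.sum_congr rfl fun μ _ ↦ by ring

/-! ## Curvature of linear connections -/

section LinearConnection

variable {M : Type*} [TopologicalSpace M] [ChartedSpace (EuclideanSpace ℝ (Fin 4)) M]
  [IsManifold (𝓡 4) ∞ M]
  {X : Type*} [NormedAddCommGroup X] [NormedSpace ℝ X]
  {h : LorentzMetric M} {e : Fin 4 → ∀ x : M, TangentSpace (𝓡 4) x} {s : Set M} {x : M}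
  {C : Fin 4 → M → X →L[ℝ] X}

theorem isCovDeriv_linear (hf : IsOrthonormalFrame h e s) (hC : ∀ μ, SmoothOn (C μ) s) :
    IsCovDeriv e s (connDeriv e fun μ x u ↦ C μ x u) :=
  isCovDeriv_connDeriv hf (fun μ _ hu ↦ (hC μ).clm_apply hu) (fun _ _ v w ↦ map_add _ v w)
    (fun _ _ c v ↦ map_smul _ c v)

/-- The curvature operators of the connection `e_μ + C_μ`. -/
def linearCurvature (h : LorentzMetric M) (e : Fin 4 → ∀ x : M, TangentSpace (𝓡 4) x)
    (C : Fin 4 → M → X →L[ℝ] X) (μ ν : Fin 4) (x : M) : X →L[ℝ] X :=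
  frameDeriv e μ (C ν) x - frameDeriv e ν (C μ) x + (C μ x * C ν x - C ν x * C μ x)
    - ∑ κ, bracketCoeff h e μ ν κ x • C κ x

/-- The cross terms C_ν e_μ u + C_μ e_ν u are symmetric in μ, ν and cancel. The bracket term inside
`linearCurvature` completes the frame commutator to a combination of covariant derivatives. -/
theorem hasCurvature_linear (hf : IsOrthonormalFrame h e s) (hC : ∀ μ, SmoothOn (C μ) s) :
    HasCurvature h e s (connDeriv e fun μ x u ↦ C μ x u)
      (fun μ ν x u ↦ linearCurvature h e C μ ν x u) := by
  intro u hu x hx μ ν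
  have h1 : ∀ μ ν, connDeriv e (fun μ x u ↦ C μ x u) μ (connDeriv e (fun μ x u ↦ C μ x u) ν u) x =
      frameDeriv e μ (frameDeriv e ν u) x + frameDeriv e μ (C ν) x (u x)
        + C ν x (frameDeriv e μ u x) + C μ x (frameDeriv e ν u x) + C μ x (C ν x (u x)) := by
    intro μ ν
    have h2 : frameDeriv e μ (fun x ↦ C ν x (u x)) x =
        frameDeriv e μ (C ν) x (u x) + C ν x (frameDeriv e μ u x) :=
      frameDeriv_bilin hf.isOpen (ContinuousLinearMap.id ℝ (X →L[ℝ] X)) (hC ν) hu hx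
    change frameDeriv e μ (fun x ↦ frameDeriv e ν u x + C ν x (u x)) x
      + C μ x (frameDeriv e ν u x + C ν x (u x)) = _
    rw [frameDeriv_add hf.isOpen (hf.smoothOn_frameDeriv hu) ((hC ν).clm_apply hu) hx, h2, map_add]
    abel
  have h3 := hf.frameDeriv_comm hu hx μ ν
  rw [h1, h1]
  simp only [connDeriv, linearCurvature, add_apply,
    sub_apply, sum_apply, smul_apply,
    mul_apply_eq_comp, smul_add, Finset.sum_add_distrib, ← h3]
  abel

end LinearConnection

/-! ## Twisted spinors -/

section TwistedSpinors

variable {V : Type*} [NormedAddCommGroup V] [InnerProductSpace ℂ V]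

/-- The action of matrices on twisted spinors. -/
def spinEnd (V : Type*) [NormedAddCommGroup V] [InnerProductSpace ℂ V]
    (S : Matrix (Fin 4) (Fin 4) ℂ) : (Fin 4 → V) →L[ℝ] (Fin 4 → V) :=
  ContinuousLinearMap.pi fun a ↦ ∑ b,
    ((S a b • ContinuousLinearMap.id ℂ V).restrictScalars ℝ).comp
      (ContinuousLinearMap.proj (R := ℝ) (φ := fun _ : Fin 4 ↦ V) b)

theorem spinEnd_apply (S : Matrix (Fin 4) (Fin 4) ℂ) (ψ : Fin 4 → V) :
    spinEnd V S ψ = spinMul S ψ := by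
  funext a
  simp [spinEnd, spinMul]

theorem spinMul_mul (S T : Matrix (Fin 4) (Fin 4) ℂ) (ψ : Fin 4 → V) :
    spinMul (S * T) ψ = spinMul S (spinMul T ψ) := by
  funext a
  simp only [spinMul, Matrix.mul_apply, Finset.sum_smul, Finset.smul_sum, smul_smul]
  exact Finset.sum_comm

theorem spinEnd_mul (S T : Matrix (Fin 4) (Fin 4) ℂ) :
    spinEnd V (S * T) = spinEnd V S * spinEnd V T := by
  ext1 ψ
  rw [mul_apply_eq_comp, spinEnd_apply, spinEnd_apply, spinEnd_apply, spinMul_mul]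

theorem spinEnd_add (S T : Matrix (Fin 4) (Fin 4) ℂ) :
    spinEnd V (S + T) = spinEnd V S + spinEnd V T := by
  ext1 ψ
  funext a
  simp [spinEnd_apply, spinMul, add_smul, Finset.sum_add_distrib]

theorem spinMul_smul_one (c : ℝ) (ψ : Fin 4 → V) :
    spinMul ((c : ℂ) • (1 : Matrix (Fin 4) (Fin 4) ℂ)) ψ = c • ψ := by
  funext a
  simp [spinMul, Matrix.one_apply]

theorem spinMul_gammaUp (μ : Fin 4) (ψ : Fin 4 → V) :
    spinMul (gammaUp μ) ψ = eta μ • spinMul (gamma μ) ψ := by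
  funext a
  simp only [spinMul, gammaUp, Matrix.smul_apply, smul_eq_mul, mul_smul, ← Finset.smul_sum,
    Pi.smul_apply]
  rfl

theorem gamma_anticomm (μ ν : Fin 4) :
    gamma μ * gamma ν + gamma ν * gamma μ =
      ((-2 * minkowski μ ν : ℝ) : ℂ) • (1 : Matrix (Fin 4) (Fin 4) ℂ) := by
  have h1 : (1 : Matrix (Fin 4) (Fin 4) ℂ) =
      !![1, 0, 0, 0; 0, 1, 0, 0; 0, 0, 1, 0; 0, 0, 0, 1] := by
    ext a b; fin_cases a <;> fin_cases b <;> rfl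
  have h0 : !![0, 0, 0, 0; 0, 0, 0, 0; 0, 0, 0, 0; 0, 0, 0, 0] =
      (0 : Matrix (Fin 4) (Fin 4) ℂ) := by
    ext a b; fin_cases a <;> fin_cases b <;> rfl
  rw [h1]
  fin_cases μ <;> fin_cases ν <;> simp [gamma, eta, minkowski] <;>
    first | exact h0 | norm_num

theorem gammaUp_anticomm (μ ν : Fin 4) :
    gammaUp μ * gammaUp ν + gammaUp ν * gammaUp μ =
      ((-2 * minkowski μ ν : ℝ) : ℂ) • (1 : Matrix (Fin 4) (Fin 4) ℂ) := by
  simp only [gammaUp, smul_mul_assoc, mul_smul_comm]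
  rw [smul_comm (eta μ : ℂ) (eta ν : ℂ) (gamma ν * gamma μ), ← smul_add, ← smul_add,
    gamma_anticomm, smul_smul, smul_smul, ← Complex.ofReal_mul, ← Complex.ofReal_mul]
  congr 2
  by_cases h : μ = ν
  · subst h
    linear_combination (-2 * minkowski μ μ) * eta_mul_self μ
  · simp [minkowski, h]

/-- Clifford multiplication on twisted spinors by the vectors of the dual frame. -/
def cliff (V : Type*) [NormedAddCommGroup V] [InnerProductSpace ℂ V] (μ : Fin 4) :
    (Fin 4 → V) →L[ℝ] (Fin 4 → V) := spinEnd V (gammaUp μ)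

theorem isClifford_cliff : IsClifford (cliff V) := by
  intro μ ν
  unfold cliff
  rw [← spinEnd_mul, ← spinEnd_mul, ← spinEnd_add, gammaUp_anticomm]
  ext1 ψ
  rw [spinEnd_apply, spinMul_smul_one]
  rfl

/-- The action of the linear maps of the twisting space, as a continuous linear map. -/
def twistL (V : Type*) [NormedAddCommGroup V] [InnerProductSpace ℂ V] :
    (V →L[ℂ] V) →L[ℝ] (Fin 4 → V) →L[ℝ] (Fin 4 → V) :=
  LinearMap.mkContinuous
    { toFun := fun T : V →L[ℂ] V ↦ ContinuousLinearMap.pi fun a ↦ (T.restrictScalars ℝ).comp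
        (ContinuousLinearMap.proj (R := ℝ) (φ := fun _ : Fin 4 ↦ V) a)
      map_add' := fun S T ↦ rfl
      map_smul' := fun c T ↦ rfl } 1 (fun T ↦ by
        rw [one_mul]
        refine ContinuousLinearMap.opNorm_le_bound _ (norm_nonneg _) fun ψ ↦ ?_
        refine (pi_norm_le_iff_of_nonneg (by positivity)).2 fun a ↦ ?_
        exact (T.le_opNorm _).trans (by gcongr; exact norm_le_pi_norm ψ a))

theorem twistL_apply (T : V →L[ℂ] V) (ψ : Fin 4 → V) : twistL V T ψ = twistMul T ψ := rfl

theorem spinMul_twistMul (S : Matrix (Fin 4) (Fin 4) ℂ) (T : V →L[ℂ] V) (ψ : Fin 4 → V) :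
    spinMul S (twistMul T ψ) = twistMul T (spinMul S ψ) := by
  funext a
  simp [spinMul, twistMul]

theorem cliff_mul_twistL (μ : Fin 4) (T : V →L[ℂ] V) :
    cliff V μ * twistL V T = twistL V T * cliff V μ := by
  ext1 ψ
  rw [mul_apply_eq_comp, mul_apply_eq_comp, twistL_apply, twistL_apply,
    cliff, spinEnd_apply, spinEnd_apply, spinMul_twistMul]

theorem spinGen_mul_twistL (a : Fin 4 → Fin 4 → ℝ) (T : V →L[ℂ] V) :
    spinGen (cliff V) a * twistL V T = twistL V T * spinGen (cliff V) a := by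
  simp only [spinGen, Finset.sum_mul, Finset.mul_sum, smul_mul_assoc, mul_smul_comm, mul_assoc,
    cliff_mul_twistL]
  simp only [← mul_assoc, cliff_mul_twistL]

/-- The spinor inner product as a real bilinear map. -/
def spinInnerL (V : Type*) [NormedAddCommGroup V] [InnerProductSpace ℂ V] :
    (Fin 4 → V) →L[ℝ] (Fin 4 → V) →L[ℝ] ℂ :=
  ∑ a, ∑ b, gamma 0 a b • (innerL V).bilinearComp
    (ContinuousLinearMap.proj (R := ℝ) (φ := fun _ : Fin 4 ↦ V) a)
    (ContinuousLinearMap.proj (R := ℝ) (φ := fun _ : Fin 4 ↦ V) b)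

theorem spinInnerL_apply (ψ φ : Fin 4 → V) : spinInnerL V ψ φ = spinInner ψ φ := by
  simp [spinInnerL, spinInner]
  rfl

/-- The matrices γ_0 γ_μ of the Weyl representation are Hermitian, which is seen on the entries. -/
theorem spinInner_gamma (μ : Fin 4) (ψ φ : Fin 4 → V) :
    spinInner (spinMul (gamma μ) ψ) φ = spinInner ψ (spinMul (gamma μ) φ) := by
  fin_cases μ <;>
    simp [spinInner, spinMul, gamma, Fin.sum_univ_four] <;> ring

theorem spinInner_gammaUp (μ : Fin 4) (ψ φ : Fin 4 → V) :
    spinInner (spinMul (gammaUp μ) ψ) φ = spinInner ψ (spinMul (gammaUp μ) φ) := by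
  rw [spinMul_gammaUp, spinMul_gammaUp, ← spinInnerL_apply, ← spinInnerL_apply, map_smul,
    map_smul, smul_apply, spinInnerL_apply, spinInnerL_apply, spinInner_gamma]

/-- Symmetry of each gamma reverses their product, and the skew coefficients turn the reversal into
a sign. Hence the spinor product is parallel for the spin connection. -/
theorem spinInner_spinGen {a : Fin 4 → Fin 4 → ℝ} (ha : ∀ ν κ, a ν κ = -a κ ν)
    (ψ φ : Fin 4 → V) : spinInner (spinGen (cliff V) a ψ) φ =
      -spinInner ψ (spinGen (cliff V) a φ) := by
  have h1 : ∀ ν κ, spinInnerL V ((cliff V ν * cliff V κ) ψ) φ =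
      spinInnerL V ψ ((cliff V κ * cliff V ν) φ) := by
    intro ν κ
    simp only [mul_apply_eq_comp, cliff, spinEnd_apply, spinInnerL_apply,
      spinInner_gammaUp]
  rw [← spinInnerL_apply, ← spinInnerL_apply]
  simp only [spinGen, smul_apply, sum_apply, map_smul,
    map_sum, h1]
  rw [← smul_neg, ← Finset.sum_neg_distrib, Finset.sum_comm]
  refine congrArg _ (Finset.sum_congr rfl fun ν _ ↦ ?_)
  rw [← Finset.sum_neg_distrib]
  refine Finset.sum_congr rfl fun κ _ ↦ ?_
  rw [ha, neg_smul]

theorem spinInner_twistMul {T : V →L[ℂ] V} (hT : ∀ v w, inner ℂ (T v) w = -inner ℂ v (T w))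
    (ψ φ : Fin 4 → V) : spinInner (twistMul T ψ) φ = -spinInner ψ (twistMul T φ) := by
  simp [spinInner, twistMul, hT]

end TwistedSpinors

/-! ## Gauge potentials along a frame -/

section GaugePotential

variable {M : Type*} [TopologicalSpace M] [ChartedSpace (EuclideanSpace ℝ (Fin 4)) M]
  [IsManifold (𝓡 4) ∞ M]
  {n : ℕ} {G : Type*} [TopologicalSpace G] [ChartedSpace (EuclideanSpace ℝ (Fin n)) G]
  [Group G] [LieGroup (𝓡 n) ∞ G]
  {X : Type*} [NormedAddCommGroup X] [NormedSpace ℝ X]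
  {h : LorentzMetric M} {e : Fin 4 → ∀ x : M, TangentSpace (𝓡 4) x} {s : Set M} {x : M}
  {A : Fin 4 → M → LieAlg n}

variable (G) in
/-- The components of the curvature form of the gauge potential `A`. -/
def curvatureForm (h : LorentzMetric M) (e : Fin 4 → ∀ x : M, TangentSpace (𝓡 4) x)
    (A : Fin 4 → M → LieAlg n) (μ ν : Fin 4) (x : M) : LieAlg n :=
  frameDeriv e μ (A ν) x - frameDeriv e ν (A μ) x - ∑ κ, bracketCoeff h e μ ν κ x • A κ x
    + lieBrL G (A μ x) (A ν x)

theorem smoothOn_curvatureForm (hf : IsOrthonormalFrame h e s) (hA : ∀ μ, SmoothOn (A μ) s)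
    (μ ν : Fin 4) : SmoothOn (curvatureForm G h e A μ ν) s :=
  (((hf.smoothOn_frameDeriv (hA ν)).sub (hf.smoothOn_frameDeriv (hA μ))).sub
    (SmoothOn.sum fun κ ↦ (hf.smoothOn_bracketCoeff μ ν κ).smul (hA κ))).add
    (SmoothOn.bilin (lieBrL G) (hA μ) (hA ν))

theorem curvatureForm_skew (μ ν : Fin 4) (x : M) :
    curvatureForm G h e A μ ν x = -curvatureForm G h e A ν μ x := by
  have h1 : ∀ κ, bracketCoeff h e μ ν κ x = -bracketCoeff h e ν μ κ x := fun κ ↦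
    bracketCoeff_swap h μ ν κ x
  have h2 : lieBrL G (A μ x) (A ν x) = -lieBrL G (A ν x) (A μ x) := lieBr_skew _ _
  unfold curvatureForm
  simp only [h1, neg_smul, Finset.sum_neg_distrib]
  rw [h2]
  abel

/-- The curvature of the connection induced by `A` through a Lie algebra representation. -/
theorem linearCurvature_rep (hf : IsOrthonormalFrame h e s) (hA : ∀ μ, SmoothOn (A μ) s)
    (L : LieAlg n →L[ℝ] X →L[ℝ] X)
    (hL : ∀ Y Z, L (lieBr G Y Z) = L Y * L Z - L Z * L Y) (hx : x ∈ s) (μ ν : Fin 4) :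
    linearCurvature h e (fun μ x ↦ L (A μ x)) μ ν x = L (curvatureForm G h e A μ ν x) := by
  unfold linearCurvature curvatureForm
  rw [frameDeriv_clm hf.isOpen L (hA ν) hx, frameDeriv_clm hf.isOpen L (hA μ) hx, lieBrL_apply]
  simp only [map_add, map_sub, map_sum, map_smul, hL]
  abel

/-- The Bianchi identity. -/
theorem curvatureForm_bianchi (hf : IsOrthonormalFrame h e s) (hA : ∀ μ, SmoothOn (A μ) s)
    (hx : x ∈ s) (κ μ ν : Fin 4) :
    let D := connDeriv e fun μ x u ↦ lieBrL G (A μ x) u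
    let F := fun x μ ν ↦ curvatureForm G h e A μ ν x
    oneFormDeriv h e (oneFormDeriv h e D) κ F x μ ν
      + oneFormDeriv h e (oneFormDeriv h e D) μ F x ν κ
      + oneFormDeriv h e (oneFormDeriv h e D) ν F x κ μ = 0 := by
  intro D F
  have hL : ∀ Y Z : LieAlg n, lieBrL G Y Z = -lieBrL G Z Y := lieBr_skew
  have hF : ∀ μ ν, F x μ ν = -F x ν μ := fun μ ν ↦ curvatureForm_skew μ ν x
  -- By skewness of F the six Γ sums pair up into structure functions: the cyclic sum is the
  -- exterior derivative and involves only the brackets.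
  have h1 : oneFormDeriv h e (oneFormDeriv h e D) κ F x μ ν
      + oneFormDeriv h e (oneFormDeriv h e D) μ F x ν κ
      + oneFormDeriv h e (oneFormDeriv h e D) ν F x κ μ =
      (D κ (fun y ↦ F y μ ν) x - ∑ α, bracketCoeff h e κ μ α x • F x α ν)
      + (D μ (fun y ↦ F y ν κ) x - ∑ α, bracketCoeff h e μ ν α x • F x α κ)
      + (D ν (fun y ↦ F y κ μ) x - ∑ α, bracketCoeff h e ν κ α x • F x α μ) := by
    have h3 : ∀ κ μ ν, oneFormDeriv h e (oneFormDeriv h e D) κ F x μ ν = D κ (fun y ↦ F y μ ν) x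
        - ∑ α, christoffelUp h e κ ν α x • F x μ α - ∑ α, christoffelUp h e κ μ α x • F x α ν :=
      fun κ μ ν ↦ by simp [oneFormDeriv]
    simp only [h3, bracketCoeff, sub_smul, Finset.sum_sub_distrib]
    have h4 : ∀ a b c, ∑ α, christoffelUp h e a b α x • F x c α =
        -∑ α, christoffelUp h e a b α x • F x α c := fun a b c ↦ by
      rw [← Finset.sum_neg_distrib]
      exact Finset.sum_congr rfl fun α _ ↦ by rw [hF c α, smul_neg]
    rw [h4 κ ν μ, h4 μ κ ν, h4 ν μ κ]
    abel
  -- One second derivative is commuted deliberately, so that the first four groups telescope in the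
  -- cyclic sum. The last two groups vanish by the Jacobi identities of the frame and of the Lie
  -- algebra, `h3` and `h4` below.
  have h2 : ∀ κ μ ν, D κ (fun y ↦ F y μ ν) x - ∑ α, bracketCoeff h e κ μ α x • F x α ν =
      (frameDeriv e μ (frameDeriv e κ (A ν)) x - frameDeriv e κ (frameDeriv e ν (A μ)) x)
      + (∑ α, bracketCoeff h e κ μ α x • frameDeriv e ν (A α) x
        - ∑ α, bracketCoeff h e μ ν α x • frameDeriv e κ (A α) x)
      + (lieBrL G (A κ x) (frameDeriv e μ (A ν) x) + lieBrL G (A μ x) (frameDeriv e κ (A ν) x)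
        - lieBrL G (A ν x) (frameDeriv e κ (A μ) x) - lieBrL G (A κ x) (frameDeriv e ν (A μ) x))
      + (∑ α, bracketCoeff h e κ μ α x • lieBrL G (A ν x) (A α x)
        - ∑ α, bracketCoeff h e μ ν α x • lieBrL G (A κ x) (A α x))
      - (∑ β, frameDeriv e κ (bracketCoeff h e μ ν β) x • A β x
        + ∑ β, (∑ α, bracketCoeff h e κ μ α x * bracketCoeff h e ν α β x) • A β x)
      + lieBrL G (A κ x) (lieBrL G (A μ x) (A ν x)) := by
    intro κ μ ν
    have h3 : frameDeriv e κ (fun y ↦ F y μ ν) x =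
        frameDeriv e κ (frameDeriv e μ (A ν)) x - frameDeriv e κ (frameDeriv e ν (A μ)) x
        - ∑ β, (frameDeriv e κ (bracketCoeff h e μ ν β) x • A β x
          + bracketCoeff h e μ ν β x • frameDeriv e κ (A β) x)
        + (lieBrL G (frameDeriv e κ (A μ) x) (A ν x)
          + lieBrL G (A μ x) (frameDeriv e κ (A ν) x)) := by
      have d1 := hf.smoothOn_frameDeriv (μ := μ) (hA ν)
      have d2 := hf.smoothOn_frameDeriv (μ := ν) (hA μ)
      have d3 : ∀ β, SmoothOn (fun y ↦ bracketCoeff h e μ ν β y • A β y) s := fun β ↦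
        (hf.smoothOn_bracketCoeff μ ν β).smul (hA β)
      have d4 : SmoothOn (fun y ↦ lieBrL G (A μ y) (A ν y)) s :=
        SmoothOn.bilin (lieBrL G) (hA μ) (hA ν)
      change frameDeriv e κ (fun y ↦ frameDeriv e μ (A ν) y - frameDeriv e ν (A μ) y
        - ∑ β, bracketCoeff h e μ ν β y • A β y + lieBrL G (A μ y) (A ν y)) x = _
      rw [frameDeriv_add hf.isOpen ((d1.sub d2).sub (SmoothOn.sum d3)) d4 hx,
        frameDeriv_sub hf.isOpen (d1.sub d2) (SmoothOn.sum d3) hx,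
        frameDeriv_sub hf.isOpen d1 d2 hx, frameDeriv_sum hf.isOpen d3 hx,
        frameDeriv_bilin hf.isOpen (lieBrL G) (hA μ) (hA ν) hx]
      congr 2
      exact Finset.sum_congr rfl fun β _ ↦
        frameDeriv_smul hf.isOpen (hf.smoothOn_bracketCoeff μ ν β) (hA β) hx
    have h4 := hf.frameDeriv_comm (hA ν) hx κ μ
    have h5 : ∀ α, F x α ν = frameDeriv e α (A ν) x - frameDeriv e ν (A α) x
        + ∑ β, bracketCoeff h e ν α β x • A β x - lieBrL G (A ν x) (A α x) := by
      intro α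
      have h6 : ∀ β, bracketCoeff h e ν α β x = -bracketCoeff h e α ν β x := fun β ↦
        bracketCoeff_swap h ν α β x
      simp only [h6, neg_smul, Finset.sum_neg_distrib]
      rw [hL (A ν x)]
      change _ - _ - _ + _ = _
      abel
    have h7 : ∑ β, (∑ α, bracketCoeff h e κ μ α x * bracketCoeff h e ν α β x) • A β x =
        ∑ α, bracketCoeff h e κ μ α x • ∑ β, bracketCoeff h e ν α β x • A β x := by
      simp only [Finset.sum_smul, Finset.smul_sum, smul_smul]
      exact Finset.sum_comm
    have h8 : D κ (fun y ↦ F y μ ν) x = frameDeriv e κ (fun y ↦ F y μ ν) x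
        + lieBrL G (A κ x) (frameDeriv e μ (A ν) x - frameDeriv e ν (A μ) x
          - ∑ β, bracketCoeff h e μ ν β x • A β x + lieBrL G (A μ x) (A ν x)) := rfl
    rw [h8, h3, h7, sub_eq_iff_eq_add.1 h4, hL _ (A ν x)]
    simp only [h5, smul_add, smul_sub, Finset.sum_add_distrib, Finset.sum_sub_distrib, map_add,
      map_sub, map_sum, map_smul]
    abel
  have h3 : ∑ β, ((frameDeriv e κ (bracketCoeff h e μ ν β) x
        + ∑ α, bracketCoeff h e μ ν α x * bracketCoeff h e κ α β x)
      + (frameDeriv e μ (bracketCoeff h e ν κ β) x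
        + ∑ α, bracketCoeff h e ν κ α x * bracketCoeff h e μ α β x)
      + (frameDeriv e ν (bracketCoeff h e κ μ β) x
        + ∑ α, bracketCoeff h e κ μ α x * bracketCoeff h e ν α β x)) • A β x = 0 :=
    Finset.sum_eq_zero fun β _ ↦ by rw [hf.bracketCoeff_jacobi hx, zero_smul]
  simp only [add_smul _ (_ : ℝ) (A _ x), Finset.sum_add_distrib] at h3
  have h4 : lieBrL G (A κ x) (lieBrL G (A μ x) (A ν x))
      + lieBrL G (A μ x) (lieBrL G (A ν x) (A κ x))
      + lieBrL G (A ν x) (lieBrL G (A κ x) (A μ x)) = 0 := by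
    have h5 : lieBrL G (A κ x) (lieBrL G (A μ x) (A ν x)) =
        lieBrL G (lieBrL G (A κ x) (A μ x)) (A ν x)
          + lieBrL G (A μ x) (lieBrL G (A κ x) (A ν x)) := lieBr_lieBr _ _ _
    rw [h5, hL _ (A ν x), hL (A κ x) (A ν x), map_neg]
    abel
  rw [h1, h2, h2, h2]
  refine Eq.trans ?_ ((congrArg₂ (· - ·) h4 h3).trans (sub_zero 0))
  beta_reduce
  abel

end GaugePotential

/-! ## The spin connection and the Dirac operator -/

section SpinGen

variable {A : Type*} [Ring A] [Algebra ℝ A] (g : Fin 4 → A)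

theorem spinGen_add (a b : Fin 4 → Fin 4 → ℝ) :
    spinGen g a + spinGen g b = spinGen g fun ν κ ↦ a ν κ + b ν κ := by
  simp only [spinGen, ← smul_add, ← Finset.sum_add_distrib, ← add_smul]

theorem spinGen_sub (a b : Fin 4 → Fin 4 → ℝ) :
    spinGen g a - spinGen g b = spinGen g fun ν κ ↦ a ν κ - b ν κ := by
  simp only [spinGen, ← smul_sub, ← Finset.sum_sub_distrib, ← sub_smul]

theorem smul_spinGen (c : ℝ) (a : Fin 4 → Fin 4 → ℝ) :
    c • spinGen g a = spinGen g fun ν κ ↦ c * a ν κ := by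
  simp only [spinGen, smul_comm c, Finset.smul_sum, mul_smul]

theorem sum_spinGen {ι : Type*} [Fintype ι] (a : ι → Fin 4 → Fin 4 → ℝ) :
    ∑ i, spinGen g (a i) = spinGen g fun ν κ ↦ ∑ i, a i ν κ := by
  simp only [spinGen, ← Finset.smul_sum, Finset.sum_smul]
  rw [Finset.sum_comm]
  exact congrArg _ (Finset.sum_congr rfl fun ν _ ↦ Finset.sum_comm)

end SpinGen

section DiracOperator

variable {M : Type*} [TopologicalSpace M] [ChartedSpace (EuclideanSpace ℝ (Fin 4)) M]
  [IsManifold (𝓡 4) ∞ M]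
  {X : Type*} [NormedAddCommGroup X] [NormedSpace ℝ X]
  {h : LorentzMetric M} {e : Fin 4 → ∀ x : M, TangentSpace (𝓡 4) x} {s : Set M} {x : M}
  {g : Fin 4 → X →L[ℝ] X}

theorem christoffel_eq (μ ν κ : Fin 4) (x : M) :
    christoffel h e μ ν κ x = eta κ * christoffelUp h e μ ν κ x := by
  unfold christoffelUp
  rw [← mul_assoc, eta_mul_self, one_mul]

theorem IsOrthonormalFrame.smoothOn_christoffel (hf : IsOrthonormalFrame h e s) (μ ν κ : Fin 4) :
    SmoothOn (christoffel h e μ ν κ) s :=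
  ((SmoothOn.const (eta κ)).mul (hf.smoothOn_christoffelUp μ ν κ)).congr
    fun x _ ↦ christoffel_eq μ ν κ x

theorem smoothOn_spinGen {a : Fin 4 → Fin 4 → M → ℝ} (ha : ∀ ν κ, SmoothOn (a ν κ) s) :
    SmoothOn (fun x ↦ spinGen g fun ν κ ↦ a ν κ x) s :=
  (SmoothOn.const (1 / 4 : ℝ)).smul (SmoothOn.sum fun ν ↦ SmoothOn.sum fun κ ↦
    (ha ν κ).smul (SmoothOn.const (g ν * g κ)))

theorem frameDeriv_spinGen (hs : IsOpen s) {a : Fin 4 → Fin 4 → M → ℝ}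
    (ha : ∀ ν κ, SmoothOn (a ν κ) s) (hx : x ∈ s) (μ : Fin 4) :
    frameDeriv e μ (fun x ↦ spinGen g fun ν κ ↦ a ν κ x) x =
      spinGen g fun ν κ ↦ frameDeriv e μ (a ν κ) x := by
  have h1 : ∀ ν κ, SmoothOn (fun x ↦ a ν κ x • (g ν * g κ)) s := fun ν κ ↦
    (ha ν κ).smul (SmoothOn.const _)
  unfold spinGen
  rw [frameDeriv_const_smul hs _ (SmoothOn.sum fun ν ↦ SmoothOn.sum fun κ ↦ h1 ν κ) hx,
    frameDeriv_sum hs (fun ν ↦ SmoothOn.sum fun κ ↦ h1 ν κ) hx]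
  refine congrArg _ (Finset.sum_congr rfl fun ν _ ↦ ?_)
  rw [frameDeriv_sum hs (h1 ν) hx]
  refine Finset.sum_congr rfl fun κ _ ↦ ?_
  rw [frameDeriv_smul hs (ha ν κ) (SmoothOn.const _) hx, frameDeriv_const, smul_zero, add_zero]

/-- The spin connection `¼ Γ_{μνκ} γ^ν γ^κ`. -/
def spinConn (h : LorentzMetric M) (e : Fin 4 → ∀ x : M, TangentSpace (𝓡 4) x)
    (g : Fin 4 → X →L[ℝ] X) (μ : Fin 4) (x : M) : X →L[ℝ] X :=
  spinGen g fun ν κ ↦ christoffel h e μ ν κ x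

theorem smoothOn_spinConn (hf : IsOrthonormalFrame h e s) (μ : Fin 4) :
    SmoothOn (spinConn h e g μ) s := smoothOn_spinGen fun ν κ ↦ hf.smoothOn_christoffel μ ν κ

/-- `spinGen` is linear in its coefficients and carries the commutator to the quadratic part of the
Riemann tensor, so the curvature may be computed on coefficients. -/
theorem linearCurvature_spinConn (hf : IsOrthonormalFrame h e s) (hg : IsClifford g) (hx : x ∈ s)
    (μ ν : Fin 4) : linearCurvature h e (spinConn h e g) μ ν x =
      spinGen g fun κ ρ ↦ riemann h e μ ν κ ρ x := by
  have h1 : ∀ μ ν, frameDeriv e μ (spinConn h e g ν) x =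
      spinGen g fun κ ρ ↦ frameDeriv e μ (christoffel h e ν κ ρ) x := fun μ ν ↦
    frameDeriv_spinGen hf.isOpen (fun κ ρ ↦ hf.smoothOn_christoffel ν κ ρ) hx μ
  have h2 : ∀ μ ν κ ρ, frameDeriv e μ (christoffelUp h e ν κ ρ) x =
      eta ρ * frameDeriv e μ (christoffel h e ν κ ρ) x := fun μ ν κ ρ ↦
    frameDeriv_const_smul hf.isOpen (eta ρ) (hf.smoothOn_christoffel ν κ ρ) hx
  unfold linearCurvature
  rw [h1, h1]
  unfold spinConn
  rw [hg.spinGen_commutator fun κ ρ ↦ christoffel_skew h e μ κ ρ x]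
  simp only [smul_spinGen, spinGen_sub, spinGen_add, sum_spinGen]
  congr 1
  funext κ ρ
  rw [riemann_eq, riemannUp, h2, h2, mul_add, mul_sub, ← mul_assoc, ← mul_assoc, eta_mul_self,
    one_mul, one_mul, Finset.mul_sum, add_sub_assoc, ← Finset.sum_sub_distrib]
  congr 1
  refine Finset.sum_congr rfl fun α _ ↦ ?_
  unfold christoffelUp
  linear_combination (-eta α * (christoffel h e ν κ α x * christoffel h e μ α ρ x
    - christoffel h e μ κ α x * christoffel h e ν α ρ x)
    + bracketCoeff h e μ ν α x * christoffel h e α κ ρ x) * eta_mul_self ρ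

/-- The mixed commutators vanish because the two potentials commute pointwise, as the spin and gauge
parts do on different tensor factors. -/
theorem linearCurvature_add (hf : IsOrthonormalFrame h e s) {S T : Fin 4 → M → X →L[ℝ] X}
    (hS : ∀ μ, SmoothOn (S μ) s) (hT : ∀ μ, SmoothOn (T μ) s)
    (hST : ∀ μ ν x, S μ x * T ν x = T ν x * S μ x) (hx : x ∈ s) (μ ν : Fin 4) :
    linearCurvature h e (fun μ x ↦ S μ x + T μ x) μ ν x =
      linearCurvature h e S μ ν x + linearCurvature h e T μ ν x := by
  unfold linearCurvature
  rw [frameDeriv_add hf.isOpen (hS ν) (hT ν) hx, frameDeriv_add hf.isOpen (hS μ) (hT μ) hx]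
  simp only [smul_add, Finset.sum_add_distrib, add_mul, mul_add, hST]
  abel

/-- A twisted Dirac connection is compatible with Clifford multiplication. -/
theorem connDeriv_clifford (hf : IsOrthonormalFrame h e s) (hg : IsClifford g)
    {T : Fin 4 → M → X →L[ℝ] X} (hT : ∀ μ x ν, T μ x * g ν = g ν * T μ x) {u : M → X}
    (hu : SmoothOn u s) (hx : x ∈ s) (μ ν : Fin 4) :
    connDeriv e (fun μ x u ↦ (spinConn h e g μ x + T μ x) u) μ (fun y ↦ g ν (u y)) x =
      g ν (connDeriv e (fun μ x u ↦ (spinConn h e g μ x + T μ x) u) μ u x)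
        - ∑ κ, christoffelUp h e μ κ ν x • g κ (u x) := by
  have h1 := hg.spinGen_mul_sub (fun κ ρ ↦ christoffel_skew h e μ κ ρ x) ν
  have h2 := congrArg (fun E : X →L[ℝ] X ↦ E (u x)) h1
  have h3 := congrArg (fun E : X →L[ℝ] X ↦ E (u x)) (hT μ x ν)
  have h4 : ∀ κ, christoffelUp h e μ κ ν x = -(eta ν * christoffel h e μ ν κ x) := fun κ ↦ by
    unfold christoffelUp
    rw [christoffel_skew]
    ring
  simp only [sub_apply, mul_apply_eq_comp, sum_apply, smul_apply] at h2 h3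
  unfold connDeriv
  rw [frameDeriv_clm hf.isOpen (g ν) hu hx]
  simp only [add_apply, map_add, h4, neg_smul, Finset.sum_neg_distrib, ← h2, h3]
  unfold spinConn
  abel

/-- The square of a twisted Dirac operator. -/
theorem dirac_dirac (hf : IsOrthonormalFrame h e s) (hg : IsClifford g)
    {T : Fin 4 → M → X →L[ℝ] X} (hTs : ∀ μ, SmoothOn (T μ) s)
    (hT : ∀ μ x ν, T μ x * g ν = g ν * T μ x) {u : M → X} (hu : SmoothOn u s) (hx : x ∈ s) :
    let D := connDeriv e fun μ x u ↦ (spinConn h e g μ x + T μ x) u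
    ∑ μ, g μ (D μ (fun y ↦ ∑ ν, g ν (D ν u y)) x) =
      (1 / 4 * scal h e x) • u x
        + (1 / 2 : ℝ) • ∑ μ, ∑ ν, g μ (g ν (linearCurvature h e T μ ν x (u x)))
        - ∑ κ, eta κ • hess h e D u κ κ x := by
  intro D
  have hSs := smoothOn_spinConn (g := g) hf
  have hD : IsCovDeriv e s D := isCovDeriv_linear hf fun μ ↦ (hSs μ).add (hTs μ)
  have hST : ∀ μ ν x, spinConn h e g μ x * T ν x = T ν x * spinConn h e g μ x := by
    intro μ ν x
    simp only [spinConn, spinGen, Finset.sum_mul, Finset.mul_sum, smul_mul_assoc, mul_smul_comm]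
    refine congrArg _ (Finset.sum_congr rfl fun α _ ↦ Finset.sum_congr rfl fun β _ ↦
      congrArg _ ?_)
    rw [mul_assoc, ← hT, ← mul_assoc, ← hT, mul_assoc]
  have hK : HasCurvature h e s D (fun μ ν x u ↦
      linearCurvature h e (fun μ x ↦ spinConn h e g μ x + T μ x) μ ν x u) :=
    hasCurvature_linear hf fun μ ↦ (hSs μ).add (hTs μ)
  -- Commuting ∇_μ with γ^ν produces exactly the Γ term that completes ∇_μ∇_ν to the Hessian.
  have h1 : ∑ μ, g μ (D μ (fun y ↦ ∑ ν, g ν (D ν u y)) x) =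
      ∑ μ, ∑ ν, g μ (g ν (hess h e D u μ ν x)) := by
    refine Finset.sum_congr rfl fun μ _ ↦ ?_
    rw [hD.sum μ (fun ν ↦ (hD.smooth ν hu).clm (g ν)) hx]
    simp only [D, connDeriv_clifford hf hg hT (hD.smooth _ hu) hx, Finset.sum_sub_distrib]
    rw [Finset.sum_comm (f := fun ν κ ↦ christoffelUp h e μ κ ν x • g κ _)]
    simp only [hess, map_sub, map_sum, map_smul, Finset.sum_sub_distrib]
  -- The symmetric part of γ^μ γ^ν meets the Hessian in its trace, which is the wave operator; the
  -- rest sees only the antisymmetric part of the Hessian, which is curvature.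
  have h2 : (2 : ℝ) • ∑ μ, ∑ ν, g μ (g ν (hess h e D u μ ν x)) =
      ∑ μ, ∑ ν, (g μ * g ν + g ν * g μ) (hess h e D u μ ν x)
        + ∑ μ, ∑ ν, g μ (g ν (hess h e D u μ ν x - hess h e D u ν μ x)) := by
    simp only [add_apply, mul_apply_eq_comp, map_sub, Finset.sum_add_distrib,
      Finset.sum_sub_distrib]
    rw [Finset.sum_comm (f := fun μ ν ↦ g ν (g μ (hess h e D u μ ν x))), two_smul]
    abel
  have h3 : ∑ μ, ∑ ν, (g μ * g ν + g ν * g μ) (hess h e D u μ ν x) =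
      -((2 : ℝ) • ∑ κ, eta κ • hess h e D u κ κ x) := by
    have h4 : ∀ μ ν, (g μ * g ν + g ν * g μ) (hess h e D u μ ν x) =
        if μ = ν then -((2 : ℝ) • eta μ • hess h e D u μ μ x) else 0 := by
      intro μ ν
      rw [hg]
      by_cases h : μ = ν
      · subst h; simp [minkowski, mul_smul]
      · simp [minkowski, h]
    simp only [h4, Finset.sum_ite_eq, Finset.mem_univ, if_true]
    rw [Finset.sum_neg_distrib, Finset.smul_sum]
  have h5 : ∑ μ, ∑ ν, g μ (g ν (hess h e D u μ ν x - hess h e D u ν μ x)) =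
      (1 / 2 * scal h e x) • u x
        + ∑ μ, ∑ ν, g μ (g ν (linearCurvature h e T μ ν x (u x))) := by
    have h6 := congrArg (fun E : X →L[ℝ] X ↦ E (u x)) (lichnerowicz hf hg hx)
    simp only [sum_apply, mul_apply_eq_comp, smul_apply, one_apply_eq_self] at h6
    rw [← h6, ← Finset.sum_add_distrib]
    refine Finset.sum_congr rfl fun μ _ ↦ ?_
    rw [← Finset.sum_add_distrib]
    refine Finset.sum_congr rfl fun ν _ ↦ ?_
    rw [hess_sub_hess hK hu hx, linearCurvature_add hf hSs hTs hST hx,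
      linearCurvature_spinConn hf hg hx, add_apply, map_add, map_add]
  rw [h1]
  rw [h3, h5] at h2
  refine smul_right_injective X (two_ne_zero (α := ℝ)) ?_
  refine h2.trans ?_
  module

end DiracOperator

/-! ## Momentum maps -/

section MomentumMap

variable {n : ℕ} {G : Type*} [TopologicalSpace G] [ChartedSpace (EuclideanSpace ℝ (Fin n)) G]
  [Group G] [LieGroup (𝓡 n) ∞ G]
  {X : Type*} [NormedAddCommGroup X] [NormedSpace ℝ X]
  (ξ : Module.Basis (Fin n) ℝ (LieAlg n)) (L : LieAlg n →L[ℝ] X →L[ℝ] X) (B : X →L[ℝ] X →L[ℝ] ℝ)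

/-- The momentum map `(u, v) ↦ ∑ B(u, ξ_a v) ξ_a` of an action of the Lie algebra. -/
def momentum : X →L[ℝ] X →L[ℝ] LieAlg n :=
  ∑ a, ((ContinuousLinearMap.compL ℝ X ℝ (LieAlg n))
    (ContinuousLinearMap.toSpanSingleton ℝ (ξ a))).comp
      (B.bilinearComp (ContinuousLinearMap.id ℝ X) (L (ξ a)))

theorem momentum_apply (u v : X) : momentum ξ L B u v = ∑ a, B u (L (ξ a) v) • ξ a := by
  simp [momentum]

variable {ξ L B}

/-- The characterisation of the momentum map independent of the basis. Both sides are linear in Z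
and agree on the orthonormal basis. -/
theorem inner_momentum {k : AdInvariantInner (n := n) G}
    (hξ : ∀ a b, k.val (ξ a) (ξ b) = if a = b then 1 else 0) (u v : X) (Z : LieAlg n) :
    k.val (momentum ξ L B u v) Z = B u (L Z v) := by
  have h1 : ∀ b, k.val (momentum ξ L B u v) (ξ b) = B u (L (ξ b) v) := by
    intro b
    simp [momentum_apply, hξ]
  have h2 : k.val (momentum ξ L B u v) = ((B u).comp (L.flip v)).toLinearMap := ξ.ext h1
  exact congrArg (fun T : LieAlg n →ₗ[ℝ] ℝ ↦ T Z) h2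

/-- Infinitesimal equivariance, tested against an arbitrary T: `lieBr_left` moves the bracket to T,
the representation property expands it, and skewness of the action for B matches the terms. It makes
the momentum map parallel. -/
theorem lieBr_momentum {k : AdInvariantInner (n := n) G}
    (hξ : ∀ a b, k.val (ξ a) (ξ b) = if a = b then 1 else 0)
    (hL : ∀ Y Z, L (lieBr G Y Z) = L Y * L Z - L Z * L Y)
    (hB : ∀ Z u v, B (L Z u) v = -B u (L Z v)) (Z : LieAlg n) (u v : X) :
    lieBr G Z (momentum ξ L B u v) =
      momentum ξ L B (L Z u) v + momentum ξ L B u (L Z v) := by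
  have h1 : ∀ T, k.val (lieBr G Z (momentum ξ L B u v)
      - (momentum ξ L B (L Z u) v + momentum ξ L B u (L Z v))) T = 0 := by
    intro T
    rw [map_sub, map_add, LinearMap.sub_apply, LinearMap.add_apply, k.lieBr_left,
      inner_momentum hξ, inner_momentum hξ, inner_momentum hξ, hL, hB, sub_apply,
      mul_apply_eq_comp, mul_apply_eq_comp, map_sub]
    ring
  by_contra h2
  exact (k.pos _ (sub_ne_zero.2 h2)).ne' (h1 _)

end MomentumMap

/-! ## The product rule for connections -/

section ProductRule

variable {M : Type*} [TopologicalSpace M] [ChartedSpace (EuclideanSpace ℝ (Fin 4)) M]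
  [IsManifold (𝓡 4) ∞ M]
  {X Y Z : Type*} [NormedAddCommGroup X] [NormedSpace ℝ X] [NormedAddCommGroup Y]
  [NormedSpace ℝ Y] [NormedAddCommGroup Z] [NormedSpace ℝ Z]
  {e : Fin 4 → ∀ x : M, TangentSpace (𝓡 4) x} {s : Set M} {x : M}

/-- The hypothesis `hm` says that the constant bilinear map is annihilated by the connection forms,
that is, parallel. -/
theorem connDeriv_bilin (hs : IsOpen s) {CX : Fin 4 → M → X → X} {CY : Fin 4 → M → Y → Y}
    {CZ : Fin 4 → M → Z → Z} (m : X →L[ℝ] Y →L[ℝ] Z)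
    (hm : ∀ μ u v, CZ μ x (m u v) = m (CX μ x u) v + m u (CY μ x v))
    {u : M → X} {v : M → Y} (hu : SmoothOn u s) (hv : SmoothOn v s) (hx : x ∈ s) (μ : Fin 4) :
    connDeriv e CZ μ (fun y ↦ m (u y) (v y)) x =
      m (connDeriv e CX μ u x) (v x) + m (u x) (connDeriv e CY μ v x) := by
  unfold connDeriv
  rw [frameDeriv_bilin hs m hu hv hx, hm, map_add, map_add, add_apply]
  abel

end ProductRule

/-! ## Local expressions of the fields -/

section LocalFields

variable {M : Type*} [TopologicalSpace M] [ChartedSpace (EuclideanSpace ℝ (Fin 4)) M]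
  [IsManifold (𝓡 4) ∞ M]
  {n : ℕ}
  {G : Type*} [TopologicalSpace G] [ChartedSpace (EuclideanSpace ℝ (Fin n)) G]
  [Group G] [LieGroup (𝓡 n) ∞ G]
  {P : Type*} [TopologicalSpace P] [ChartedSpace (EuclideanSpace ℝ (Fin (4 + n))) P]
  [IsManifold (𝓡 (4 + n)) ∞ P]
  {Q : Type*} [TopologicalSpace Q]
  {W : Type*} [NormedAddCommGroup W] [InnerProductSpace ℂ W] [FiniteDimensional ℂ W]
  {V : Type*} [NormedAddCommGroup V] [InnerProductSpace ℂ V] [FiniteDimensional ℂ V]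
  {D : Model (n := n) M G P Q W V}

/-- The vielbein sits over x and the spin frame over the projection of ε(x); the two base points are
only propositionally equal, so vectors are compared in the total space. -/
theorem LorentzMetric.val_eq_of_totalSpace_eq (h : LorentzMetric M) {x y : M}
    {v v' : TangentSpace (𝓡 4) x} {w w' : TangentSpace (𝓡 4) y}
    (h1 : (⟨x, v⟩ : TangentBundle (𝓡 4) M) = ⟨y, w⟩)
    (h2 : (⟨x, v'⟩ : TangentBundle (𝓡 4) M) = ⟨y, w'⟩) : h.val x v v' = h.val y w w' := by
  obtain rfl : x = y := congrArg Bundle.TotalSpace.proj h1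
  rw [Bundle.TotalSpace.mk_inj.1 h1, Bundle.TotalSpace.mk_inj.1 h2]

theorem LocalGauge.isOrthonormalFrame (σ : LocalGauge D) :
    IsOrthonormalFrame D.metric σ.e σ.dom where
  isOpen := σ.isOpen_dom
  smooth := σ.smooth_e
  orthonormal x hx μ ν := by
    rw [D.metric.val_eq_of_totalSpace_eq (σ.e_eq μ x hx) (σ.e_eq ν x hx),
      D.spin.frame_orthonormal]

namespace Fields

variable (f : Fields D) (σ : LocalGauge D)

/-- A_μ is the connection form, smooth on the tangent bundle of P, composed with the tangent map of
s and the field e_μ. -/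
theorem smoothOn_A (μ : Fin 4) : SmoothOn (f.A σ μ) σ.dom := by
  have : IsManifold (𝓡 4) 1 M := IsManifold.of_le (n := ∞) (by simp)
  have : IsManifold (𝓡 (4 + n)) 1 P := IsManifold.of_le (n := ∞) (by simp)
  have h1 := ContMDiffOn.contMDiffOn_tangentMapWithin (m := ∞) σ.smooth_s (by simp)
    σ.isOpen_dom.uniqueMDiffOn
  have h2 := h1.comp (σ.smooth_e μ) fun x hx ↦ hx
  have h3 := f.conn.smooth.comp_contMDiffOn h2
  refine h3.congr fun x hx ↦ ?_
  exact (congrArg (fun T : TangentSpace (𝓡 4) x →L[ℝ] TangentSpace (𝓡 (4 + n)) (σ.s x) ↦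
    f.conn.form (σ.s x) (T (σ.e μ x))) (mfderivWithin_of_isOpen σ.isOpen_dom hx)).symm

theorem smoothOn_phi : SmoothOn (f.phi σ) σ.dom := f.higgs_smooth.comp_contMDiffOn σ.smooth_s

theorem smoothOn_psi : SmoothOn (f.psi σ) σ.dom := f.spinor_smooth σ

theorem F_eq_curvatureForm {x : M} (hx : x ∈ σ.dom) (μ ν : Fin 4) :
    f.F σ μ ν x = curvatureForm G D.metric σ.e (f.A σ) μ ν x := by
  have h1 : f.localForm σ x (VectorField.mlieBracket (𝓡 4) (σ.e μ) (σ.e ν) x) =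
      ∑ κ, bracketCoeff D.metric σ.e μ ν κ x • f.A σ κ x := by
    rw [σ.isOrthonormalFrame.mlieBracket_eq hx]
    simp only [localForm, map_sum, map_smul]
    rfl
  unfold F curvatureForm
  rw [h1]
  rfl

/-- The field strength as a function with values in matrices of Lie algebra elements. -/
theorem eqOn_F : Set.EqOn (fun x μ ν ↦ f.F σ μ ν x)
    (fun x μ ν ↦ curvatureForm G D.metric σ.e (f.A σ) μ ν x) σ.dom :=
  fun _ hx ↦ funext fun μ ↦ funext fun ν ↦ f.F_eq_curvatureForm σ hx μ ν

theorem smoothOn_F (μ ν : Fin 4) : SmoothOn (f.F σ μ ν) σ.dom :=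
  (smoothOn_curvatureForm σ.isOrthonormalFrame (f.smoothOn_A σ) μ ν).congr
    fun _ hx ↦ f.F_eq_curvatureForm σ hx μ ν

theorem F_skew {x : M} (hx : x ∈ σ.dom) (μ ν : Fin 4) : f.F σ μ ν x = -f.F σ ν μ x := by
  rw [f.F_eq_curvatureForm σ hx, f.F_eq_curvatureForm σ hx, curvatureForm_skew]

/-! ### The induced connections -/

/-- The Lie algebra representation `ρ_*` on the Higgs space, by real linear maps. -/
def higgsRep (D : Model (n := n) M G P Q W V) : LieAlg n →L[ℝ] W →L[ℝ] W :=
  (UnitaryRep.evalL W).comp D.rho.derivL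

/-- The Lie algebra representation `χ_*` on twisted spinors, by real linear maps. -/
def spinorRep (D : Model (n := n) M G P Q W V) : LieAlg n →L[ℝ] (Fin 4 → V) →L[ℝ] (Fin 4 → V) :=
  (twistL V).comp D.chi.derivL

theorem higgsRep_lieBr (Y Z : LieAlg n) :
    higgsRep D (lieBr G Y Z) = higgsRep D Y * higgsRep D Z - higgsRep D Z * higgsRep D Y := by
  change UnitaryRep.evalL W (D.rho.deriv (lieBr G Y Z)) = _
  rw [D.rho.deriv_lieBr, map_sub]
  rfl

theorem spinorRep_lieBr (Y Z : LieAlg n) : spinorRep D (lieBr G Y Z) =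
    spinorRep D Y * spinorRep D Z - spinorRep D Z * spinorRep D Y := by
  change twistL V (D.chi.deriv (lieBr G Y Z)) = _
  rw [D.chi.deriv_lieBr, map_sub]
  rfl

theorem lieBrL_lieBr (Y Z : LieAlg n) :
    lieBrL G (lieBr G Y Z) = lieBrL G Y * lieBrL G Z - lieBrL G Z * lieBrL G Y := by
  ext1 T
  rw [sub_apply, mul_apply_eq_comp, mul_apply_eq_comp]
  exact (sub_eq_of_eq_add (lieBr_lieBr Y Z T)).symm

/-- The covariant derivative of sections of `Ad P`. -/
abbrev derivAd : Fin 4 → (M → LieAlg n) → M → LieAlg n := connDeriv σ.e (f.connAd σ)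

/-- The covariant derivative of sections of `P ×_ρ W`. -/
abbrev derivHiggs : Fin 4 → (M → W) → M → W := connDeriv σ.e (f.connHiggs σ)

/-- The covariant derivative of twisted spinors. -/
abbrev derivSpinor : Fin 4 → (M → Fin 4 → V) → M → Fin 4 → V := connDeriv σ.e (f.connSpinor σ)

theorem connSpinor_eq : f.connSpinor σ = fun μ x u ↦
    (spinConn D.metric σ.e (cliff V) μ x + spinorRep D (f.A σ μ x)) u := by
  funext μ x u
  unfold connSpinor spinConn spinGen
  rw [add_apply, smul_apply]
  simp only [sum_apply, smul_apply, mul_apply_eq_comp, cliff, spinEnd_apply]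
  rfl

theorem isCovDeriv_derivAd : IsCovDeriv σ.e σ.dom (f.derivAd σ) :=
  isCovDeriv_linear σ.isOrthonormalFrame (C := fun μ x ↦ lieBrL G (f.A σ μ x))
    fun μ ↦ (f.smoothOn_A σ μ).clm (lieBrL G)

theorem isCovDeriv_derivHiggs : IsCovDeriv σ.e σ.dom (f.derivHiggs σ) :=
  isCovDeriv_linear σ.isOrthonormalFrame (C := fun μ x ↦ higgsRep D (f.A σ μ x))
    fun μ ↦ (f.smoothOn_A σ μ).clm (higgsRep D)

theorem smoothOn_spinorRep (μ : Fin 4) : SmoothOn (fun x ↦ spinorRep D (f.A σ μ x)) σ.dom :=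
  SmoothOn.clm (Y := (Fin 4 → V) →L[ℝ] (Fin 4 → V)) (spinorRep D) (f.smoothOn_A σ μ)

theorem isCovDeriv_derivSpinor : IsCovDeriv σ.e σ.dom (f.derivSpinor σ) := by
  unfold derivSpinor
  rw [connSpinor_eq]
  exact isCovDeriv_linear σ.isOrthonormalFrame
    (C := fun μ x ↦ spinConn D.metric σ.e (cliff V) μ x + spinorRep D (f.A σ μ x))
    fun μ ↦ (smoothOn_spinConn σ.isOrthonormalFrame μ).add (f.smoothOn_spinorRep σ μ)

theorem hasCurvature_derivAd : HasCurvature D.metric σ.e σ.dom (f.derivAd σ)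
    (fun μ ν x u ↦ lieBr G (f.F σ μ ν x) u) := by
  intro u hu x hx μ ν
  beta_reduce
  rw [f.F_eq_curvatureForm σ hx]
  refine (hasCurvature_linear σ.isOrthonormalFrame (C := fun μ x ↦ lieBrL G (f.A σ μ x))
    (fun μ ↦ (f.smoothOn_A σ μ).clm (lieBrL G)) u hu x hx μ ν).trans ?_
  beta_reduce
  rw [linearCurvature_rep σ.isOrthonormalFrame (f.smoothOn_A σ) (lieBrL G) lieBrL_lieBr hx]
  rfl

theorem hasCurvature_derivHiggs : HasCurvature D.metric σ.e σ.dom (f.derivHiggs σ)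
    (fun μ ν x u ↦ D.rho.deriv (f.F σ μ ν x) u) := by
  intro u hu x hx μ ν
  beta_reduce
  rw [f.F_eq_curvatureForm σ hx]
  refine (hasCurvature_linear σ.isOrthonormalFrame (C := fun μ x ↦ higgsRep D (f.A σ μ x))
    (fun μ ↦ (f.smoothOn_A σ μ).clm (higgsRep D)) u hu x hx μ ν).trans ?_
  beta_reduce
  rw [linearCurvature_rep σ.isOrthonormalFrame (f.smoothOn_A σ) (higgsRep D) higgsRep_lieBr hx]
  rfl

theorem nablaPhi_eq (μ : Fin 4) (x : M) : f.nablaPhi σ μ x = f.derivHiggs σ μ (f.phi σ) x :=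
  covDeriv_zero _ _ _ _

theorem nablaPsi_eq (μ : Fin 4) (x : M) : f.nablaPsi σ μ x = f.derivSpinor σ μ (f.psi σ) x :=
  covDeriv_zero _ _ _ _

/-! ### The wave equation of the spinor -/

theorem spinMul_gamma_eq (μ : Fin 4) (ψ : Fin 4 → V) :
    eta μ • spinMul (gamma μ) ψ = cliff V μ ψ := by
  rw [cliff, spinEnd_apply, spinMul_gammaUp]

theorem spinorRep_mul_cliff (Y : LieAlg n) (ν : Fin 4) :
    spinorRep D Y * cliff V ν = cliff V ν * spinorRep D Y :=
  (cliff_mul_twistL ν (D.chi.deriv Y)).symm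

theorem dirac_eq (x : M) :
    f.dirac σ x = ∑ μ, cliff V μ (f.derivSpinor σ μ (f.psi σ) x) := by
  simp only [dirac, nablaPsi_eq, spinMul_gamma_eq]

/-- The Weitzenböck formula for the twisted Dirac operator. -/
theorem dirac_dirac_eq {x : M} (hx : x ∈ σ.dom) :
    ∑ μ, cliff V μ (f.derivSpinor σ μ (f.dirac σ) x) =
      (1 / 4 * σ.scal x) • f.psi σ x + f.curvPsi σ x - f.boxPsi σ x := by
  have h1 := dirac_dirac σ.isOrthonormalFrame isClifford_cliff (f.smoothOn_spinorRep σ)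
    (fun μ x ν ↦ spinorRep_mul_cliff (f.A σ μ x) ν) (f.smoothOn_psi σ) hx
  rw [← connSpinor_eq] at h1
  have h2 : f.dirac σ = fun y ↦ ∑ ν, cliff V ν (f.derivSpinor σ ν (f.psi σ) y) :=
    funext fun y ↦ f.dirac_eq σ y
  have h3 : f.boxPsi σ x =
      ∑ κ, eta κ • hess D.metric σ.e (f.derivSpinor σ) (f.psi σ) κ κ x := box_zero _ _ _
  rw [h2, h3]
  refine h1.trans ?_
  congr 2
  refine congrArg _ (Finset.sum_congr rfl fun μ _ ↦ Finset.sum_congr rfl fun ν _ ↦ ?_)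
  rw [linearCurvature_rep σ.isOrthonormalFrame (f.smoothOn_A σ) (spinorRep D) spinorRep_lieBr hx,
    ← f.F_eq_curvatureForm σ hx, cliff, cliff, spinEnd_apply, spinEnd_apply]
  rfl

/-- The Yukawa map as a real bilinear map on Higgs fields and twisted spinors. -/
def yukawaL (D : Model (n := n) M G P Q W V) : W →L[ℝ] (Fin 4 → V) →L[ℝ] (Fin 4 → V) :=
  (twistL V).comp (LinearMap.toContinuousLinearMap D.Y)

theorem yukawa_deriv (X : LieAlg n) (w : W) (v : V) :
    D.Y (D.rho.deriv X w) v + D.Y w (D.chi.deriv X v) = D.chi.deriv X (D.Y w v) :=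
  deriv_equivariant D.rho D.chi
    ((UnitaryRep.evalL V).comp (LinearMap.toContinuousLinearMap D.Y)) D.Y_equivariant X w v

theorem cliff_mul_yukawaL (μ : Fin 4) (w : W) :
    cliff V μ * yukawaL D w = yukawaL D w * cliff V μ := cliff_mul_twistL μ (D.Y w)

/-- The Yukawa map is parallel: the spin connection acts on the other tensor factor and commutes
with it, and the gauge part is its infinitesimal equivariance. -/
theorem derivSpinor_yukawa {u : M → W} {v : M → Fin 4 → V} (hu : SmoothOn u σ.dom)
    (hv : SmoothOn v σ.dom) {x : M} (hx : x ∈ σ.dom) (μ : Fin 4) :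
    f.derivSpinor σ μ (fun y ↦ yukawaL D (u y) (v y)) x =
      yukawaL D (f.derivHiggs σ μ u x) (v x) + yukawaL D (u x) (f.derivSpinor σ μ v x) := by
  refine connDeriv_bilin σ.isOpen_dom (yukawaL D) (fun μ w ψ ↦ ?_) hu hv hx μ
  have h1 : spinConn D.metric σ.e (cliff V) μ x (yukawaL D w ψ) =
      yukawaL D w (spinConn D.metric σ.e (cliff V) μ x ψ) :=
    DFunLike.congr_fun
      (spinGen_mul_twistL (fun ν κ ↦ christoffel D.metric σ.e μ ν κ x) (D.Y w)) ψ
  have h2 : spinorRep D (f.A σ μ x) (yukawaL D w ψ) =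
      yukawaL D (f.connHiggs σ μ x w) ψ + yukawaL D w (spinorRep D (f.A σ μ x) ψ) :=
    funext fun a ↦ (yukawa_deriv (f.A σ μ x) w (ψ a)).symm
  rw [connSpinor_eq]
  simp only [add_apply, map_add]
  rw [h1, h2]
  abel

/-- D̸ is applied to D̸Ψ = -Y_Φ Ψ. The product rule gives -Y_{∇Φ}·Ψ - Y_Φ D̸Ψ, and inserting the
Dirac equation again turns the last term into Y_Φ² Ψ. Comparison with the Weitzenböck formula gives
the claim. -/
theorem boxPsi_eq (hf : f.SolvesEulerLagrange) {x : M} (hx : x ∈ σ.dom) :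
    f.boxPsi σ x = (1 / 4 * σ.scal x) • f.psi σ x + f.curvPsi σ x + f.yukawaNablaPsi σ x
      - twistMul (D.Y (f.phi σ x)) (twistMul (D.Y (f.phi σ x)) (f.psi σ x)) := by
  have h1 : Set.EqOn (f.dirac σ) (fun y ↦ -yukawaL D (f.phi σ y) (f.psi σ y)) σ.dom :=
    fun y hy ↦ eq_neg_of_add_eq_zero_left (hf.diracEq σ y hy)
  have hY : SmoothOn (fun y ↦ yukawaL D (f.phi σ y) (f.psi σ y)) σ.dom :=
    SmoothOn.bilin (yukawaL D) (f.smoothOn_phi σ) (f.smoothOn_psi σ)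
  have hneg : ∀ μ, f.derivSpinor σ μ (fun y ↦ -yukawaL D (f.phi σ y) (f.psi σ y)) x =
      -f.derivSpinor σ μ (fun y ↦ yukawaL D (f.phi σ y) (f.psi σ y)) x := by
    intro μ
    have h2 := (f.isCovDeriv_derivSpinor σ).const_smul μ (-1) hY hx
    simpa only [neg_one_smul] using h2
  have h3 : ∑ μ, cliff V μ (f.derivSpinor σ μ (f.dirac σ) x) =
      -f.yukawaNablaPsi σ x - yukawaL D (f.phi σ x) (f.dirac σ x) := by
    have h4 : ∀ μ, cliff V μ (f.derivSpinor σ μ (f.dirac σ) x) =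
        -(eta μ • spinMul (gamma μ) (twistMul (D.Y (f.nablaPhi σ μ x)) (f.psi σ x)))
          - yukawaL D (f.phi σ x) (cliff V μ (f.derivSpinor σ μ (f.psi σ) x)) := by
      intro μ
      have h5 := congrArg (fun T : (Fin 4 → V) →L[ℝ] (Fin 4 → V) ↦
        T (f.derivSpinor σ μ (f.psi σ) x)) (cliff_mul_yukawaL (D := D) μ (f.phi σ x))
      rw [(f.isCovDeriv_derivSpinor σ).congr μ h1 hx, hneg,
        f.derivSpinor_yukawa σ (f.smoothOn_phi σ) (f.smoothOn_psi σ) hx, spinMul_gamma_eq,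
        nablaPhi_eq, map_neg, map_add, neg_add, ← sub_eq_add_neg]
      exact congrArg _ h5
    simp only [h4, Finset.sum_sub_distrib, Finset.sum_neg_distrib, yukawaNablaPsi, dirac_eq, map_sum]
  rw [f.dirac_dirac_eq σ hx, h1 hx, map_neg, sub_neg_eq_add, sub_eq_iff_eq_add] at h3
  change _ = _ - yukawaL D (f.phi σ x) (yukawaL D (f.phi σ x) (f.psi σ x))
  rw [h3]
  abel

end Fields

end LocalFields

/-! ## The wave equation of the field strength -/

section FieldStrength

variable {M : Type*} [TopologicalSpace M] [ChartedSpace (EuclideanSpace ℝ (Fin 4)) M]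
  [IsManifold (𝓡 4) ∞ M]
  {n : ℕ}
  {G : Type*} [TopologicalSpace G] [ChartedSpace (EuclideanSpace ℝ (Fin n)) G]
  [Group G] [LieGroup (𝓡 n) ∞ G]
  {P : Type*} [TopologicalSpace P] [ChartedSpace (EuclideanSpace ℝ (Fin (4 + n))) P]
  [IsManifold (𝓡 (4 + n)) ∞ P]
  {Q : Type*} [TopologicalSpace Q]
  {W : Type*} [NormedAddCommGroup W] [InnerProductSpace ℂ W] [FiniteDimensional ℂ W]
  {V : Type*} [NormedAddCommGroup V] [InnerProductSpace ℂ V] [FiniteDimensional ℂ V]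
  {D : Model (n := n) M G P Q W V}

/-! ### Currents -/

theorem conj_spinInner (ψ φ : Fin 4 → V) :
    (starRingEnd ℂ) (spinInner ψ φ) = spinInner φ ψ := by
  simp [spinInner, gamma, Fin.sum_univ_four]
  ring

/-- The real part of the Hermitian inner product, as a real bilinear map. -/
def reInner (W : Type*) [NormedAddCommGroup W] [InnerProductSpace ℂ W] : W →L[ℝ] W →L[ℝ] ℝ :=
  ((ContinuousLinearMap.compL ℝ W ℂ ℝ) Complex.reCLM).comp (innerL W)

theorem reInner_apply (v w : W) : reInner W v w = (inner ℂ v w).re := rfl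

theorem reInner_symm (v w : W) : reInner W v w = reInner W w v := by
  rw [reInner_apply, reInner_apply, ← inner_conj_symm, Complex.conj_re]

/-- The imaginary part of the spinor inner product, as a real bilinear map. -/
def imSpinInner (V : Type*) [NormedAddCommGroup V] [InnerProductSpace ℂ V] :
    (Fin 4 → V) →L[ℝ] (Fin 4 → V) →L[ℝ] ℝ :=
  ((ContinuousLinearMap.compL ℝ (Fin 4 → V) ℂ ℝ) Complex.imCLM).comp (spinInnerL V)

theorem imSpinInner_apply (ψ φ : Fin 4 → V) : imSpinInner V ψ φ = (spinInner ψ φ).im := by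
  rw [← spinInnerL_apply]; rfl

theorem imSpinInner_skew (ψ φ : Fin 4 → V) : imSpinInner V ψ φ = -imSpinInner V φ ψ := by
  rw [imSpinInner_apply, imSpinInner_apply, ← conj_spinInner φ ψ, Complex.conj_im]

namespace Fields

theorem reInner_higgsRep (Z : LieAlg n) (u v : W) :
    reInner W (higgsRep D Z u) v = -reInner W u (higgsRep D Z v) := by
  rw [reInner_apply, reInner_apply, ← Complex.neg_re]
  exact congrArg Complex.re (D.rho.inner_deriv_left Z u v)

theorem imSpinInner_spinorRep (Z : LieAlg n) (u v : Fin 4 → V) :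
    imSpinInner V (spinorRep D Z u) v = -imSpinInner V u (spinorRep D Z v) := by
  rw [imSpinInner_apply, imSpinInner_apply, ← Complex.neg_im]
  exact congrArg Complex.im (spinInner_twistMul (D.chi.inner_deriv_left Z) u v)

variable (f : Fields D) (σ : LocalGauge D)

/-- The momentum map `Re ⟨u, ρ_*(ξ_a) v⟩ ξ_a`. -/
def higgsMomentum : W →L[ℝ] W →L[ℝ] LieAlg n := momentum σ.xi (higgsRep D) (reInner W)

/-- The momentum map `Im ⟨ψ, χ_*(ξ_a) φ⟩ ξ_a`. -/
def spinorMomentum : (Fin 4 → V) →L[ℝ] (Fin 4 → V) →L[ℝ] LieAlg n :=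
  momentum σ.xi (spinorRep D) (imSpinInner V)

theorem higgsMomentum_apply (u v : W) : higgsMomentum σ u v =
    ∑ a, (inner ℂ u (D.rho.deriv (σ.xi a) v)).re • σ.xi a := momentum_apply _ _ _ _ _

theorem spinorMomentum_apply (ψ φ : Fin 4 → V) : spinorMomentum σ ψ φ =
    ∑ a, (spinInner ψ (twistMul (D.chi.deriv (σ.xi a)) φ)).im • σ.xi a := by
  refine (momentum_apply _ _ _ _ _).trans (Finset.sum_congr rfl fun a _ ↦ ?_)
  rw [imSpinInner_apply]
  rfl

/-- Re⟨·,·⟩ is symmetric and ρ_* is skew for it. -/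
theorem higgsMomentum_skew (u v : W) : higgsMomentum σ u v = -higgsMomentum σ v u := by
  unfold higgsMomentum
  rw [momentum_apply, momentum_apply, ← Finset.sum_neg_distrib]
  refine Finset.sum_congr rfl fun a _ ↦ ?_
  rw [reInner_symm, reInner_higgsRep, neg_smul]

/-- The imaginary part and χ_* are both skew, so the signs cancel; Clifford multiplication is
symmetric and commutes with χ_*. -/
theorem spinorMomentum_gamma (ν : Fin 4) (ψ φ : Fin 4 → V) :
    spinorMomentum σ (spinMul (gamma ν) ψ) φ = spinorMomentum σ (spinMul (gamma ν) φ) ψ := by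
  unfold spinorMomentum
  rw [momentum_apply, momentum_apply]
  refine Finset.sum_congr rfl fun a _ ↦ ?_
  congr 1
  rw [imSpinInner_skew, imSpinInner_spinorRep, neg_neg, imSpinInner_apply, imSpinInner_apply,
    spinInner_gamma]
  exact congrArg (fun T ↦ (spinInner φ T).im) (spinMul_twistMul _ (D.chi.deriv (σ.xi a)) ψ).symm

theorem derivAd_higgsMomentum {u v : M → W} (hu : SmoothOn u σ.dom) (hv : SmoothOn v σ.dom)
    {x : M} (hx : x ∈ σ.dom) (μ : Fin 4) :
    f.derivAd σ μ (fun y ↦ higgsMomentum σ (u y) (v y)) x =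
      higgsMomentum σ (f.derivHiggs σ μ u x) (v x)
        + higgsMomentum σ (u x) (f.derivHiggs σ μ v x) :=
  connDeriv_bilin σ.isOpen_dom (higgsMomentum σ) (fun μ u v ↦
    lieBr_momentum σ.xi_orthonormal higgsRep_lieBr reInner_higgsRep (f.A σ μ x) u v) hu hv hx μ

/-- The gauge part of the connection is absorbed by equivariance of the momentum map. The spin part
contributes nothing, being skew for the spinor product and commuting with χ_*. -/
theorem derivAd_spinorMomentum {u v : M → Fin 4 → V} (hu : SmoothOn u σ.dom)
    (hv : SmoothOn v σ.dom) {x : M} (hx : x ∈ σ.dom) (μ : Fin 4) :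
    f.derivAd σ μ (fun y ↦ spinorMomentum σ (u y) (v y)) x =
      spinorMomentum σ (f.derivSpinor σ μ u x) (v x)
        + spinorMomentum σ (u x) (f.derivSpinor σ μ v x) := by
  refine connDeriv_bilin σ.isOpen_dom (spinorMomentum σ) (fun μ u v ↦ ?_) hu hv hx μ
  have h1 : spinorMomentum σ (spinConn D.metric σ.e (cliff V) μ x u) v
      + spinorMomentum σ u (spinConn D.metric σ.e (cliff V) μ x v) = 0 := by
    unfold spinorMomentum
    rw [momentum_apply, momentum_apply, ← Finset.sum_add_distrib]
    refine Finset.sum_eq_zero fun a _ ↦ ?_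
    have h2 : spinorRep D (σ.xi a) (spinConn D.metric σ.e (cliff V) μ x v) =
        spinConn D.metric σ.e (cliff V) μ x (spinorRep D (σ.xi a) v) :=
      (DFunLike.congr_fun (spinGen_mul_twistL
        (fun ν κ ↦ YMHD.christoffel D.metric σ.e μ ν κ x) (D.chi.deriv (σ.xi a))) v).symm
    have h3 := spinInner_spinGen (V := V) (a := fun ν κ ↦ YMHD.christoffel D.metric σ.e μ ν κ x)
      (fun ν κ ↦ christoffel_skew D.metric σ.e μ ν κ x) u (spinorRep D (σ.xi a) v)
    rw [h2, ← add_smul, imSpinInner_apply, imSpinInner_apply]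
    unfold spinConn
    rw [h3, Complex.neg_im, neg_add_cancel, zero_smul]
  have h2 : f.connAd σ μ x (spinorMomentum σ u v) =
      spinorMomentum σ (spinorRep D (f.A σ μ x) u) v
        + spinorMomentum σ u (spinorRep D (f.A σ μ x) v) :=
    lieBr_momentum σ.xi_orthonormal spinorRep_lieBr imSpinInner_spinorRep (f.A σ μ x) u v
  rw [h2, connSpinor_eq]
  simp only [add_apply, map_add]
  rw [← zero_add (spinorMomentum σ (spinorRep D (f.A σ μ x) u) v
    + spinorMomentum σ u (spinorRep D (f.A σ μ x) v)), ← h1]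
  abel

theorem smoothOn_spinMul {u : M → Fin 4 → V} {s : Set M} (hu : SmoothOn u s)
    (S : Matrix (Fin 4) (Fin 4) ℂ) : SmoothOn (fun y ↦ spinMul S (u y)) s := by
  simp only [← spinEnd_apply]
  exact hu.clm (spinEnd V S)

/-- Lowering the index in `connDeriv_clifford` turns -Γ_{μκ}^ν γ^κ into +Γ_{μν}^κ γ_κ, because Γ is
skew once its last index is lowered. -/
theorem derivSpinor_gamma {u : M → Fin 4 → V} (hu : SmoothOn u σ.dom) {x : M} (hx : x ∈ σ.dom)
    (μ ν : Fin 4) : f.derivSpinor σ μ (fun y ↦ spinMul (gamma ν) (u y)) x =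
      spinMul (gamma ν) (f.derivSpinor σ μ u x)
        + ∑ κ, christoffelUp D.metric σ.e μ ν κ x • spinMul (gamma κ) (u x) := by
  have h1 : ∀ (κ : Fin 4) (ψ : Fin 4 → V), spinMul (gamma κ) ψ = eta κ • cliff V κ ψ := by
    intro κ ψ
    rw [← spinMul_gamma_eq, smul_smul, eta_mul_self, one_smul]
  have h2 := connDeriv_clifford σ.isOrthonormalFrame isClifford_cliff
    (fun μ x ν ↦ spinorRep_mul_cliff (D := D) (f.A σ μ x) ν) hu hx μ ν
  rw [← connSpinor_eq] at h2
  simp only [h1]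
  rw [(f.isCovDeriv_derivSpinor σ).const_smul μ (eta ν) (hu.clm (cliff V ν)) hx]
  unfold derivSpinor
  rw [h2, smul_sub, sub_eq_add_neg, Finset.smul_sum, ← Finset.sum_neg_distrib]
  refine congrArg _ (Finset.sum_congr rfl fun κ _ ↦ ?_)
  rw [smul_smul, smul_smul, ← neg_smul, christoffelUp_skew μ ν κ]
  congr 1
  linear_combination (eta ν * christoffelUp D.metric σ.e μ κ ν x) * eta_mul_self κ

theorem higgsCurrent_eq (ν : Fin 4) (x : M) : f.higgsCurrent σ ν x =
    higgsMomentum σ (f.derivHiggs σ ν (f.phi σ) x) (f.phi σ x) := by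
  rw [higgsMomentum_apply, ← nablaPhi_eq]
  rfl

theorem diracCurrent_eq (ν : Fin 4) (x : M) : f.diracCurrent σ ν x =
    spinorMomentum σ (spinMul (gamma ν) (f.psi σ x)) (f.psi σ x) := by
  rw [spinorMomentum_apply]
  rfl

theorem smoothOn_higgsCurrent : SmoothOn (fun x ν ↦ f.higgsCurrent σ ν x) σ.dom :=
  SmoothOn.pi fun ν ↦ by
    simp only [higgsCurrent_eq]
    exact SmoothOn.bilin (higgsMomentum σ)
      ((f.isCovDeriv_derivHiggs σ).smooth ν (f.smoothOn_phi σ)) (f.smoothOn_phi σ)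

theorem smoothOn_diracCurrent : SmoothOn (fun x ν ↦ f.diracCurrent σ ν x) σ.dom :=
  SmoothOn.pi fun ν ↦ by
    simp only [diracCurrent_eq]
    exact SmoothOn.bilin (spinorMomentum σ) (smoothOn_spinMul (f.smoothOn_psi σ) _)
      (f.smoothOn_psi σ)

/-- The exterior covariant derivative of the Higgs current. -/
theorem extDeriv_higgsCurrent {x : M} (hx : x ∈ σ.dom) (μ ν : Fin 4) :
    oneFormDeriv D.metric σ.e (f.derivAd σ) μ (fun x ν ↦ f.higgsCurrent σ ν x) x ν
      - oneFormDeriv D.metric σ.e (f.derivAd σ) ν (fun x ν ↦ f.higgsCurrent σ ν x) x μ =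
      f.higgsCurvCurrent σ μ ν x - f.higgsWedgeCurrent σ μ ν x := by
  have hD := f.isCovDeriv_derivHiggs σ
  -- The Γ term of the one-form index completes the second derivative of Φ to its Hessian; the minus
  -- sign on the other term is the skewness of the momentum map.
  have h1 : ∀ μ ν, oneFormDeriv D.metric σ.e (f.derivAd σ) μ
      (fun x ν ↦ f.higgsCurrent σ ν x) x ν =
      higgsMomentum σ (hess D.metric σ.e (f.derivHiggs σ) (f.phi σ) μ ν x) (f.phi σ x)
        - higgsMomentum σ (f.nablaPhi σ μ x) (f.nablaPhi σ ν x) := by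
    intro μ ν
    unfold oneFormDeriv hess
    simp only [higgsCurrent_eq, nablaPhi_eq]
    rw [f.derivAd_higgsMomentum σ (hD.smooth ν (f.smoothOn_phi σ)) (f.smoothOn_phi σ) hx,
      higgsMomentum_skew σ (f.derivHiggs σ ν (f.phi σ) x), map_sub, sub_apply, map_sum, sum_apply]
    simp only [map_smul, smul_apply]
    abel
  have h2 := hess_sub_hess (f.hasCurvature_derivHiggs σ) (f.smoothOn_phi σ) hx μ ν
  -- As F is already skew, passing from e^μ ∧ e^ν to components doubles the coefficient ½.
  have h3 : f.higgsCurvCurrent σ μ ν x =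
      higgsMomentum σ (D.rho.deriv (f.F σ μ ν x) (f.phi σ x)) (f.phi σ x) := by
    have h4 : ∀ μ ν, ∑ a, ((1 / 2 : ℝ) * (inner ℂ (D.rho.deriv (f.F σ μ ν x) (f.phi σ x))
        (D.rho.deriv (σ.xi a) (f.phi σ x))).re) • σ.xi a =
        (1 / 2 : ℝ) • higgsMomentum σ (higgsRep D (f.F σ μ ν x) (f.phi σ x)) (f.phi σ x) := by
      intro μ ν
      rw [higgsMomentum_apply, Finset.smul_sum]
      simp only [mul_smul]
      rfl
    unfold higgsCurvCurrent wedgeComp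
    beta_reduce
    rw [h4, h4, f.F_skew σ hx ν μ, map_neg, neg_apply, map_neg, neg_apply]
    change _ = higgsMomentum σ (higgsRep D (f.F σ μ ν x) (f.phi σ x)) (f.phi σ x)
    module
  have h4 : f.higgsWedgeCurrent σ μ ν x = higgsMomentum σ (f.nablaPhi σ μ x) (f.nablaPhi σ ν x)
      - higgsMomentum σ (f.nablaPhi σ ν x) (f.nablaPhi σ μ x) := by
    rw [higgsMomentum_apply, higgsMomentum_apply]
    rfl
  rw [h1, h1, h3, h4, ← h2, map_sub, sub_apply]
  abel

/-- The exterior covariant derivative of the Dirac current. -/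
theorem extDeriv_diracCurrent {x : M} (hx : x ∈ σ.dom) (μ ν : Fin 4) :
    oneFormDeriv D.metric σ.e (f.derivAd σ) μ (fun x ν ↦ f.diracCurrent σ ν x) x ν
      - oneFormDeriv D.metric σ.e (f.derivAd σ) ν (fun x ν ↦ f.diracCurrent σ ν x) x μ =
      (-2 : ℝ) • f.diracWedgeCurrent σ μ ν x := by
  -- The Γ term from differentiating γ_ν cancels that of the one-form index, and the two halves of
  -- the product rule coincide by `spinorMomentum_gamma`, whence the factor 2.
  have h1 : ∀ μ ν, oneFormDeriv D.metric σ.e (f.derivAd σ) μ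
      (fun x ν ↦ f.diracCurrent σ ν x) x ν =
      (2 : ℝ) • spinorMomentum σ (spinMul (gamma ν) (f.psi σ x)) (f.nablaPsi σ μ x) := by
    intro μ ν
    unfold oneFormDeriv
    simp only [diracCurrent_eq, nablaPsi_eq]
    rw [f.derivAd_spinorMomentum σ (smoothOn_spinMul (f.smoothOn_psi σ) _) (f.smoothOn_psi σ) hx,
      f.derivSpinor_gamma σ (f.smoothOn_psi σ) hx, map_add, add_apply, map_sum, sum_apply,
      spinorMomentum_gamma σ ν (f.derivSpinor σ μ (f.psi σ) x)]
    simp only [map_smul, smul_apply]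
    rw [two_smul]
    abel
  have h2 : ∀ μ ν, ∑ a, ((1 / 2 : ℝ) *
      (spinInner (spinMul (gamma μ) (f.psi σ x))
          (twistMul (D.chi.deriv (σ.xi a)) (f.nablaPsi σ ν x))
        - spinInner (spinMul (gamma ν) (f.psi σ x))
          (twistMul (D.chi.deriv (σ.xi a)) (f.nablaPsi σ μ x))).im) • σ.xi a =
      (1 / 2 : ℝ) • (spinorMomentum σ (spinMul (gamma μ) (f.psi σ x)) (f.nablaPsi σ ν x)
        - spinorMomentum σ (spinMul (gamma ν) (f.psi σ x)) (f.nablaPsi σ μ x)) := by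
    intro μ ν
    rw [spinorMomentum_apply, spinorMomentum_apply, ← Finset.sum_sub_distrib, Finset.smul_sum]
    simp only [mul_smul, Complex.sub_im, sub_smul]
  unfold diracWedgeCurrent wedgeComp
  beta_reduce
  rw [h1, h1, h2, h2]
  module

/-! ### The wave equation -/

theorem smoothOn_F_pi : SmoothOn (fun x μ ν ↦ f.F σ μ ν x) σ.dom :=
  SmoothOn.pi fun μ ↦ SmoothOn.pi fun ν ↦ f.smoothOn_F σ μ ν

theorem F_bianchi {x : M} (hx : x ∈ σ.dom) (κ μ ν : Fin 4) :
    oneFormDeriv D.metric σ.e (oneFormDeriv D.metric σ.e (f.derivAd σ)) κ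
        (fun x μ ν ↦ f.F σ μ ν x) x μ ν
      + oneFormDeriv D.metric σ.e (oneFormDeriv D.metric σ.e (f.derivAd σ)) μ
        (fun x μ ν ↦ f.F σ μ ν x) x ν κ
      + oneFormDeriv D.metric σ.e (oneFormDeriv D.metric σ.e (f.derivAd σ)) ν
        (fun x μ ν ↦ f.F σ μ ν x) x κ μ = 0 := by
  have hD := ((f.isCovDeriv_derivAd σ).oneFormDeriv σ.isOrthonormalFrame).oneFormDeriv
    σ.isOrthonormalFrame
  simp only [hD.congr _ (f.eqOn_F σ) hx]
  exact curvatureForm_bianchi σ.isOrthonormalFrame (f.smoothOn_A σ) hx κ μ ν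

/-- The Yang-Mills equation solved for the divergence; the codifferential carries the opposite sign.
-/
theorem sum_nablaF (hf : f.SolvesEulerLagrange) {x : M} (hx : x ∈ σ.dom) (ν : Fin 4) :
    ∑ κ, eta κ • oneFormDeriv D.metric σ.e (oneFormDeriv D.metric σ.e (f.derivAd σ)) κ
        (fun x μ ν ↦ f.F σ μ ν x) x κ ν =
      f.higgsCurrent σ ν x - (1 / 2 : ℝ) • f.diracCurrent σ ν x := by
  have h1 : ∀ κ, f.nablaF σ κ κ ν x =
      oneFormDeriv D.metric σ.e (oneFormDeriv D.metric σ.e (f.derivAd σ)) κ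
        (fun x μ ν ↦ f.F σ μ ν x) x κ ν := fun κ ↦ covDeriv_two _ _ κ κ ν x
  have h2 := hf.yangMills σ x hx ν
  unfold codiffF at h2
  simp only [h1] at h2
  rw [add_sub_assoc] at h2
  exact (neg_add_eq_zero.1 h2)

/-- Combines `twoForm_box`, whose divergence is the current, with the exterior derivatives of the
two parts of that current. -/
theorem boxF_eq (hf : f.SolvesEulerLagrange) {x : M} (hx : x ∈ σ.dom) (μ ν : Fin 4) :
    f.boxF σ μ ν x = f.bracketFF σ μ ν x + f.curvF σ μ ν x + f.diracWedgeCurrent σ μ ν x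
      + f.higgsCurvCurrent σ μ ν x - f.higgsWedgeCurrent σ μ ν x := by
  have hfr := σ.isOrthonormalFrame
  have h1 := twoForm_box hfr (f.isCovDeriv_derivAd σ) (f.smoothOn_F_pi σ)
    (f.hasCurvature_derivAd σ) (fun x hx ↦ f.F_skew σ hx) (fun x hx ↦ f.F_bianchi σ hx)
    (J := fun x ν ↦ f.higgsCurrent σ ν x - (1 / 2 : ℝ) • f.diracCurrent σ ν x)
    (fun x hx ↦ f.sum_nablaF σ hf hx) hx μ ν
  have h2 : f.boxF σ μ ν x = _ := (box_two _ _ μ ν x).trans h1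
  have hD1 := (f.isCovDeriv_derivAd σ).oneFormDeriv hfr
  have h3 : ∀ μ ν, oneFormDeriv D.metric σ.e (f.derivAd σ) μ
      (fun x ν ↦ f.higgsCurrent σ ν x - (1 / 2 : ℝ) • f.diracCurrent σ ν x) x ν =
      oneFormDeriv D.metric σ.e (f.derivAd σ) μ (fun x ν ↦ f.higgsCurrent σ ν x) x ν
        - (1 / 2 : ℝ) •
          oneFormDeriv D.metric σ.e (f.derivAd σ) μ (fun x ν ↦ f.diracCurrent σ ν x) x ν := by
    intro μ ν
    have h4 := hD1.sub μ (f.smoothOn_higgsCurrent σ)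
      ((SmoothOn.const (1 / 2 : ℝ)).smul (f.smoothOn_diracCurrent σ)) hx
    rw [hD1.const_smul μ _ (f.smoothOn_diracCurrent σ) hx] at h4
    exact congrFun h4 ν
  -- One of the Riemann terms is a trace over its first and third indices, which is minus the Ricci
  -- tensor by skewness in the last pair.
  have h4 : ∀ μ ν, ∑ κ, eta κ • (lieBr G (f.F σ κ μ x) (f.F σ κ ν x)
        - ∑ ρ, riemannUp D.metric σ.e κ μ ν ρ x • f.F σ κ ρ x
        - ∑ ρ, riemannUp D.metric σ.e κ μ κ ρ x • f.F σ ρ ν x) =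
      ∑ κ, eta κ • lieBr G (f.F σ κ μ x) (f.F σ κ ν x)
        - ∑ κ, ∑ ρ, (σ.riemann κ μ ν ρ x * eta κ * eta ρ) • f.F σ κ ρ x
        + ∑ ρ, (σ.ricci μ ρ x * eta ρ) • f.F σ ρ ν x := by
    intro μ ν
    have h5 : ∑ ρ, (σ.ricci μ ρ x * eta ρ) • f.F σ ρ ν x =
        -∑ κ, eta κ • ∑ ρ, riemannUp D.metric σ.e κ μ κ ρ x • f.F σ ρ ν x := by
      simp only [LocalGauge.ricci, YMHD.ricci, Finset.sum_mul, Finset.sum_smul, Finset.smul_sum,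
        smul_smul, ← Finset.sum_neg_distrib, ← neg_smul]
      rw [Finset.sum_comm]
      refine Finset.sum_congr rfl fun κ _ ↦ Finset.sum_congr rfl fun ρ _ ↦ ?_
      rw [riemannUp_eq, riemann_skew hfr hx κ μ κ ρ]
      congr 1
      ring
    have h6 : ∑ κ, ∑ ρ, (σ.riemann κ μ ν ρ x * eta κ * eta ρ) • f.F σ κ ρ x =
        ∑ κ, eta κ • ∑ ρ, riemannUp D.metric σ.e κ μ ν ρ x • f.F σ κ ρ x := by
      simp only [Finset.smul_sum, smul_smul]
      refine Finset.sum_congr rfl fun κ _ ↦ Finset.sum_congr rfl fun ρ _ ↦ ?_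
      rw [riemannUp_eq]
      congr 1
      unfold LocalGauge.riemann
      ring
    rw [h5, h6]
    simp only [smul_sub, Finset.sum_sub_distrib]
    abel
  -- Since F is skew, the two Ricci terms become equal after antisymmetrisation, which removes the
  -- factor ½.
  have h5 : f.curvF σ μ ν x =
      (∑ ρ, (σ.ricci μ ρ x * eta ρ) • f.F σ ρ ν x - ∑ ρ, (σ.ricci ν ρ x * eta ρ) • f.F σ ρ μ x)
      - (∑ κ, ∑ ρ, (σ.riemann κ μ ν ρ x * eta κ * eta ρ) • f.F σ κ ρ x
        - ∑ κ, ∑ ρ, (σ.riemann κ ν μ ρ x * eta κ * eta ρ) • f.F σ κ ρ x) := by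
    have h6 : ∀ μ ν, ∑ α, (σ.ricci ν α x * eta α) • f.F σ μ α x =
        -∑ α, (σ.ricci ν α x * eta α) • f.F σ α μ x := by
      intro μ ν
      rw [← Finset.sum_neg_distrib]
      exact Finset.sum_congr rfl fun α _ ↦ by rw [f.F_skew σ hx μ α, smul_neg]
    unfold curvF wedgeComp
    beta_reduce
    rw [h6 μ ν, h6 ν μ]
    module
  have h6 : f.bracketFF σ μ ν x = ∑ κ, eta κ • lieBr G (f.F σ κ μ x) (f.F σ κ ν x)
      - ∑ κ, eta κ • lieBr G (f.F σ κ ν x) (f.F σ κ μ x) := rfl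
  -- The weight -½ of the Dirac current in the divergence meets the factor -2 of its exterior
  -- derivative, so the Dirac term enters with coefficient 1.
  rw [h3, h3, h4, h4, sub_sub_sub_comm, ← smul_sub, f.extDeriv_higgsCurrent σ hx,
    f.extDeriv_diracCurrent σ hx] at h2
  rw [h2, h5, h6]
  module

theorem boxPhi_eq (hf : f.SolvesEulerLagrange) {x : M} (hx : x ∈ σ.dom) :
    f.boxPhi σ x = (1 / 2 : ℝ) • f.gradU σ x + f.yukawaCurrent σ x := by
  have h1 := hf.higgsEq σ x hx
  rw [sub_sub] at h1
  exact sub_eq_zero.1 h1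

end Fields

end FieldStrength

end YMHD

end

/-- Solutions of the Yang-Mills-Higgs-Dirac system satisfy a coupled system of wave equations. -/
theorem theorem3p3
    {M : Type*} [TopologicalSpace M] [ChartedSpace (EuclideanSpace ℝ (Fin 4)) M]
    [IsManifold (𝓡 4) ∞ M]
    {n : ℕ}
    {G : Type*} [TopologicalSpace G] [ChartedSpace (EuclideanSpace ℝ (Fin n)) G]
    [Group G] [LieGroup (𝓡 n) ∞ G] [CompactSpace G]
    {P : Type*} [TopologicalSpace P] [ChartedSpace (EuclideanSpace ℝ (Fin (4 + n))) P]
    [IsManifold (𝓡 (4 + n)) ∞ P]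
    {Q : Type*} [TopologicalSpace Q]
    {W : Type*} [NormedAddCommGroup W] [InnerProductSpace ℂ W] [FiniteDimensional ℂ W]
    {V : Type*} [NormedAddCommGroup V] [InnerProductSpace ℂ V] [FiniteDimensional ℂ V]
    (D : Model (n := n) M G P Q W V) (f : Fields D) (hf : f.SolvesEulerLagrange) :
    ∀ σ : LocalGauge D, ∀ x ∈ σ.dom,
      (∀ μ ν, f.boxF σ μ ν x =
        f.bracketFF σ μ ν x + f.curvF σ μ ν x + f.diracWedgeCurrent σ μ ν x
          + f.higgsCurvCurrent σ μ ν x - f.higgsWedgeCurrent σ μ ν x) ∧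
      f.boxPhi σ x = (1 / 2 : ℝ) • f.gradU σ x + f.yukawaCurrent σ x ∧
      f.boxPsi σ x = (1 / 4 * σ.scal x) • f.psi σ x + f.curvPsi σ x + f.yukawaNablaPsi σ x
        - twistMul (D.Y (f.phi σ x)) (twistMul (D.Y (f.phi σ x)) (f.psi σ x)) := fun σ _ hx ↦
  ⟨fun μ ν ↦ f.boxF_eq σ hf hx μ ν, f.boxPhi_eq σ hf hx, f.boxPsi_eq σ hf hx⟩
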